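/- Let $N\ge 3$, $0\le\mu\le (N-2)^2/8$, $2^*=\frac{2N}{N-2}$, $\beta=\frac{N-2}{4}$ and $K(y)=e^{|y|^2/4}$. Let $L^2_K$ be the $L^2$ space over $\mathbb{R}^N$ with respect to the measure $K(y)\,dy$, with norm $\|\cdot\|_{K,2}$ and inner product $(\cdot,\cdot)_{K}$ (also for vector fields), and let $X$ be the Hilbert space obtained as the completion of $C_c^\infty(\mathbb{R}^N)$ with respect to the norm $\|\nabla v\|_{K,2}$. Consider the problem $$v_s-\Delta v-\tfrac12\,y\cdot\nabla v=\beta v+\frac{\mu v}{|y|^2}+|v|^{2^*-2}v,\qquad v|_{s=0}=v_0\in X. \tag{2.1}$$ For $0<S\le\infty$, a weak solution of (2.1) on $(0,S)$ is a function $v$ with $v\in L^\infty(0,S;X)$, $v_s\in L^2(0,S;L^2_K)$, $v(0)=v_0$, and $$\int_0^s \big[(v_s,w)_K+(\nabla v,\nabla w)_K\big]\,d\tau=\int_0^s\int_{\mathbb{R}^N}\Big(|v|^{2^*-2}v+\frac{\mu v}{|y|^2}+\beta v\Big)w\,K\,dy\,d\tau\qquad\text{for all } w\in X,\ 0<s<S.$$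 A global solution is a function $v:[0,\infty)\to X$ (its representative that is continuous in time with values in $L^2_K$) which either is a weak solution on $(0,\infty)$, or belongs to $C([0,\infty);X)$ and is a weak solution on $(0,S)$ for every finite $S$. A stationary solution is a $w\in X$ with $$(\nabla w,\nabla\varphi)_K=\int_{\mathbb{R}^N}\Big(|w|^{2^*-2}w+\frac{\mu w}{|y|^2}+\beta w\Big)\varphi\,K\,dy\qquad\text{for all }\varphi\in X.$$ Put $$E_K(v)=\frac12\int_{\mathbb{R}^N}\Big(|\nabla v|^2-\mu\frac{|v|^2}{|y|^2}-\beta|v|^2\Big)K\,dy-\frac1{2^*}\int_{\mathbb{R}^N}|v|^{2^*}K\,dy .$$ Theorem 6.2. Let $v$ be a global solution of (2.1). Then its $\omega$-limit set $$\omega(v_0)=\{w\in X:\ \exists\, s_n\to+\infty,\ v(s_n)\rightharpoonup w\ \text{in } X\}$$ contains a stationary solution $w$. Moreover, $w$ can be obtained as follows: there are times $s_n>0$, $s_n\to\infty$, at which $v$ is differentiable in time with values in $L^2_K$, such that $\|v_s(s_n)\|_{K,2}\to0$, the sequence $v(s_n)$ is a Palais–Smale sequence of $E_K$ (that is, $E_K(v(s_n))$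 converges in $\mathbb{R}$ and $E_K'(v(s_n))\to0$ in the dual of $X$), and $v(s_n)\rightharpoonup w$ weakly in $X$. -/

import Mathlib

open MeasureTheory Filter Topology Set
open scoped ContDiff InnerProductSpace

noncomputable section

namespace HardySobolev

/-- Euclidean space `ℝ^N`. -/
abbrev Space (N : ℕ) : Type := EuclideanSpace ℝ (Fin N)

/-- The weight `K(y) = exp(|y|² / 4)`. -/
def weight {N : ℕ} (y : Space N) : ℝ := Real.exp (‖y‖ ^ 2 / 4)

/-- The measure `K(y) dy`. -/
def measureK (N : ℕ) : Measure (Space N) :=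
  volume.withDensity fun y => ENNReal.ofReal (weight y)

/-- `L²_K(ℝ^N)`, with its inner product `∫ u v K dy`. -/
abbrev L2K (N : ℕ) : Type := Lp ℝ 2 (measureK N)

/-- `L²_K(ℝ^N; ℝ^N)`, the space of weighted square integrable vector fields. -/
abbrev L2KVec (N : ℕ) : Type := Lp (Space N) 2 (measureK N)

/-- The pairs `(φ, ∇φ)` with `φ ∈ C_c^∞(ℝ^N)`. -/
def testGraph (N : ℕ) : Submodule ℝ (L2K N × L2KVec N) where
  carrier := {p | ∃ φ : Space N → ℝ, ContDiff ℝ ∞ φ ∧ HasCompactSupport φ ∧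
    p.1 =ᵐ[measureK N] φ ∧ p.2 =ᵐ[measureK N] gradient φ}
  zero_mem' := by
    refine ⟨0, contDiff_const, HasCompactSupport.zero, Lp.coeFn_zero _ _ _, ?_⟩
    have h : gradient (0 : Space N → ℝ) = 0 := by
      funext x; simp [gradient]
    rw [h]; exact Lp.coeFn_zero _ _ _
  add_mem' := by
    rintro p q ⟨φ, hφ, cφ, h1, h2⟩ ⟨ψ, hψ, cψ, k1, k2⟩
    refine ⟨φ + ψ, hφ.add hψ, cφ.add cψ, ?_, ?_⟩
    · exact (Lp.coeFn_add _ _).trans (h1.add k1)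
    · have h : gradient (φ + ψ) = gradient φ + gradient ψ := by
        funext x
        simp only [gradient, Pi.add_apply]
        rw [fderiv_add (hφ.differentiable (by simp) x) (hψ.differentiable (by simp) x), map_add]
      rw [h]
      exact (Lp.coeFn_add _ _).trans (h2.add k2)
  smul_mem' := by
    rintro c p ⟨φ, hφ, cφ, h1, h2⟩
    refine ⟨c • φ, contDiff_const.smul hφ, cφ.smul_left (f := fun _ => c), ?_, ?_⟩
    · exact (Lp.coeFn_smul _ _).trans (h1.const_smul c)
    · have h : gradient (c • φ) = c • gradient φ := by
        funext x
        simp only [gradient, Pi.smul_apply]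
        rw [fderiv_const_smul (hφ.differentiable (by simp) x), map_smulₛₗ]
        simp
      rw [h]
      exact (Lp.coeFn_smul _ _).trans (h2.const_smul c)

/-- The energy space `X`, the completion of `C_c^∞(ℝ^N)` for the norm `‖∇v‖_{K,2}`. By the
weighted Poincaré inequality `(N/2) ‖φ‖²_{K,2} ≤ ‖∇φ‖²_{K,2}`, a sequence of test functions whose
gradients are Cauchy in `L²_K` is itself Cauchy in `L²_K`, so the completion is realized by the
pairs `(v, ∇v)` which are limits in `L²_K × L²_K` of pairs `(φ, ∇φ)`. The norm and the inner
product of `X` are always those of the gradient component. -/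
abbrev X (N : ℕ) : Type := (testGraph N).topologicalClosure

/-- The function underlying an element of `X`. -/
def X.fn {N : ℕ} (v : X N) : L2K N := v.1.1

/-- The (weak) gradient of an element of `X`. -/
def X.grad {N : ℕ} (v : X N) : L2KVec N := v.1.2

/-- The critical Sobolev exponent `2* = 2N/(N-2)`. -/
def critExp (N : ℕ) : ℝ := 2 * N / ((N : ℝ) - 2)

/-- `β = (N-2)/4`, which is `1/(p-1)` for `p = 2* - 1`. -/
def beta (N : ℕ) : ℝ := ((N : ℝ) - 2) / 4

/-- `∫ (|v|^{2*-2} v + μ v/|y|² + β v) w K dy` for `v, w ∈ X`. By the weighted Sobolev and Hardy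
inequalities the integrand is integrable. -/
def reaction {N : ℕ} (μ : ℝ) (v w : X N) : ℝ :=
  ∫ y, (|v.fn y| ^ (critExp N - 2) * v.fn y + μ * (v.fn y / ‖y‖ ^ 2) + beta N * v.fn y) * w.fn y
    ∂(measureK N)

/-- The energy
`E_K(v) = ½ ∫ (|∇v|² - μ |v|²/|y|² - β |v|²) K dy - (1/2*) ∫ |v|^{2*} K dy`. -/
def energy {N : ℕ} (μ : ℝ) (v : X N) : ℝ :=
  1 / 2 * (‖v.grad‖ ^ 2 - μ * ∫ y, v.fn y ^ 2 / ‖y‖ ^ 2 ∂(measureK N) - beta N * ‖v.fn‖ ^ 2)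
    - 1 / critExp N * ∫ y, |v.fn y| ^ critExp N ∂(measureK N)

/-- The differential `⟨E_K'(v), w⟩` of the energy at `v ∈ X` in the direction `w ∈ X`. -/
def denergy {N : ℕ} (μ : ℝ) (v w : X N) : ℝ :=
  ⟪v.grad, w.grad⟫_ℝ - reaction μ v w

/-- Stationary solutions: weak solutions `w ∈ X` of
`-Δw - ½ y·∇w = β w + μ w/|y|² + |w|^{2*-2} w`. -/
def IsStationarySolution {N : ℕ} (μ : ℝ) (w : X N) : Prop :=
  ∀ φ : X N, ⟪w.grad, φ.grad⟫_ℝ = reaction μ w φ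

/-- The time interval `(0, S)`, where `0 < S ≤ ∞`. -/
def timeInterval (S : EReal) : Set ℝ := {s | 0 < s ∧ (s : EReal) < S}

/-- `v` is a weak solution on `ℝ^N × (0, S)` with initial value `v₀ ∈ X`:
`v ∈ L^∞(0, S; X)`, `v_s ∈ L²(0, S; L²_K)`, and the equation holds in integrated form against
every `w ∈ X`. The function `v` is the representative that is continuous in time with values in
`L²_K`, so that `v_s` is its time derivative exactly if it integrates to the increments of `v`.
Values of `v` at negative times are irrelevant. -/
def IsWeakSolution {N : ℕ} (μ : ℝ) (S : EReal) (v₀ : X N) (v : ℝ → X N) : Prop :=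
  v 0 = v₀ ∧
  MemLp (fun s => (v s).grad) ⊤ (volume.restrict (timeInterval S)) ∧
  ∃ vs : ℝ → L2K N, MemLp vs 2 (volume.restrict (timeInterval S)) ∧
    (∀ s ∈ timeInterval S, (v s).fn = v₀.fn + ∫ τ in (0 : ℝ)..s, vs τ) ∧
    ∀ w : X N, ∀ s ∈ timeInterval S,
      ∫ τ in (0 : ℝ)..s, (⟪vs τ, w.fn⟫_ℝ + ⟪(v τ).grad, w.grad⟫_ℝ)
        = ∫ τ in (0 : ℝ)..s, reaction μ (v τ) w

/-- Global solutions. Either `v` is a weak solution on `(0, ∞)` (in particular bounded in `X`), or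
`v ∈ C([0, ∞); X)` and `v` is a weak solution on `(0, S)` for every finite `S` (the class in which
the problem is locally well posed; no bound uniform in time is required). -/
def IsGlobalSolution {N : ℕ} (μ : ℝ) (v₀ : X N) (v : ℝ → X N) : Prop :=
  IsWeakSolution μ ⊤ v₀ v ∨
    (ContinuousOn (fun s => (v s).grad) (Ici 0) ∧
      ∀ S : ℝ, 0 < S → IsWeakSolution μ (S : EReal) v₀ v)

/-- Weak convergence `u_n ⇀ w` in the Hilbert space `X`. -/
def WeakTendsto {N : ℕ} (u : ℕ → X N) (w : X N) : Prop :=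
  ∀ φ : X N, Tendsto (fun n => ⟪(u n).grad, φ.grad⟫_ℝ) atTop (𝓝 ⟪w.grad, φ.grad⟫_ℝ)

/-- The set of all weak limits in `X` of `v(s_n)` along sequences `s_n → +∞`. -/
def omegaLimitSet {N : ℕ} (v : ℝ → X N) : Set (X N) :=
  {w | ∃ s : ℕ → ℝ, Tendsto s atTop atTop ∧ WeakTendsto (fun n => v (s n)) w}

/-- Palais–Smale sequences of `E_K`: the energies converge and `E_K'(u_n) → 0` in the dual
of `X`. -/
def IsPalaisSmale {N : ℕ} (μ : ℝ) (u : ℕ → X N) : Prop :=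
  (∃ c : ℝ, Tendsto (fun n => energy μ (u n)) atTop (𝓝 c)) ∧
  ∃ ε : ℕ → ℝ, Tendsto ε atTop (𝓝 0) ∧
    ∀ n, ∀ φ : X N, |denergy μ (u n) φ| ≤ ε n * ‖φ.grad‖

end HardySobolev

end

open HardySobolev

/-! The equation is the gradient flow of `E_K` in `L²_K`: at almost every time `E_K'(v) = -(v_s,
·)_K`, and formally the energy decays at the rate `‖v_s‖²`. If `v_s` is square integrable on the
half-line, it tends to zero along suitable times `s_n → ∞`, and by the Poincaré inequality
`E_K'(v(s_n)) → 0` in the dual of `X`. If moreover `v(s_n)` is bounded in `X`, a subsequence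
converges weakly and its energies converge. Tested against a fixed element, `E_K'` is continuous
along bounded weakly convergent sequences, so the weak limit is stationary
(`exists_stationary_of_seq`). The critical exponent is harmless here: `WeakTendsto.tendsto_nonlin`
needs only local `L¹` convergence, not compactness in `L^{2*}`.

The functional setting comes from weighted Poincaré, Hardy and Sobolev inequalities, all obtained by
completing a square and integrating the divergence of `F(y) y`. As `μ` is at most half the Hardy
constant, the quadratic part of the energy is coercive (`form_coercive`).

For a weak solution on `(0, ∞)` the two bounds belong to the definition. For a solution that is only
continuous in `X` they are proved. Since `v_s` takes values in `L²_K` and not in `X`, the chain rule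
for the energy is unavailable; `IsFlow.energy_add_integral_le` derives the dissipation inequality
from difference quotients, using compactness of the trajectory on bounded time intervals to control
the critical term. A concavity argument shows that negative energy would force blow-up
(`IsFlow.energy_nonneg`), so the energy bounds `∫ ‖v_s‖²`. Finally `(1/2 - 1/2*)` times the
quadratic form is the energy minus `E_K'(v)v / 2*`, which bounds `v` in `X` whenever `‖v_s‖ ≤ 1`
(`IsFlow.exists_norm_grad_le`). -/

noncomputable section

namespace HardySobolev

/-! ### The weighted measure and its comparison with Lebesgue measure. -/

section Measure

variable {N : ℕ}

lemma continuous_weight : Continuous (weight : Space N → ℝ) := by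
  unfold weight; fun_prop

lemma weight_pos (y : Space N) : 0 < weight y := Real.exp_pos _

lemma one_le_weight (y : Space N) : 1 ≤ weight y := Real.one_le_exp (by positivity)

lemma measurable_ofReal_weight : Measurable fun y : Space N => ENNReal.ofReal (weight y) :=
  continuous_weight.measurable.ennreal_ofReal

lemma volume_absolutelyContinuous : (volume : Measure (Space N)) ≪ measureK N :=
  withDensity_absolutelyContinuous' measurable_ofReal_weight.aemeasurable
    (Eventually.of_forall fun y => by simp [weight_pos y])

lemma measureK_absolutelyContinuous : measureK N ≪ (volume : Measure (Space N)) :=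
  withDensity_absolutelyContinuous _ _

lemma integral_measureK (f : Space N → ℝ) :
    ∫ y, f y ∂(measureK N) = ∫ y, weight y * f y := by
  unfold measureK
  rw [integral_withDensity_eq_integral_toReal_smul measurable_ofReal_weight (by simp)]
  simp [(weight_pos _).le]

lemma lintegral_measureK (f : Space N → ENNReal) :
    ∫⁻ y, f y ∂(measureK N) = ∫⁻ y, ENNReal.ofReal (weight y) * f y := by
  unfold measureK
  rw [lintegral_withDensity_eq_lintegral_mul_non_measurable _ measurable_ofReal_weight (by simp)]
  rfl

instance : IsLocallyFiniteMeasure (measureK N) :=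
  .withDensity_ofReal continuous_weight

instance : SigmaFinite (measureK N) := SigmaFinite.withDensity_ofReal _

lemma ae_measureK_iff {p : Space N → Prop} :
    (∀ᵐ y ∂(measureK N), p y) ↔ ∀ᵐ y, p y :=
  ⟨fun h => volume_absolutelyContinuous.ae_le h, fun h => measureK_absolutelyContinuous.ae_le h⟩

end Measure

/-! ### The divergence identity for radial vector fields. -/

section IntegrationByParts

variable {N : ℕ}

lemma fderiv_apply_self_eq_sum (F : Space N → ℝ) (y : Space N) :
    fderiv ℝ F y y = ∑ i, y i * fderiv ℝ F y (EuclideanSpace.single i 1) := by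
  have h : y = ∑ i, y i • EuclideanSpace.single i (1 : ℝ) := by
    simpa using ((EuclideanSpace.basisFun (Fin N) ℝ).sum_repr y).symm
  conv_lhs => arg 2; rw [h]
  simp [map_sum]

/-- The integrand is the divergence of the compactly supported field `F(y) y`. This single identity
lies behind the Poincaré, Hardy and Sobolev inequalities below. -/
lemma integral_fderiv_apply_self {F : Space N → ℝ} (hF : ContDiff ℝ 1 F)
    (cF : HasCompactSupport F) :
    ∫ y, (fderiv ℝ F y y + N * F y) = 0 := by
  have hd : Continuous (fderiv ℝ F) := hF.continuous_fderiv (by simp)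
  have hdc : HasCompactSupport (fderiv ℝ F) := cF.fderiv ℝ
  have hint : ∀ i : Fin N, Integrable
      fun y : Space N => y i * fderiv ℝ F y (EuclideanSpace.single i 1) := fun i => by
    refine Continuous.integrable_of_hasCompactSupport (by fun_prop) ?_
    have := hdc.comp_left (g := fun L : Space N →L[ℝ] ℝ => L (EuclideanSpace.single i 1)) (by simp)
    exact HasCompactSupport.mul_left this
  have key : ∀ i : Fin N, ∫ y : Space N, y i * fderiv ℝ F y (EuclideanSpace.single i 1)
      = - ∫ y, F y := by
    intro i
    have hi : ∀ y : Space N, HasFDerivAt (fun y : Space N => y i)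
        (EuclideanSpace.proj i : Space N →L[ℝ] ℝ) y := fun y =>
      (EuclideanSpace.proj i : Space N →L[ℝ] ℝ).hasFDerivAt
    rw [integral_mul_fderiv_eq_neg_fderiv_mul_of_integrable (𝕜 := ℝ) (f := fun y : Space N => y i)
      (g := F)]
    · congr 2; ext y
      rw [(hi y).fderiv]; simp
    · refine Continuous.integrable_of_hasCompactSupport ?_ cF.mul_left
      simp_rw [fun y => (hi y).fderiv]
      exact continuous_const.mul hF.continuous
    · exact hint i
    · refine Continuous.integrable_of_hasCompactSupport ?_ cF.mul_left
      exact Continuous.mul (by fun_prop) hF.continuous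
    · exact fun x _ => (hi x).differentiableAt
    · exact fun x _ => hF.differentiable (by simp) x
  have hFi : Integrable F := hF.continuous.integrable_of_hasCompactSupport cF
  simp_rw [fderiv_apply_self_eq_sum]
  rw [integral_add (integrable_finsetSum _ fun i _ => hint i) (hFi.const_mul _),
    integral_finsetSum _ fun i _ => hint i, integral_const_mul]
  simp_rw [key]
  simp

/-- Integrating a pointwise inequality modulo the divergence of `F(y) y`. -/
lemma integral_le_of_le_add_fderiv_apply_self {A B F : Space N → ℝ} (hF : ContDiff ℝ 1 F)
    (cF : HasCompactSupport F) (hA : Integrable A) (hB : Integrable B) (c : ℝ)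
    (h : ∀ y, A y ≤ B y + c * (fderiv ℝ F y y + N * F y)) :
    ∫ y, A y ≤ ∫ y, B y := by
  have hd : Continuous (fderiv ℝ F) := hF.continuous_fderiv (by simp)
  have hdc : HasCompactSupport fun y => fderiv ℝ F y y :=
    (cF.fderiv ℝ).mono' (by
      refine (Function.support_subset_iff'.2 fun y hy => ?_).trans subset_closure
      rw [Function.notMem_support.1 hy]; simp)
  have hI : Integrable fun y => fderiv ℝ F y y + N * F y :=
    (Continuous.integrable_of_hasCompactSupport (by fun_prop) hdc).add
      ((hF.continuous.integrable_of_hasCompactSupport cF).const_mul _)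
  have := integral_mono hA (hB.add (hI.const_mul c)) h
  simp only [Pi.add_apply] at this
  rwa [integral_add hB (hI.const_mul c), integral_const_mul, integral_fderiv_apply_self hF cF,
    mul_zero, add_zero] at this

end IntegrationByParts

/-! ### Weighted Poincaré and Hardy inequalities for test functions. -/

section TestFunctions

variable {N : ℕ}

lemma contDiff_weight {n : WithTop ℕ∞} : ContDiff ℝ n (weight : Space N → ℝ) := by
  unfold weight
  exact ((contDiff_id.norm_sq ℝ).div_const 4).exp

lemma hasFDerivAt_weight (y : Space N) :
    HasFDerivAt (weight : Space N → ℝ) ((weight y / 2) • innerSL ℝ y) y := by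
  have h := (((hasStrictFDerivAt_norm_sq y).hasFDerivAt).mul_const (4 : ℝ)⁻¹).exp
  convert! h using 1
  ext z
  simp [weight, div_eq_mul_inv]
  ring

lemma inner_gradient_eq_fderiv (φ : Space N → ℝ) (y z : Space N) :
    ⟪gradient φ y, z⟫_ℝ = fderiv ℝ φ y z := by
  simp [gradient]

lemma continuous_gradient {φ : Space N → ℝ} (hφ : ContDiff ℝ 1 φ) : Continuous (gradient φ) := by
  unfold gradient
  exact (LinearIsometryEquiv.continuous _).comp (hφ.continuous_fderiv (by simp))

lemma hasCompactSupport_gradient {φ : Space N → ℝ} (cφ : HasCompactSupport φ) :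
    HasCompactSupport (gradient φ) := by
  unfold gradient
  exact (cφ.fderiv ℝ).comp_left (g := (InnerProductSpace.toDual ℝ (Space N)).symm) (by simp)

lemma integrable_mul_sq {φ η : Space N → ℝ} (hφ : ContDiff ℝ 1 φ) (cφ : HasCompactSupport φ)
    (hη : Continuous η) : Integrable fun y => η y * φ y ^ 2 := by
  refine Continuous.integrable_of_hasCompactSupport (hη.mul (hφ.continuous.pow 2)) ?_
  exact HasCompactSupport.mul_left (cφ.comp_left (g := fun x : ℝ => x ^ 2) (by simp))

lemma integrable_mul_norm_gradient_sq {φ η : Space N → ℝ} (hφ : ContDiff ℝ 1 φ)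
    (cφ : HasCompactSupport φ) (hη : Continuous η) :
    Integrable fun y => η y * ‖gradient φ y‖ ^ 2 := by
  refine Continuous.integrable_of_hasCompactSupport
    (hη.mul ((continuous_gradient hφ).norm.pow 2)) ?_
  exact HasCompactSupport.mul_left
    ((hasCompactSupport_gradient cφ).comp_left (g := fun x : Space N => ‖x‖ ^ 2) (by simp))

/-- Radial derivative of `φ² ρ K`. -/
lemma fderiv_sq_mul_weight {φ ρ : Space N → ℝ} {ρ' : Space N →L[ℝ] ℝ} (hφ : ContDiff ℝ 1 φ)
    (y : Space N) (hρ : HasFDerivAt ρ ρ' y) :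
    fderiv ℝ (fun y => φ y ^ 2 * (ρ y * weight y)) y y
      = weight y * (2 * φ y * fderiv ℝ φ y y * ρ y + φ y ^ 2 * ρ' y
        + φ y ^ 2 * ρ y * ‖y‖ ^ 2 / 2) := by
  have h1 : HasFDerivAt φ (fderiv ℝ φ y) y := (hφ.differentiable (by simp) y).hasFDerivAt
  have h := (h1.pow 2).mul (hρ.mul (hasFDerivAt_weight y))
  change fderiv ℝ ((fun x => φ x ^ 2) * (ρ * weight)) y y = _
  rw [h.fderiv]
  simp
  ring

lemma contDiff_sq_mul_weight {φ ρ : Space N → ℝ} (hφ : ContDiff ℝ 1 φ) (hρ : ContDiff ℝ 1 ρ) :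
    ContDiff ℝ 1 (fun y => φ y ^ 2 * (ρ y * weight y)) :=
  (hφ.pow 2).mul (hρ.mul contDiff_weight)

lemma hasCompactSupport_sq_mul {φ ρ : Space N → ℝ} (cφ : HasCompactSupport φ) :
    HasCompactSupport (fun y => φ y ^ 2 * (ρ y * weight y)) :=
  HasCompactSupport.mul_right (cφ.comp_left (g := fun x : ℝ => x ^ 2) (by simp))

/-- Expansion of `|∇φ + a y|²`. -/
lemma norm_gradient_add_smul_sq (φ : Space N → ℝ) (y : Space N) (a : ℝ) :
    ‖gradient φ y + a • y‖ ^ 2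
      = ‖gradient φ y‖ ^ 2 + 2 * a * fderiv ℝ φ y y + a ^ 2 * ‖y‖ ^ 2 := by
  rw [norm_add_sq_real, inner_smul_right, inner_gradient_eq_fderiv, norm_smul, mul_pow,
    Real.norm_eq_abs, sq_abs]
  ring

/-- The weighted Poincaré inequality for test functions. -/
lemma poincare_testFunction {φ : Space N → ℝ} (hφ : ContDiff ℝ 1 φ) (cφ : HasCompactSupport φ) :
    (N : ℝ) / 2 * ∫ y, φ y ^ 2 ∂(measureK N) ≤ ∫ y, ‖gradient φ y‖ ^ 2 ∂(measureK N) := by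
  rw [integral_measureK, integral_measureK, ← integral_const_mul]
  refine integral_le_of_le_add_fderiv_apply_self
    (contDiff_sq_mul_weight hφ (contDiff_const (c := (1 : ℝ)))) (hasCompactSupport_sq_mul cφ)
    ((integrable_mul_sq hφ cφ continuous_weight).const_mul _)
    (integrable_mul_norm_gradient_sq hφ cφ continuous_weight) (1 / 2) fun y => ?_
  rw [fderiv_sq_mul_weight hφ y (hasFDerivAt_const (1 : ℝ) y)]
  -- In this square the cross term and the `|y|²` term are exactly half of those in the divergence
  -- of `φ² K y`; what remains of that half divergence is `(N/2) φ² K`.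
  have h := mul_nonneg (weight_pos y).le (sq_nonneg ‖gradient φ y + (φ y / 2) • y‖)
  rw [norm_gradient_add_smul_sq] at h
  simp only [_root_.zero_apply]
  linarith

/-- The weighted Hardy inequality for test functions, with a regularized potential. -/
lemma hardy_testFunction_aux {φ : Space N → ℝ} (hN : 2 ≤ N) (hφ : ContDiff ℝ 1 φ)
    (cφ : HasCompactSupport φ) {ε : ℝ} (hε : 0 < ε) :
    (((N : ℝ) - 2) / 2) ^ 2 * ∫ y, (‖y‖ ^ 2 + ε)⁻¹ * φ y ^ 2 ∂(measureK N)
      ≤ ∫ y, ‖gradient φ y‖ ^ 2 ∂(measureK N) := by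
  have hN' : (2 : ℝ) ≤ N := by exact_mod_cast hN
  have hp : ∀ y : Space N, 0 < ‖y‖ ^ 2 + ε := fun y => by positivity
  have hρ : ContDiff ℝ 1 fun y : Space N => (‖y‖ ^ 2 + ε)⁻¹ :=
    ((contDiff_id.norm_sq ℝ).add contDiff_const).inv fun y => (hp y).ne'
  rw [integral_measureK, integral_measureK, ← integral_const_mul]
  refine integral_le_of_le_add_fderiv_apply_self
    (contDiff_sq_mul_weight hφ hρ) (hasCompactSupport_sq_mul cφ) ?_
    (integrable_mul_norm_gradient_sq hφ cφ continuous_weight) (((N : ℝ) - 2) / 2) fun y => ?_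
  · simp_rw [← mul_assoc (weight _)]
    exact (integrable_mul_sq hφ cφ (continuous_weight.mul hρ.continuous)).const_mul _
  have hd : HasFDerivAt (fun y : Space N => (‖y‖ ^ 2 + ε)⁻¹) _ y :=
    (hasDerivAt_inv (hp y).ne').comp_hasFDerivAt y
      (((hasStrictFDerivAt_norm_sq y).hasFDerivAt).add_const ε)
  rw [fderiv_sq_mul_weight hφ y hd]
  -- With `c = (N-2)/2` and `ρ = (|y|² + ε)⁻¹`, removing `c` times the divergence of `φ² ρ K y`
  -- leaves at least `(cN - 2c - c²) φ² ρ = c² φ² ρ`, because `ρ|y|² ≤ 1`. The term from the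
  -- derivative of `K` has the good sign.
  have h := mul_nonneg (weight_pos y).le
    (sq_nonneg ‖gradient φ y + (((N : ℝ) - 2) / 2 * (‖y‖ ^ 2 + ε)⁻¹ * φ y) • y‖)
  rw [norm_gradient_add_smul_sq] at h
  set ρ := (‖y‖ ^ 2 + ε)⁻¹ with hρdef
  have hρ0 : 0 < ρ := inv_pos.2 (hp y)
  have h1 : ρ * ‖y‖ ^ 2 ≤ 1 := by
    rw [hρdef, inv_mul_le_iff₀ (hp y)]; linarith
  have e : (-(((‖y‖ ^ 2 + ε) ^ 2)⁻¹) : ℝ) = - ρ ^ 2 := by rw [hρdef, inv_pow]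
  simp only [_root_.smul_apply, innerSL_apply_apply, real_inner_self_eq_norm_sq,
    smul_eq_mul, nsmul_eq_mul, e]
  have hw := weight_pos y
  set w := weight y
  set c := ((N : ℝ) - 2) / 2 with hc
  have hc0 : 0 ≤ c := by rw [hc]; linarith
  have hN2 : (N : ℝ) = 2 * c + 2 := by rw [hc]; ring
  have k1 : 0 ≤ w * φ y ^ 2 * ρ := by positivity
  have k2 := mul_le_mul_of_nonneg_left h1 (mul_nonneg hc0 k1)
  have k3 := mul_le_mul_of_nonneg_left h1 (mul_nonneg (mul_nonneg hc0 hc0) k1)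
  have k4 : 0 ≤ c * (w * φ y ^ 2 * ρ) * ‖y‖ ^ 2 := by positivity
  rw [hN2]
  push_cast
  nlinarith

/-- The gradient of `K^{1/2} φ` is controlled by the weighted gradient of `φ`. -/
lemma norm_fderiv_sqrt_weight_mul_sq {φ : Space N → ℝ} (hφ : ContDiff ℝ 1 φ) (y : Space N) :
    ‖fderiv ℝ (fun y => Real.exp (‖y‖ ^ 2 / 8) * φ y) y‖ ^ 2
      = weight y * ‖gradient φ y + (φ y / 4) • y‖ ^ 2 := by
  have h1 : HasFDerivAt φ (fderiv ℝ φ y) y := (hφ.differentiable (by simp) y).hasFDerivAt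
  have h := ((((hasStrictFDerivAt_norm_sq y).hasFDerivAt).mul_const (8 : ℝ)⁻¹).exp).mul h1
  have e : fderiv ℝ (fun y => Real.exp (‖y‖ ^ 2 / 8) * φ y) y
      = Real.exp (‖y‖ ^ 2 / 8) • InnerProductSpace.toDual ℝ (Space N)
        (gradient φ y + (φ y / 4) • y) := by
    have : (fun y : Space N => Real.exp (‖y‖ ^ 2 / 8) * φ y)
      = (fun y => Real.exp (‖y‖ ^ 2 * (8 : ℝ)⁻¹)) * φ := by ext; simp [div_eq_mul_inv]
    rw [this, h.fderiv]
    ext z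
    simp [gradient, div_eq_mul_inv]
    ring
  rw [e, norm_smul, LinearIsometryEquiv.norm_map, mul_pow, Real.norm_eq_abs, sq_abs, weight,
    ← Real.exp_nat_mul]
  congr 2
  push_cast; ring

end TestFunctions

/-! ### The weighted Sobolev inequality and `L¹` estimates. -/

section Sobolev

variable {N : ℕ}

lemma critExp_eq (hN : 3 ≤ N) : critExp N = 4 / ((N : ℝ) - 2) + 2 := by
  have : (3 : ℝ) ≤ N := by exact_mod_cast hN
  have h : (N : ℝ) - 2 ≠ 0 := by linarith
  unfold critExp; field_simp; ring

lemma two_lt_critExp (hN : 3 ≤ N) : 2 < critExp N := by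
  have : (3 : ℝ) ≤ N := by exact_mod_cast hN
  have : 0 < 4 / ((N : ℝ) - 2) := div_pos (by norm_num) (by linarith)
  rw [critExp_eq hN]; linarith

lemma eLpNorm_two_eq {α E : Type*} [MeasurableSpace α] [NormedAddCommGroup E] {μ : Measure α}
    (f : α → E) : eLpNorm f 2 μ = (∫⁻ x, ‖f x‖ₑ ^ 2 ∂μ) ^ (1 / 2 : ℝ) := by
  rw [eLpNorm_eq_lintegral_rpow_enorm_toReal (by simp) (by simp)]
  simp

lemma integral_norm_sq_eq {α E : Type*} [MeasurableSpace α] [NormedAddCommGroup E]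
    [InnerProductSpace ℝ E] {μ : Measure α} (f : Lp E 2 μ) :
    ∫ x, ‖f x‖ ^ 2 ∂μ = ‖f‖ ^ 2 := by
  rw [← real_inner_self_eq_norm_sq, L2.inner_def]
  simp

/-- The weighted Sobolev inequality for test functions. -/
lemma exists_sobolev_testFunction (hN : 3 ≤ N) : ∃ C : NNReal, ∀ φ : Space N → ℝ,
    ContDiff ℝ 1 φ → HasCompactSupport φ →
      eLpNorm φ (ENNReal.ofReal (critExp N)) (measureK N)
        ≤ C * eLpNorm (gradient φ) 2 (measureK N) := by
  have hq : 2 < critExp N := two_lt_critExp hN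
  have hN' : (3 : ℝ) ≤ N := by exact_mod_cast hN
  have hq0 : 0 < critExp N := by linarith
  refine ⟨eLpNormLESNormFDerivOfEqInnerConst (volume : Measure (Space N)) (2 : NNReal),
    fun φ hφ cφ => ?_⟩
  -- Multiplying by `K^{1/2}` reduces the claim to the unweighted Sobolev inequality.
  set u : Space N → ℝ := fun y => Real.exp (‖y‖ ^ 2 / 8) * φ y with hu
  have hu1 : ContDiff ℝ 1 u := (((contDiff_id.norm_sq ℝ).div_const 8).exp).mul hφ
  have cu : HasCompactSupport u := HasCompactSupport.mul_left cφ
  have key := eLpNorm_le_eLpNorm_fderiv_of_eq_inner (volume : Measure (Space N)) hu1 cu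
    (p := 2) (p' := (critExp N).toNNReal) (by norm_num) (by simp; omega) (by
      rw [Real.coe_toNNReal _ hq0.le]
      simp [critExp]
      field_simp)
  -- Since `2* > 2` and `K ≥ 1`, the weight satisfies `K ≤ (K^{1/2})^{2*}`.
  have e1 : eLpNorm φ (ENNReal.ofReal (critExp N)) (measureK N)
      ≤ eLpNorm u ((critExp N).toNNReal : NNReal) volume := by
    change _ ≤ eLpNorm u (ENNReal.ofReal (critExp N)) volume
    have h0 : ENNReal.ofReal (critExp N) ≠ 0 := by simpa using hq0
    rw [eLpNorm_eq_lintegral_rpow_enorm_toReal h0 (by simp),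
      eLpNorm_eq_lintegral_rpow_enorm_toReal h0 (by simp), ENNReal.toReal_ofReal hq0.le,
      lintegral_measureK]
    refine ENNReal.rpow_le_rpow (lintegral_mono fun y => ?_) (by positivity)
    simp only [hu, enorm_mul]
    rw [ENNReal.mul_rpow_of_nonneg _ _ hq0.le]
    gcongr
    rw [Real.enorm_eq_ofReal (Real.exp_pos _).le, ENNReal.ofReal_rpow_of_pos (Real.exp_pos _)]
    refine ENNReal.ofReal_le_ofReal ?_
    rw [weight, ← Real.exp_mul]
    refine Real.exp_le_exp.2 ?_
    nlinarith [sq_nonneg ‖y‖]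
  have e2 : eLpNorm (fderiv ℝ u) (2 : NNReal) volume ≤ eLpNorm (gradient φ) 2 (measureK N) := by
    change eLpNorm (fderiv ℝ u) 2 volume ≤ _
    rw [eLpNorm_two_eq, eLpNorm_two_eq]
    refine ENNReal.rpow_le_rpow ?_ (by norm_num)
    have hA : Integrable fun y => weight y * ‖gradient φ y + (φ y / 4) • y‖ ^ 2 := by
      simp_rw [← norm_fderiv_sqrt_weight_mul_sq hφ]
      exact Continuous.integrable_of_hasCompactSupport
        ((hu1.continuous_fderiv (by simp)).norm.pow 2)
        ((cu.fderiv ℝ).comp_left (g := fun L : Space N →L[ℝ] ℝ => ‖L‖ ^ 2) (by simp))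
    have hB := integrable_mul_norm_gradient_sq hφ cφ (continuous_weight (N := N))
    -- After expanding the square, a quarter of the divergence of `φ² K y` removes the cross term
    -- and leaves `-φ²|y|²/16 - Nφ²/4` (times `K`), which is nonpositive.
    have hle : ∫ y, weight y * ‖gradient φ y + (φ y / 4) • y‖ ^ 2
        ≤ ∫ y, weight y * ‖gradient φ y‖ ^ 2 := by
      refine integral_le_of_le_add_fderiv_apply_self
        (contDiff_sq_mul_weight hφ (contDiff_const (c := (1 : ℝ)))) (hasCompactSupport_sq_mul cφ)
        hA hB (1 / 4) fun y => ?_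
      rw [fderiv_sq_mul_weight hφ y (hasFDerivAt_const (1 : ℝ) y), norm_gradient_add_smul_sq]
      simp only [_root_.zero_apply]
      have h1 : 0 ≤ weight y * φ y ^ 2 * ‖y‖ ^ 2 :=
        mul_nonneg (mul_nonneg (weight_pos y).le (sq_nonneg _)) (sq_nonneg _)
      have h2 : 0 ≤ weight y * φ y ^ 2 * N :=
        mul_nonneg (mul_nonneg (weight_pos y).le (sq_nonneg _)) (by positivity)
      nlinarith
    rw [lintegral_measureK]
    have c1 : ∀ y, ‖fderiv ℝ u y‖ₑ ^ 2
        = ENNReal.ofReal (weight y * ‖gradient φ y + (φ y / 4) • y‖ ^ 2) := fun y => by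
      rw [← norm_fderiv_sqrt_weight_mul_sq hφ y, ENNReal.ofReal_pow (norm_nonneg _),
        ofReal_norm]
    have c2 : ∀ y, ENNReal.ofReal (weight y) * ‖gradient φ y‖ₑ ^ 2
        = ENNReal.ofReal (weight y * ‖gradient φ y‖ ^ 2) := fun y => by
      rw [ENNReal.ofReal_mul (weight_pos y).le, ENNReal.ofReal_pow (norm_nonneg _),
        ofReal_norm]
    simp_rw [c1, c2]
    rw [← ofReal_integral_eq_lintegral_ofReal hA (Eventually.of_forall fun y =>
        mul_nonneg (weight_pos y).le (sq_nonneg _)),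
      ← ofReal_integral_eq_lintegral_ofReal hB (Eventually.of_forall fun y =>
        mul_nonneg (weight_pos y).le (sq_nonneg _))]
    exact ENNReal.ofReal_le_ofReal hle
  exact e1.trans (key.trans (mul_le_mul' le_rfl e2))

/-- The `L¹` modulus of continuity of a test function is controlled by its gradient. -/
lemma lintegral_translate_sub_le {φ : Space N → ℝ} (hφ : ContDiff ℝ 1 φ) (z : Space N) :
    ∫⁻ x, ‖φ (x + z) - φ x‖ₑ ≤ ‖z‖ₑ * ∫⁻ x, ‖gradient φ x‖ₑ := by
  have hg := continuous_gradient hφ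
  have h1 : ∀ x, ‖φ (x + z) - φ x‖ₑ
      ≤ ∫⁻ t in Icc (0 : ℝ) 1, ‖z‖ₑ * ‖gradient φ (x + t • z)‖ₑ := fun x => by
    have hd : ∀ t : ℝ, HasDerivAt (fun t : ℝ => φ (x + t • z)) (fderiv ℝ φ (x + t • z) z) t := by
      intro t
      have h := (hφ.differentiable (by simp) (x + t • z)).hasFDerivAt
      have h2 : HasDerivAt (fun t : ℝ => x + t • z) z t := by
        simpa using ((hasDerivAt_id t).smul_const z).const_add x
      exact h.comp_hasDerivAt t h2
    have hc : Continuous fun t : ℝ => fderiv ℝ φ (x + t • z) z := by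
      have := hφ.continuous_fderiv (by simp)
      fun_prop
    have h := intervalIntegral.integral_eq_sub_of_hasDerivAt (a := 0) (b := 1)
      (fun t _ => hd t) (hc.intervalIntegrable _ _)
    simp only [one_smul, zero_smul, add_zero] at h
    rw [← h, intervalIntegral.integral_of_le zero_le_one, ← integral_Icc_eq_integral_Ioc]
    refine (enorm_integral_le_lintegral_enorm _).trans (lintegral_mono fun t => ?_)
    rw [← inner_gradient_eq_fderiv]
    have := norm_inner_le_norm (𝕜 := ℝ) (gradient φ (x + t • z)) z
    rw [mul_comm]
    simp only [← ofReal_norm]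
    rw [← ENNReal.ofReal_mul (norm_nonneg _)]
    exact ENNReal.ofReal_le_ofReal this
  calc ∫⁻ x, ‖φ (x + z) - φ x‖ₑ
      ≤ ∫⁻ x, ∫⁻ t in Icc (0 : ℝ) 1, ‖z‖ₑ * ‖gradient φ (x + t • z)‖ₑ := lintegral_mono h1
    _ = ∫⁻ t in Icc (0 : ℝ) 1, ∫⁻ x, ‖z‖ₑ * ‖gradient φ (x + t • z)‖ₑ := by
        refine lintegral_lintegral_swap (Continuous.aemeasurable ?_)
        refine ENNReal.continuous_const_mul (by simp) |>.comp ?_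
        exact (by fun_prop : Continuous fun p : Space N × ℝ => ‖gradient φ (p.1 + p.2 • z)‖ₑ)
    _ = ∫⁻ _ in Icc (0 : ℝ) 1, ‖z‖ₑ * ∫⁻ x, ‖gradient φ x‖ₑ := by
        refine lintegral_congr fun t => ?_
        rw [lintegral_const_mul' _ _ (by simp),
          lintegral_add_right_eq_self (fun x => ‖gradient φ x‖ₑ) (t • z)]
    _ = _ := by simp

/-- `L²_K` embeds into `L¹(ℝ^N)`. -/
lemma exists_lintegral_enorm_le (N : ℕ) : ∃ C : NNReal, ∀ {E : Type} [NormedAddCommGroup E]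
    (f : Space N → E), AEStronglyMeasurable f (measureK N) →
      ∫⁻ x, ‖f x‖ₑ ≤ C * eLpNorm f 2 (measureK N) := by
  have hG : Integrable fun y : Space N => Real.exp (-(1 / 4) * ‖y‖ ^ 2) := by
    -- A non-integrable function has integral zero by convention, so the positive value of the
    -- Gaussian integral proves integrability.
    refine not_imp_comm.1 integral_undef ?_
    rw [GaussianFourier.integral_rexp_neg_mul_sq_norm (by norm_num)]
    positivity
  have hfin : ∫⁻ y : Space N, ENNReal.ofReal (Real.exp (-(1 / 4) * ‖y‖ ^ 2)) < ⊤ := by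
    rw [← ofReal_integral_eq_lintegral_ofReal hG (Eventually.of_forall fun y => (Real.exp_pos _).le)]
    simp
  set A := ∫⁻ y : Space N, ENNReal.ofReal (Real.exp (-(1 / 4) * ‖y‖ ^ 2)) with hA
  refine ⟨(A ^ (1 / 2 : ℝ)).toNNReal, fun f hf => ?_⟩
  rw [ENNReal.coe_toNNReal (ENNReal.rpow_ne_top_of_nonneg (by norm_num) hfin.ne)]
  have hw : Measurable fun y : Space N => (ENNReal.ofReal (weight y))⁻¹ :=
    measurable_ofReal_weight.inv
  have hne : ∀ y : Space N, ENNReal.ofReal (weight y) ≠ 0 := fun y => by simpa using weight_pos y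
  have e1 : ∫⁻ x, ‖f x‖ₑ
      = ∫⁻ x, ((fun y => (ENNReal.ofReal (weight y))⁻¹) * (fun y => ‖f y‖ₑ) : Space N → ENNReal) x
        ∂(measureK N) := by
    rw [lintegral_measureK]
    refine lintegral_congr fun y => ?_
    rw [Pi.mul_apply, ← mul_assoc, ENNReal.mul_inv_cancel (hne y) (by simp), one_mul]
  rw [e1]
  refine (ENNReal.lintegral_mul_le_Lp_mul_Lq (measureK N) Real.HolderConjugate.two_two
    hw.aemeasurable hf.enorm).trans ?_
  rw [eLpNorm_two_eq]
  simp only [ENNReal.rpow_two]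
  gcongr
  refine le_of_eq ?_
  rw [hA, lintegral_measureK]
  refine lintegral_congr fun y => ?_
  rw [sq, ← mul_assoc, ENNReal.mul_inv_cancel (hne y) (by simp), one_mul,
    ← ENNReal.ofReal_inv_of_pos (weight_pos y), weight, ← Real.exp_neg]
  congr 2; ring

end Sobolev

/-! ### Passage of the inequalities to `X` by density. -/

section EnergySpace

variable {N : ℕ}

/-- `v ↦ v` as a map `X → L²_K`. -/
def X.fnL (N : ℕ) : X N →L[ℝ] L2K N :=
  (ContinuousLinearMap.fst ℝ (L2K N) (L2KVec N)).comp (testGraph N).topologicalClosure.subtypeL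

/-- `v ↦ ∇v` as a map `X → L²_K`. -/
def X.gradL (N : ℕ) : X N →L[ℝ] L2KVec N :=
  (ContinuousLinearMap.snd ℝ (L2K N) (L2KVec N)).comp (testGraph N).topologicalClosure.subtypeL

lemma X.continuous_fn : Continuous (X.fn : X N → L2K N) := (X.fnL N).continuous

lemma X.continuous_grad : Continuous (X.grad : X N → L2KVec N) := (X.gradL N).continuous

lemma X.fn_sub (v w : X N) : (v - w).fn = v.fn - w.fn := rfl
lemma X.fn_add (v w : X N) : (v + w).fn = v.fn + w.fn := rfl
lemma X.fn_smul (c : ℝ) (v : X N) : (c • v).fn = c • v.fn := rfl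
lemma X.grad_sub (v w : X N) : (v - w).grad = v.grad - w.grad := rfl
/-- `u ∈ X` is represented by the test function `φ`. -/
structure IsTestFunction (u : X N) (φ : Space N → ℝ) : Prop where
  contDiff : ContDiff ℝ ∞ φ
  hasCompactSupport : HasCompactSupport φ
  fn_ae : u.fn =ᵐ[measureK N] φ
  grad_ae : u.grad =ᵐ[measureK N] gradient φ

lemma IsTestFunction.contDiff_one {u : X N} {φ : Space N → ℝ} (h : IsTestFunction u φ) :
    ContDiff ℝ 1 φ := h.contDiff.of_le (by norm_cast)

/-- Elements of `X` are limits of test functions, also almost everywhere. -/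
lemma X.exists_testFunction_seq (v : X N) : ∃ (u : ℕ → X N) (φ : ℕ → Space N → ℝ),
    (∀ n, IsTestFunction (u n) (φ n)) ∧ Tendsto u atTop (𝓝 v) ∧
      ∀ᵐ y, Tendsto (fun n => φ n y) atTop (𝓝 (v.fn y)) := by
  have hv : (v : L2K N × L2KVec N) ∈ closure (testGraph N : Set (L2K N × L2KVec N)) := by
    rw [← Submodule.topologicalClosure_coe]; exact v.2
  obtain ⟨p, hp, hlim⟩ := mem_closure_iff_seq_limit.1 hv
  choose φ h1 h2 h3 h4 using hp
  set u : ℕ → X N := fun n => ⟨p n, (testGraph N).le_topologicalClosure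
    ⟨φ n, h1 n, h2 n, h3 n, h4 n⟩⟩ with hu
  have hulim : Tendsto u atTop (𝓝 v) := tendsto_subtype_rng.2 hlim
  have hfn : Tendsto (fun n => (u n).fn) atTop (𝓝 v.fn) :=
    (X.continuous_fn.tendsto v).comp hulim
  obtain ⟨k, hk, hae⟩ := (tendstoInMeasure_of_tendsto_Lp hfn).exists_seq_tendsto_ae
  refine ⟨u ∘ k, φ ∘ k, fun n => ⟨h1 _, h2 _, h3 _, h4 _⟩, hulim.comp hk.tendsto_atTop, ?_⟩
  rw [← ae_measureK_iff]
  filter_upwards [hae, ae_all_iff.2 fun n => h3 (k n)] with y hy hn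
  exact hy.congr fun n => hn n

lemma IsTestFunction.integral_sq {u : X N} {φ : Space N → ℝ} (h : IsTestFunction u φ) :
    ∫ y, φ y ^ 2 ∂(measureK N) = ‖u.fn‖ ^ 2 := by
  rw [← integral_norm_sq_eq]
  refine integral_congr_ae ?_
  filter_upwards [h.fn_ae] with y hy
  rw [hy, Real.norm_eq_abs, sq_abs]

lemma IsTestFunction.integral_norm_gradient_sq {u : X N} {φ : Space N → ℝ}
    (h : IsTestFunction u φ) :
    ∫ y, ‖gradient φ y‖ ^ 2 ∂(measureK N) = ‖u.grad‖ ^ 2 := by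
  rw [← integral_norm_sq_eq]
  refine integral_congr_ae ?_
  filter_upwards [h.grad_ae] with y hy
  rw [hy]

lemma IsTestFunction.eLpNorm_gradient {u : X N} {φ : Space N → ℝ} (h : IsTestFunction u φ) :
    eLpNorm (gradient φ) 2 (measureK N) = ‖u.grad‖ₑ := by
  rw [← eLpNorm_congr_ae h.grad_ae, Lp.enorm_def]

/-- The weighted Poincaré inequality. -/
lemma X.poincare (v : X N) : (N : ℝ) / 2 * ‖v.fn‖ ^ 2 ≤ ‖v.grad‖ ^ 2 := by
  obtain ⟨u, φ, hu, hlim, -⟩ := v.exists_testFunction_seq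
  refine le_of_tendsto_of_tendsto'
    ((((X.continuous_fn.tendsto v).comp hlim).norm.pow 2).const_mul _)
    (((X.continuous_grad.tendsto v).comp hlim).norm.pow 2) fun n => ?_
  have h := poincare_testFunction (hu n).contDiff_one (hu n).hasCompactSupport
  rwa [(hu n).integral_sq, (hu n).integral_norm_gradient_sq] at h

lemma X.norm_fn_le (hN : 3 ≤ N) (v : X N) : ‖v.fn‖ ≤ ‖v.grad‖ := by
  have h := v.poincare
  have hN' : (3 : ℝ) ≤ N := by exact_mod_cast hN
  refine abs_le_of_sq_le_sq' ?_ (norm_nonneg _) |>.2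
  nlinarith [sq_nonneg ‖v.fn‖]

/-- The norm inherited from the product is the maximum of the two component norms, and by Poincaré
with `N/2 ≥ 1` the gradient wins. Hence the subspace topology is that of the energy norm. -/
lemma X.norm_eq (hN : 3 ≤ N) (v : X N) : ‖v‖ = ‖v.grad‖ := by
  change max ‖v.fn‖ ‖v.grad‖ = _
  exact max_eq_right (v.norm_fn_le hN)

/-- The weighted Sobolev inequality. -/
lemma X.exists_sobolev (hN : 3 ≤ N) : ∃ C : NNReal, ∀ v : X N,
    eLpNorm v.fn (ENNReal.ofReal (critExp N)) (measureK N) ≤ C * ‖v.grad‖ₑ := by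
  obtain ⟨C, hC⟩ := exists_sobolev_testFunction hN
  refine ⟨C, fun v => ?_⟩
  obtain ⟨u, φ, hu, hlim, hae⟩ := v.exists_testFunction_seq
  have h1 : eLpNorm v.fn (ENNReal.ofReal (critExp N)) (measureK N)
      ≤ liminf (fun n => eLpNorm (φ n) (ENNReal.ofReal (critExp N)) (measureK N)) atTop :=
    Lp.eLpNorm_lim_le_liminf_eLpNorm
      (fun n => (hu n).contDiff.continuous.aestronglyMeasurable) _ (ae_measureK_iff.2 hae)
  have h2 : Tendsto (fun n => C * ‖(u n).grad‖ₑ) atTop (𝓝 (C * ‖v.grad‖ₑ)) :=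
    ENNReal.Tendsto.const_mul (((X.continuous_grad.tendsto v).comp hlim).enorm) (by simp)
  refine h1.trans ?_
  rw [← h2.liminf_eq]
  refine liminf_le_liminf (Eventually.of_forall fun n => ?_)
  have := hC (φ n) (hu n).contDiff_one (hu n).hasCompactSupport
  rwa [(hu n).eLpNorm_gradient] at this

/-- The weighted Hardy inequality. -/
lemma X.lintegral_hardy (hN : 3 ≤ N) (v : X N) :
    ∫⁻ y, ENNReal.ofReal (v.fn y ^ 2 / ‖y‖ ^ 2) ∂(measureK N)
      ≤ ENNReal.ofReal (4 / ((N : ℝ) - 2) ^ 2 * ‖v.grad‖ ^ 2) := by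
  have hN' : (3 : ℝ) ≤ N := by exact_mod_cast hN
  have : Nonempty (Fin N) := ⟨⟨0, by omega⟩⟩
  obtain ⟨u, φ, hu, hlim, hae⟩ := v.exists_testFunction_seq
  -- The regularization is removed along with the approximation by test functions, so one
  -- application of Fatou's lemma covers both limits.
  set ε : ℕ → ℝ := fun n => 1 / ((n : ℝ) + 1) with hεdef
  have hε : ∀ n, 0 < ε n := fun n => by simp only [hεdef]; positivity
  have hεlim : Tendsto ε atTop (𝓝 0) := tendsto_one_div_add_atTop_nhds_zero_nat
  set G : ℕ → Space N → ℝ := fun n y => (‖y‖ ^ 2 + ε n)⁻¹ * φ n y ^ 2 with hG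
  have hGc : ∀ n, Continuous (G n) := fun n =>
    Continuous.mul (Continuous.inv₀ (by fun_prop) fun y => by have := hε n; positivity)
      ((hu n).contDiff.continuous.pow 2)
  have hG0 : ∀ n y, 0 ≤ G n y := fun n y => by have := hε n; positivity
  have hGae : ∀ᵐ y ∂(measureK N), Tendsto (fun n => ENNReal.ofReal (G n y)) atTop
      (𝓝 (ENNReal.ofReal (v.fn y ^ 2 / ‖y‖ ^ 2))) := by
    rw [ae_measureK_iff]
    have h0 : ∀ᵐ y : Space N, y ≠ 0 := by simp [ae_iff]
    filter_upwards [hae, h0] with y hy hy0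
    refine ENNReal.tendsto_ofReal ?_
    have h := ((hεlim.const_add (‖y‖ ^ 2)).inv₀ (by simpa using hy0)).mul (hy.pow 2)
    simpa [hG, div_eq_inv_mul] using h
  calc ∫⁻ y, ENNReal.ofReal (v.fn y ^ 2 / ‖y‖ ^ 2) ∂(measureK N)
      = ∫⁻ y, liminf (fun n => ENNReal.ofReal (G n y)) atTop ∂(measureK N) :=
        lintegral_congr_ae (hGae.mono fun y hy => hy.liminf_eq.symm)
    _ ≤ liminf (fun n => ∫⁻ y, ENNReal.ofReal (G n y) ∂(measureK N)) atTop :=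
        lintegral_liminf_le fun n => (hGc n).measurable.ennreal_ofReal
    _ ≤ liminf (fun n => ENNReal.ofReal (4 / ((N : ℝ) - 2) ^ 2 * ‖(u n).grad‖ ^ 2)) atTop := by
        refine liminf_le_liminf (Eventually.of_forall fun n => ?_)
        have hint : Integrable (G n) (measureK N) :=
          (hGc n).integrable_of_hasCompactSupport (HasCompactSupport.mul_left
            ((hu n).hasCompactSupport.comp_left (g := fun x : ℝ => x ^ 2) (by simp)))
        rw [← ofReal_integral_eq_lintegral_ofReal hint (Eventually.of_forall (hG0 n))]
        refine ENNReal.ofReal_le_ofReal ?_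
        have h := hardy_testFunction_aux (by omega) (hu n).contDiff_one
          (hu n).hasCompactSupport (hε n)
        rw [(hu n).integral_norm_gradient_sq] at h
        have hp : 0 < ((N : ℝ) - 2) ^ 2 := by have : 0 < (N : ℝ) - 2 := by linarith
                                              positivity
        rw [div_mul_eq_mul_div, le_div_iff₀ hp]
        simp only [hG]
        linarith
    _ = _ := by
        refine Tendsto.liminf_eq (ENNReal.tendsto_ofReal (Tendsto.const_mul _ ?_))
        exact ((X.continuous_grad.tendsto v).comp hlim).norm.pow 2

lemma X.aestronglyMeasurable_fn (v : X N) : AEStronglyMeasurable v.fn (measureK N) :=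
  Lp.aestronglyMeasurable _

lemma X.aestronglyMeasurable_sq_div (v : X N) :
    AEStronglyMeasurable (fun y => v.fn y ^ 2 / ‖y‖ ^ 2) (measureK N) :=
  ((v.aestronglyMeasurable_fn.pow 2).aemeasurable.div (by fun_prop)).aestronglyMeasurable

lemma X.integrable_sq_div (hN : 3 ≤ N) (v : X N) :
    Integrable (fun y => v.fn y ^ 2 / ‖y‖ ^ 2) (measureK N) := by
  refine ⟨v.aestronglyMeasurable_sq_div, ?_⟩
  rw [hasFiniteIntegral_iff_ofReal (Eventually.of_forall fun y => by positivity)]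
  exact (v.lintegral_hardy hN).trans_lt ENNReal.ofReal_lt_top

lemma X.hardy (hN : 3 ≤ N) (v : X N) :
    ∫ y, v.fn y ^ 2 / ‖y‖ ^ 2 ∂(measureK N) ≤ 4 / ((N : ℝ) - 2) ^ 2 * ‖v.grad‖ ^ 2 := by
  rw [integral_eq_lintegral_of_nonneg_ae (Eventually.of_forall fun y => by positivity)
    v.aestronglyMeasurable_sq_div]
  refine ENNReal.toReal_le_of_le_ofReal ?_ (v.lintegral_hardy hN)
  positivity

/-- The `L¹` modulus of continuity of an element of `X`. -/
lemma X.exists_lintegral_translate_sub_le (N : ℕ) : ∃ C : NNReal, ∀ (v : X N) (z : Space N),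
    ∫⁻ x, ‖v.fn (x + z) - v.fn x‖ₑ ≤ ‖z‖ₑ * (C * ‖v.grad‖ₑ) := by
  obtain ⟨C, hC⟩ := exists_lintegral_enorm_le N
  refine ⟨C, fun v z => ?_⟩
  obtain ⟨u, φ, hu, hlim, hae⟩ := v.exists_testFunction_seq
  have hz : ∀ᵐ x, Tendsto (fun n => φ n (x + z)) atTop (𝓝 (v.fn (x + z))) :=
    (measurePreserving_add_right volume z).quasiMeasurePreserving.ae hae
  calc ∫⁻ x, ‖v.fn (x + z) - v.fn x‖ₑ
      = ∫⁻ x, liminf (fun n => ‖φ n (x + z) - φ n x‖ₑ) atTop := by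
        refine lintegral_congr_ae ?_
        filter_upwards [hae, hz] with x h1 h2
        exact ((h2.sub h1).enorm.liminf_eq).symm
    _ ≤ liminf (fun n => ∫⁻ x, ‖φ n (x + z) - φ n x‖ₑ) atTop := by
        refine lintegral_liminf_le fun n => Continuous.measurable ?_
        have := (hu n).contDiff.continuous
        fun_prop
    _ ≤ liminf (fun n => ‖z‖ₑ * (C * ‖(u n).grad‖ₑ)) atTop := by
        refine liminf_le_liminf (Eventually.of_forall fun n => ?_)
        refine (lintegral_translate_sub_le (hu n).contDiff_one z).trans ?_
        gcongr
        rw [← (hu n).eLpNorm_gradient]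
        exact hC _ (continuous_gradient (hu n).contDiff_one).aestronglyMeasurable
    _ = _ := by
        refine Tendsto.liminf_eq (ENNReal.Tendsto.const_mul
          (ENNReal.Tendsto.const_mul ?_ (by simp)) (by simp))
        exact ((X.continuous_grad.tendsto v).comp hlim).enorm

end EnergySpace

/-! ### Elementary inequalities for powers. -/

section Pointwise

/-- This is Bernoulli's inequality for `(b/a)^{r+1}`, multiplied by `a^{r+1}`. -/
lemma abs_rpow_mul_sub_le_of_nonneg {r a b : ℝ} (hr : 0 ≤ r) (hb : 0 ≤ b) (hab : b ≤ a) :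
    a ^ r * a - b ^ r * b ≤ (r + 1) * (a ^ r * (a - b)) := by
  rcases eq_or_lt_of_le (hb.trans hab) with h0 | ha
  · have : b = 0 := le_antisymm (by rw [h0]; exact hab) hb
    subst this; subst h0; simp
  have h := one_add_mul_self_le_rpow_one_add (s := b / a - 1) (p := r + 1)
    (by have : 0 ≤ b / a := by positivity
        linarith) (by linarith)
  have e : 1 + (b / a - 1) = b / a := by ring
  rw [e, Real.div_rpow hb ha.le] at h
  have hA : 0 < a ^ (r + 1) := Real.rpow_pos_of_pos ha _
  rw [le_div_iff₀ hA] at h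
  have e1 : a ^ (r + 1) = a ^ r * a := by rw [Real.rpow_add_one ha.ne']
  have e2 : b ^ (r + 1) = b ^ r * b := by
    rw [Real.rpow_add_one' hb (by linarith)]
  rw [e1, e2] at h
  have e3 : (1 + (r + 1) * (b / a - 1)) * (a ^ r * a) = a ^ r * a + (r + 1) * (a ^ r * (b - a)) := by
    field_simp
  rw [e3] at h
  linarith

/-- Local Lipschitz estimate for `x ↦ |x|^r x`. -/
lemma abs_abs_rpow_mul_sub_le {r : ℝ} (hr : 0 ≤ r) (a b : ℝ) :
    |(|a| ^ r * a) - |b| ^ r * b| ≤ (r + 1) * ((|a| ^ r + |b| ^ r) * |a - b|) := by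
  have main : ∀ a b : ℝ, 0 ≤ a → |b| ≤ a →
      |(|a| ^ r * a) - |b| ^ r * b| ≤ (r + 1) * ((|a| ^ r + |b| ^ r) * |a - b|) := by
    intro a b ha hb
    have hab := abs_le.1 hb
    have hA : 0 ≤ |a| ^ r := by positivity
    have hB : 0 ≤ |b| ^ r := by positivity
    have hBA : |b| ^ r ≤ |a| ^ r := by
      refine Real.rpow_le_rpow (abs_nonneg _) ?_ hr
      rwa [abs_of_nonneg ha]
    rw [abs_of_nonneg (a := a - b) (by linarith)]
    rcases le_total 0 b with h0 | h0
    · have h := abs_rpow_mul_sub_le_of_nonneg hr h0 hab.2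
      rw [abs_of_nonneg ha, abs_of_nonneg h0] at *
      rw [abs_of_nonneg (by nlinarith)]
      refine h.trans ?_
      have : 0 ≤ b ^ r * (a - b) := mul_nonneg hB (by linarith)
      nlinarith
    · rw [abs_of_nonneg (by nlinarith)]
      have h1 : |b| ^ r * (-b) ≤ |a| ^ r * (-b) :=
        mul_le_mul_of_nonneg_right hBA (by linarith)
      have h2 : 0 ≤ |b| ^ r * (a - b) := mul_nonneg hB (by linarith)
      have h3 : 0 ≤ |a| ^ r * (a - b) := mul_nonneg hA (by linarith)
      nlinarith
  have symm : ∀ a b : ℝ, |b| ≤ |a| →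
      |(|a| ^ r * a) - |b| ^ r * b| ≤ (r + 1) * ((|a| ^ r + |b| ^ r) * |a - b|) := by
    intro a b h
    rcases le_total 0 a with ha | ha
    · exact main a b ha (by rwa [abs_of_nonneg ha] at h)
    · have := main (-a) (-b) (by linarith) (by rwa [abs_neg, ← abs_of_nonpos ha])
      rw [abs_neg, abs_neg] at this
      convert this using 1
      · rw [← abs_neg]; ring_nf
      · rw [← abs_neg (a - b)]; ring_nf
  rcases le_total |b| |a| with h | h
  · exact symm a b h
  · have := symm b a h
    rwa [abs_sub_comm, abs_sub_comm b a, add_comm (|b| ^ r)] at this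

lemma abs_rpow_eq_mul_self {r : ℝ} (hr : 0 ≤ r) (a : ℝ) : |a| ^ (r + 2) = |a| ^ r * a * a := by
  rw [Real.rpow_add' (abs_nonneg _) (by linarith), mul_assoc, ← sq, Real.rpow_two, sq_abs]

/-- Convexity of `x ↦ |x|^{r+2} / (r+2)`. -/
lemma abs_rpow_mul_mul_sub_le {r : ℝ} (hr : 0 < r) (a b : ℝ) :
    |a| ^ r * a * (b - a) ≤ 1 / (r + 2) * (|b| ^ (r + 2) - |a| ^ (r + 2)) := by
  have hpq : (( r + 2) / (r + 1)).HolderConjugate (r + 2) := by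
    rw [Real.holderConjugate_iff]
    constructor
    · rw [lt_div_iff₀ (by linarith)]; linarith
    · field_simp; ring
  -- Young's inequality with the exponents `(r+2)/(r+1)` and `r+2` bounds the mixed term `|a|^r a
  -- b`.
  have h := Real.young_inequality_of_nonneg (a := |a| ^ (r + 1)) (b := |b|) (by positivity)
    (abs_nonneg b) hpq
  rw [← Real.rpow_mul (abs_nonneg _), mul_div_cancel₀ _ (by linarith)] at h
  have h1 : |a| ^ r * a * b ≤ |a| ^ (r + 1) * |b| := by
    rw [Real.rpow_add' (abs_nonneg _) (by linarith), Real.rpow_one]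
    calc |a| ^ r * a * b ≤ |(|a| ^ r * a * b)| := le_abs_self _
      _ = _ := by rw [abs_mul, abs_mul, abs_of_nonneg (by positivity : 0 ≤ |a| ^ r)]
  have h2 := abs_rpow_eq_mul_self hr.le a
  set A := |a| ^ (r + 2)
  have e : A / ((r + 2) / (r + 1)) = A - A / (r + 2) := by field_simp; ring
  rw [e] at h
  have : |a| ^ r * a * (b - a) = |a| ^ r * a * b - A := by rw [h2]; ring
  rw [this]
  have : 1 / (r + 2) * (|b| ^ (r + 2) - A) = |b| ^ (r + 2) / (r + 2) - A / (r + 2) := by ring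
  linarith

lemma abs_add_rpow_le {r : ℝ} (hr : 0 ≤ r) (a b : ℝ) :
    |a + b| ^ r ≤ 2 ^ r * (|a| ^ r + |b| ^ r) := by
  have h : |a + b| ≤ 2 * max |a| |b| := by
    have := abs_add_le a b
    linarith [le_max_left |a| |b|, le_max_right |a| |b|]
  refine (Real.rpow_le_rpow (abs_nonneg _) h hr).trans ?_
  rw [Real.mul_rpow (by norm_num) (le_max_of_le_left (abs_nonneg _))]
  gcongr
  rcases max_choice |a| |b| with h | h <;> rw [h]
  · linarith [Real.rpow_nonneg (abs_nonneg b) r]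
  · linarith [Real.rpow_nonneg (abs_nonneg a) r]

end Pointwise

/-! ### A three-factor Hölder inequality. -/

section Holder

/-- Hölder's inequality applied to the `q`-th powers of the three functions, with the weights
`(q-2)/q`, `1/q`, `1/q`, which add up to one. -/
lemma lintegral_rpow_mul_mul_le {α : Type*} [MeasurableSpace α] {μ : Measure α} {q : ℝ} (hq : 2 < q)
    {f g h : α → ℝ} (hf : AEStronglyMeasurable f μ) (hg : AEStronglyMeasurable g μ)
    (hh : AEStronglyMeasurable h μ) :
    ∫⁻ x, ‖f x‖ₑ ^ (q - 2) * ‖g x‖ₑ * ‖h x‖ₑ ∂μ ≤ eLpNorm f (ENNReal.ofReal q) μ ^ (q - 2)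
      * eLpNorm g (ENNReal.ofReal q) μ * eLpNorm h (ENNReal.ofReal q) μ := by
  have hq0 : 0 < q := by linarith
  have key := ENNReal.lintegral_prod_norm_pow_le (μ := μ) (Finset.univ : Finset (Fin 3))
    (f := ![fun x => ‖f x‖ₑ ^ q, fun x => ‖g x‖ₑ ^ q, fun x => ‖h x‖ₑ ^ q])
    (p := ![(q - 2) / q, 1 / q, 1 / q])
    (by
      intro i _
      fin_cases i
      · exact hf.enorm.pow_const q
      · exact hg.enorm.pow_const q
      · exact hh.enorm.pow_const q)
    (by simp [Fin.sum_univ_three]; field_simp; ring)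
    (by
      intro i _
      fin_cases i
      · exact div_nonneg (by linarith) hq0.le
      · exact div_nonneg zero_le_one hq0.le
      · exact div_nonneg zero_le_one hq0.le)
  simp only [Fin.prod_univ_three, Matrix.cons_val_zero, Matrix.cons_val_one, Matrix.cons_val] at key
  have h0 : ENNReal.ofReal q ≠ 0 := by simpa using hq0
  have e1 : ∀ t : ENNReal, (t ^ q) ^ ((q - 2) / q) = t ^ (q - 2) := fun t => by
    rw [← ENNReal.rpow_mul, mul_div_cancel₀ _ hq0.ne']
  have e2 : ∀ t : ENNReal, (t ^ q) ^ (1 / q) = t := fun t => by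
    rw [← ENNReal.rpow_mul, mul_div_cancel₀ _ hq0.ne', ENNReal.rpow_one]
  simp only [e1, e2] at key
  simp only [eLpNorm_eq_lintegral_rpow_enorm_toReal h0 ENNReal.ofReal_ne_top,
    ENNReal.toReal_ofReal hq0.le]
  rw [← ENNReal.rpow_mul, one_div_mul_eq_div]
  exact key

end Holder

/-! ### The critical nonlinearity on `X`. -/

section Nonlinearity

variable {N : ℕ}

lemma critExp_sub_two_pos (hN : 3 ≤ N) : 0 < critExp N - 2 := by
  linarith [two_lt_critExp hN]

/-- The trilinear estimate behind all bounds on the critical nonlinearity. -/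
lemma X.exists_trilinear (hN : 3 ≤ N) : ∃ C : ℝ, 0 < C ∧ ∀ a b c : X N,
    Integrable (fun y => |a.fn y| ^ (critExp N - 2) * |b.fn y| * |c.fn y|) (measureK N) ∧
    ∫ y, |a.fn y| ^ (critExp N - 2) * |b.fn y| * |c.fn y| ∂(measureK N)
      ≤ C * (‖a.grad‖ ^ (critExp N - 2) * ‖b.grad‖ * ‖c.grad‖) := by
  obtain ⟨S, hS⟩ := X.exists_sobolev hN
  have hr := critExp_sub_two_pos hN
  -- The summand `1` keeps the constant positive even if the Sobolev constant is zero.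
  refine ⟨(S : ℝ) ^ (critExp N - 2) * S * S + 1, by positivity, fun a b c => ?_⟩
  have hm : AEStronglyMeasurable
      (fun y => |a.fn y| ^ (critExp N - 2) * |b.fn y| * |c.fn y|) (measureK N) := by
    have h1 := a.aestronglyMeasurable_fn.norm
    have h2 := b.aestronglyMeasurable_fn.norm
    have h3 := c.aestronglyMeasurable_fn.norm
    exact ((h1.aemeasurable.pow_const _).mul h2.aemeasurable).mul h3.aemeasurable
      |>.aestronglyMeasurable
  have hnn : ∀ y, 0 ≤ |a.fn y| ^ (critExp N - 2) * |b.fn y| * |c.fn y| := fun y => by positivity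
  have hb : ∫⁻ y, ENNReal.ofReal (|a.fn y| ^ (critExp N - 2) * |b.fn y| * |c.fn y|) ∂(measureK N)
      ≤ ENNReal.ofReal (((S : ℝ) ^ (critExp N - 2) * S * S)
        * (‖a.grad‖ ^ (critExp N - 2) * ‖b.grad‖ * ‖c.grad‖)) := by
    calc _ = ∫⁻ y, ‖a.fn y‖ₑ ^ (critExp N - 2) * ‖b.fn y‖ₑ * ‖c.fn y‖ₑ ∂(measureK N) := by
          refine lintegral_congr fun y => ?_
          rw [ENNReal.ofReal_mul (by positivity), ENNReal.ofReal_mul (by positivity),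
            ← ENNReal.ofReal_rpow_of_nonneg (abs_nonneg _) hr.le]
          simp only [← Real.norm_eq_abs, ofReal_norm]
      _ ≤ _ := lintegral_rpow_mul_mul_le (two_lt_critExp hN) a.aestronglyMeasurable_fn
          b.aestronglyMeasurable_fn c.aestronglyMeasurable_fn
      _ ≤ (S * ‖a.grad‖ₑ) ^ (critExp N - 2) * (S * ‖b.grad‖ₑ) * (S * ‖c.grad‖ₑ) := by
          gcongr
          · exact hS a
          · exact hS b
          · exact hS c
      _ = _ := by
          have e : ((S : ℝ) ^ (critExp N - 2) * S * S)
              * (‖a.grad‖ ^ (critExp N - 2) * ‖b.grad‖ * ‖c.grad‖)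
              = (S * ‖a.grad‖) ^ (critExp N - 2) * (S * ‖b.grad‖) * (S * ‖c.grad‖) := by
            rw [Real.mul_rpow S.coe_nonneg (norm_nonneg _)]; ring
          rw [e, ENNReal.ofReal_mul (by positivity), ENNReal.ofReal_mul (by positivity),
            ← ENNReal.ofReal_rpow_of_nonneg (by positivity) hr.le]
          simp only [ENNReal.ofReal_mul S.coe_nonneg, ofReal_norm, ENNReal.ofReal_coe_nnreal]
  refine ⟨⟨hm, ?_⟩, ?_⟩
  · rw [hasFiniteIntegral_iff_ofReal (Eventually.of_forall hnn)]
    exact hb.trans_lt ENNReal.ofReal_lt_top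
  · rw [integral_eq_lintegral_of_nonneg_ae (Eventually.of_forall hnn) hm]
    refine (ENNReal.toReal_le_of_le_ofReal (by positivity) hb).trans ?_
    gcongr
    linarith

/-- The critical nonlinearity `∫ |v|^{2*-2} v w K dy`. -/
def nonlin (v w : X N) : ℝ :=
  ∫ y, |v.fn y| ^ (critExp N - 2) * v.fn y * w.fn y ∂(measureK N)

lemma aestronglyMeasurable_rpow_mul (v : X N) :
    AEStronglyMeasurable (fun y => |v.fn y| ^ (critExp N - 2) * v.fn y) (measureK N) :=
  ((v.aestronglyMeasurable_fn.norm.aemeasurable.pow_const _).mul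
    v.aestronglyMeasurable_fn.aemeasurable).aestronglyMeasurable

lemma integrable_nonlin (hN : 3 ≤ N) (v w : X N) :
    Integrable (fun y => |v.fn y| ^ (critExp N - 2) * v.fn y * w.fn y) (measureK N) := by
  obtain ⟨C, -, hC⟩ := X.exists_trilinear hN
  refine (hC v v w).1.mono ((aestronglyMeasurable_rpow_mul v).mul w.aestronglyMeasurable_fn)
    (Eventually.of_forall fun y => ?_)
  simp only [norm_mul, Real.norm_eq_abs, abs_abs]
  exact le_rfl

lemma nonlin_sub_right (hN : 3 ≤ N) (v w w' : X N) :
    nonlin v (w - w') = nonlin v w - nonlin v w' := by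
  unfold nonlin
  rw [← integral_sub (integrable_nonlin hN v w) (integrable_nonlin hN v w')]
  refine integral_congr_ae ?_
  filter_upwards [Lp.coeFn_sub w.fn w'.fn] with y hy
  rw [X.fn_sub, hy, Pi.sub_apply]; ring

lemma exists_abs_nonlin_le (hN : 3 ≤ N) : ∃ C : ℝ, 0 < C ∧ ∀ v w : X N,
    |nonlin v w| ≤ C * (‖v.grad‖ ^ (critExp N - 2) * ‖v.grad‖ * ‖w.grad‖) := by
  obtain ⟨C, hC0, hC⟩ := X.exists_trilinear hN
  refine ⟨C, hC0, fun v w => le_trans ?_ (hC v v w).2⟩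
  refine (abs_integral_le_integral_abs).trans (le_of_eq (integral_congr_ae ?_))
  refine Eventually.of_forall fun y => ?_
  simp [abs_mul, abs_of_nonneg (Real.rpow_nonneg (abs_nonneg _) _)]

/-- The integrals are left unestimated because they are bounded in three ways later: by the
trilinear estimate, by compactness, and by truncation against a test function. -/
lemma abs_nonlin_sub_le (hN : 3 ≤ N) (v v' w : X N) :
    |nonlin v w - nonlin v' w| ≤ (critExp N - 1) *
      (∫ y, |v.fn y| ^ (critExp N - 2) * |(v - v').fn y| * |w.fn y| ∂(measureK N)
      + ∫ y, |v'.fn y| ^ (critExp N - 2) * |(v - v').fn y| * |w.fn y| ∂(measureK N)) := by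
  obtain ⟨C, hC0, hC⟩ := X.exists_trilinear hN
  have hr := critExp_sub_two_pos hN
  rw [nonlin, nonlin, ← integral_sub (integrable_nonlin hN v w) (integrable_nonlin hN v' w),
    ← integral_add (hC v (v - v') w).1 (hC v' (v - v') w).1, ← integral_const_mul]
  refine (abs_integral_le_integral_abs).trans (integral_mono_ae
    ((integrable_nonlin hN v w).sub (integrable_nonlin hN v' w)).abs
    (((hC v (v - v') w).1.add (hC v' (v - v') w).1).const_mul _) ?_)
  filter_upwards [Lp.coeFn_sub v.fn v'.fn] with y hy
  rw [X.fn_sub, hy, Pi.sub_apply, ← sub_mul, abs_mul]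
  have h := mul_le_mul_of_nonneg_right (abs_abs_rpow_mul_sub_le hr.le (v.fn y) (v'.fn y))
    (abs_nonneg (w.fn y))
  refine h.trans (le_of_eq ?_)
  ring

/-- The nonlinearity is locally Lipschitz in its first argument. -/
lemma exists_abs_nonlin_sub_le (hN : 3 ≤ N) : ∃ C : ℝ, 0 < C ∧ ∀ v v' w : X N,
    |nonlin v w - nonlin v' w| ≤ C * ((‖v.grad‖ ^ (critExp N - 2) + ‖v'.grad‖ ^ (critExp N - 2))
      * ‖(v - v').grad‖ * ‖w.grad‖) := by
  obtain ⟨C, hC0, hC⟩ := X.exists_trilinear hN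
  have hr := critExp_sub_two_pos hN
  refine ⟨(critExp N - 1) * C, mul_pos (by linarith) hC0, fun v v' w => ?_⟩
  refine (abs_nonlin_sub_le hN v v' w).trans ?_
  rw [mul_assoc]
  refine mul_le_mul_of_nonneg_left ?_ (by linarith)
  have h1 := (hC v (v - v') w).2
  have h2 := (hC v' (v - v') w).2
  linarith

lemma integral_abs_rpow_eq_nonlin (hN : 3 ≤ N) (v : X N) :
    ∫ y, |v.fn y| ^ critExp N ∂(measureK N) = nonlin v v := by
  refine integral_congr_ae (Eventually.of_forall fun y => ?_)
  have := abs_rpow_eq_mul_self (critExp_sub_two_pos hN).le (v.fn y)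
  simpa using this

lemma integrable_abs_rpow (hN : 3 ≤ N) (v : X N) :
    Integrable (fun y => |v.fn y| ^ critExp N) (measureK N) := by
  refine (integrable_nonlin hN v v).congr (Eventually.of_forall fun y => ?_)
  have := abs_rpow_eq_mul_self (critExp_sub_two_pos hN).le (v.fn y)
  simpa using this.symm

/-- The convex functional `(1/2*) ∫ |v|^{2*} K` lies above its tangents. It enters the energy with a
minus sign, so this gives an upper bound for energy increments without any second derivative. -/
lemma nonlin_sub_le (hN : 3 ≤ N) (a b : X N) :
    nonlin a (b - a) ≤ 1 / critExp N * (nonlin b b - nonlin a a) := by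
  have hr := critExp_sub_two_pos hN
  rw [← integral_abs_rpow_eq_nonlin hN, ← integral_abs_rpow_eq_nonlin hN,
    ← integral_sub (integrable_abs_rpow hN b) (integrable_abs_rpow hN a), ← integral_const_mul]
  refine integral_mono_ae (integrable_nonlin hN _ _)
    (((integrable_abs_rpow hN b).sub (integrable_abs_rpow hN a)).const_mul _) ?_
  filter_upwards [Lp.coeFn_sub b.fn a.fn] with y hy
  rw [X.fn_sub, hy, Pi.sub_apply]
  simpa using abs_rpow_mul_mul_sub_le hr (a.fn y) (b.fn y)

end Nonlinearity

/-! ### The quadratic form, the energy and its differential. -/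

section Form

variable {N : ℕ}

lemma X.memLp_div (hN : 3 ≤ N) (v : X N) : MemLp (fun y => v.fn y / ‖y‖) 2 (measureK N) := by
  have hm : AEStronglyMeasurable (fun y => v.fn y / ‖y‖) (measureK N) :=
    (v.aestronglyMeasurable_fn.aemeasurable.div (by fun_prop)).aestronglyMeasurable
  rw [memLp_two_iff_integrable_sq hm]
  simpa [div_pow] using v.integrable_sq_div hN

/-- `v ↦ v / |y|` as a map `X → L²_K`. -/
def X.hardyL (hN : 3 ≤ N) : X N →L[ℝ] L2K N :=
  LinearMap.mkContinuous
    { toFun := fun v => (v.memLp_div hN).toLp _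
      map_add' := fun v w => by
        rw [← MemLp.toLp_add]
        refine MemLp.toLp_congr _ _ ?_
        filter_upwards [Lp.coeFn_add v.fn w.fn] with y hy
        rw [X.fn_add, hy, Pi.add_apply, Pi.add_apply, add_div]
      map_smul' := fun c v => by
        rw [RingHom.id_apply, ← MemLp.toLp_const_smul]
        refine MemLp.toLp_congr _ _ ?_
        filter_upwards [Lp.coeFn_smul c v.fn] with y hy
        rw [X.fn_smul, hy, Pi.smul_apply, Pi.smul_apply, smul_eq_mul, smul_eq_mul, mul_div_assoc] }
    (2 / ((N : ℝ) - 2)) (fun v => by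
      have hN' : (3 : ℝ) ≤ N := by exact_mod_cast hN
      have h2 : 0 < (N : ℝ) - 2 := by linarith
      refine abs_le_of_sq_le_sq' ?_ (by positivity) |>.2
      change ‖(v.memLp_div hN).toLp _‖ ^ 2 ≤ _
      rw [← integral_norm_sq_eq, mul_pow, v.norm_eq hN]
      have h := v.hardy hN
      have e : (2 / ((N : ℝ) - 2)) ^ 2 = 4 / ((N : ℝ) - 2) ^ 2 := by rw [div_pow]; norm_num
      rw [e]
      refine le_trans (le_of_eq (integral_congr_ae ?_)) h
      filter_upwards [(v.memLp_div hN).coeFn_toLp] with y hy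
      rw [hy, Real.norm_eq_abs, sq_abs, div_pow])

lemma X.hardyL_ae (hN : 3 ≤ N) (v : X N) :
    X.hardyL hN v =ᵐ[measureK N] fun y => v.fn y / ‖y‖ := (v.memLp_div hN).coeFn_toLp

lemma X.inner_hardyL (hN : 3 ≤ N) (v w : X N) :
    ⟪X.hardyL hN v, X.hardyL hN w⟫_ℝ = ∫ y, v.fn y / ‖y‖ ^ 2 * w.fn y ∂(measureK N) := by
  rw [L2.inner_def]
  refine integral_congr_ae ?_
  filter_upwards [X.hardyL_ae hN v, X.hardyL_ae hN w] with y h1 h2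
  simp only [h1, h2, RCLike.inner_apply, conj_trivial]
  rw [div_mul_div_comm]
  ring

lemma X.norm_hardyL_sq_le (hN : 3 ≤ N) (v : X N) :
    ‖X.hardyL hN v‖ ^ 2 ≤ 4 / ((N : ℝ) - 2) ^ 2 * ‖v.grad‖ ^ 2 := by
  refine le_trans (le_of_eq ?_) (v.hardy hN)
  rw [← real_inner_self_eq_norm_sq, X.inner_hardyL]
  congr 1; ext y; ring

/-- The linear part of the problem as a bilinear form on `X`. -/
def form (hN : 3 ≤ N) (μ : ℝ) (v w : X N) : ℝ :=
  ⟪v.grad, w.grad⟫_ℝ - μ * ⟪X.hardyL hN v, X.hardyL hN w⟫_ℝ - beta N * ⟪v.fn, w.fn⟫_ℝ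

lemma reaction_eq (hN : 3 ≤ N) (μ : ℝ) (v w : X N) :
    reaction μ v w
      = nonlin v w + μ * ⟪X.hardyL hN v, X.hardyL hN w⟫_ℝ + beta N * ⟪v.fn, w.fn⟫_ℝ := by
  have h1 := integrable_nonlin hN v w
  have h2 : Integrable (fun y => v.fn y / ‖y‖ ^ 2 * w.fn y) (measureK N) := by
    refine (L2.integrable_inner (𝕜 := ℝ) (X.hardyL hN v) (X.hardyL hN w)).congr ?_
    filter_upwards [X.hardyL_ae hN v, X.hardyL_ae hN w] with y h1 h2
    simp only [h1, h2, RCLike.inner_apply, conj_trivial]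
    rw [div_mul_div_comm]
    ring
  have h3 : Integrable (fun y => v.fn y * w.fn y) (measureK N) := by
    refine (L2.integrable_inner (𝕜 := ℝ) v.fn w.fn).congr (Eventually.of_forall fun y => ?_)
    simp [mul_comm]
  have e3 : ⟪v.fn, w.fn⟫_ℝ = ∫ y, v.fn y * w.fn y ∂(measureK N) := by
    rw [L2.inner_def]
    refine integral_congr_ae (Eventually.of_forall fun y => ?_)
    simp [mul_comm]
  have h12 : Integrable (fun y => |v.fn y| ^ (critExp N - 2) * v.fn y * w.fn y
      + μ * (v.fn y / ‖y‖ ^ 2 * w.fn y)) (measureK N) := h1.add (h2.const_mul μ)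
  rw [X.inner_hardyL, e3, nonlin, ← integral_const_mul, ← integral_const_mul,
    ← integral_add h1 (h2.const_mul μ), ← integral_add h12 (h3.const_mul _)]
  refine integral_congr_ae (Eventually.of_forall fun y => ?_)
  simp only
  ring

lemma denergy_eq (hN : 3 ≤ N) (μ : ℝ) (v w : X N) :
    denergy μ v w = form hN μ v w - nonlin v w := by
  rw [denergy, reaction_eq hN, form]; ring

lemma energy_eq (hN : 3 ≤ N) (μ : ℝ) (v : X N) :
    energy μ v = 1 / 2 * form hN μ v v - 1 / critExp N * nonlin v v := by
  have e : ∫ y, v.fn y ^ 2 / ‖y‖ ^ 2 ∂(measureK N) = ⟪X.hardyL hN v, X.hardyL hN v⟫_ℝ := by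
    rw [X.inner_hardyL]; congr 1; ext y; ring
  rw [energy, form, integral_abs_rpow_eq_nonlin hN, e, real_inner_self_eq_norm_sq v.grad,
    real_inner_self_eq_norm_sq v.fn]

lemma form_comm (hN : 3 ≤ N) (μ : ℝ) (v w : X N) : form hN μ v w = form hN μ w v := by
  simp only [form]
  rw [real_inner_comm v.grad, real_inner_comm v.fn, real_inner_comm (X.hardyL hN v)]

lemma form_sub_left (hN : 3 ≤ N) (μ : ℝ) (v v' w : X N) :
    form hN μ (v - v') w = form hN μ v w - form hN μ v' w := by
  simp only [form, X.grad_sub, X.fn_sub, map_sub, inner_sub_left]; ring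

lemma form_sub_right (hN : 3 ≤ N) (μ : ℝ) (v w w' : X N) :
    form hN μ v (w - w') = form hN μ v w - form hN μ v w' := by
  simp only [form, X.grad_sub, X.fn_sub, map_sub, inner_sub_right]; ring

/-- Coercivity of the linear part. -/
lemma form_coercive (hN : 3 ≤ N) {μ : ℝ} (hμ₁ : μ ≤ ((N : ℝ) - 2) ^ 2 / 8)
    (v : X N) : 1 / (N : ℝ) * ‖v.grad‖ ^ 2 ≤ form hN μ v v := by
  have hN' : (3 : ℝ) ≤ N := by exact_mod_cast hN
  have h2 : 0 < (N : ℝ) - 2 := by linarith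
  have hp := v.poincare
  have hh := v.norm_hardyL_sq_le hN
  simp only [form, real_inner_self_eq_norm_sq]
  -- The bound on `μ` is half the Hardy constant, so the potential costs at most `1/2` of the
  -- gradient term. By Poincaré the `β` term costs `1/2 - 1/N`, and `1/N` is left.
  have k1 : μ * ‖X.hardyL hN v‖ ^ 2 ≤ 1 / 2 * ‖v.grad‖ ^ 2 := by
    calc μ * ‖X.hardyL hN v‖ ^ 2 ≤ ((N : ℝ) - 2) ^ 2 / 8 * (4 / ((N : ℝ) - 2) ^ 2 * ‖v.grad‖ ^ 2) :=
          mul_le_mul hμ₁ hh (sq_nonneg _) (by positivity)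
      _ = _ := by field_simp; ring
  have k2 : beta N * ‖v.fn‖ ^ 2 ≤ (1 / 2 - 1 / N) * ‖v.grad‖ ^ 2 := by
    have e : beta N = (1 / 2 - 1 / N) * (N / 2) := by unfold beta; field_simp; ring
    rw [e, mul_assoc]
    refine mul_le_mul_of_nonneg_left hp ?_
    rw [sub_nonneg]
    exact one_div_le_one_div_of_le (by norm_num) (by linarith)
  linarith

lemma form_self_nonneg (hN : 3 ≤ N) {μ : ℝ} (hμ₁ : μ ≤ ((N : ℝ) - 2) ^ 2 / 8)
    (v : X N) : 0 ≤ form hN μ v v :=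
  le_trans (by positivity) (form_coercive hN hμ₁ v)

lemma continuous_form (hN : 3 ≤ N) (μ : ℝ) :
    Continuous fun p : X N × X N => form hN μ p.1 p.2 := by
  unfold form
  have h1 : Continuous (X.grad : X N → L2KVec N) := X.continuous_grad
  have h2 : Continuous (X.fn : X N → L2K N) := X.continuous_fn
  have h3 := (X.hardyL hN).continuous
  refine ((Continuous.inner (h1.comp continuous_fst) (h1.comp continuous_snd)).sub
    (continuous_const.mul (Continuous.inner (h3.comp continuous_fst) (h3.comp continuous_snd)))).sub
    (continuous_const.mul (Continuous.inner (h2.comp continuous_fst) (h2.comp continuous_snd)))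

lemma continuous_nonlin (hN : 3 ≤ N) : Continuous fun p : X N × X N => nonlin p.1 p.2 := by
  obtain ⟨C, hC0, hC⟩ := exists_abs_nonlin_sub_le hN
  obtain ⟨D, hD0, hD⟩ := exists_abs_nonlin_le hN
  have hr := critExp_sub_two_pos hN
  have hg : Continuous (X.grad : X N → L2KVec N) := X.continuous_grad
  have hpow : ∀ f : X N × X N → X N, Continuous f →
      Continuous fun p => ‖(f p).grad‖ ^ (critExp N - 2) := fun f hf =>
    (hg.comp hf).norm.rpow_const fun _ => Or.inr hr.le
  refine continuous_iff_continuousAt.2 fun p₀ => ?_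
  rw [ContinuousAt, tendsto_iff_dist_tendsto_zero]
  set B : X N × X N → ℝ := fun p =>
    C * ((‖p.1.grad‖ ^ (critExp N - 2) + ‖p₀.1.grad‖ ^ (critExp N - 2)) * ‖(p.1 - p₀.1).grad‖
      * ‖p.2.grad‖) + D * (‖p₀.1.grad‖ ^ (critExp N - 2) * ‖p₀.1.grad‖ * ‖(p.2 - p₀.2).grad‖)
    with hB
  have hBc : Continuous B := by
    have h1 := hpow _ continuous_fst
    have h2 : Continuous fun p : X N × X N => ‖(p.1 - p₀.1).grad‖ :=
      (hg.comp (continuous_fst.sub continuous_const)).norm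
    have h3 : Continuous fun p : X N × X N => ‖p.2.grad‖ := (hg.comp continuous_snd).norm
    have h4 : Continuous fun p : X N × X N => ‖(p.2 - p₀.2).grad‖ :=
      (hg.comp (continuous_snd.sub continuous_const)).norm
    fun_prop
  have hB0 : Tendsto B (𝓝 p₀) (𝓝 0) := by
    have := hBc.tendsto p₀
    have e : B p₀ = 0 := by simp [hB, X.grad]
    rwa [e] at this
  refine squeeze_zero (fun _ => dist_nonneg) (fun p => ?_) hB0
  rw [Real.dist_eq]
  have e : nonlin p.1 p.2 - nonlin p₀.1 p₀.2
      = (nonlin p.1 p.2 - nonlin p₀.1 p.2) + nonlin p₀.1 (p.2 - p₀.2) := by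
    rw [nonlin_sub_right hN]; ring
  rw [e]
  exact (abs_add_le _ _).trans (add_le_add (hC _ _ _) (hD _ _))

lemma continuous_energy (hN : 3 ≤ N) (μ : ℝ) : Continuous (energy μ : X N → ℝ) := by
  have e : (energy μ : X N → ℝ) = fun v => 1 / 2 * form hN μ v v - 1 / critExp N * nonlin v v :=
    funext fun v => energy_eq hN μ v
  rw [e]
  have hd : Continuous fun v : X N => (v, v) := continuous_id.prodMk continuous_id
  exact (continuous_const.mul ((continuous_form hN μ).comp hd)).sub
    (continuous_const.mul ((continuous_nonlin hN).comp hd))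

lemma continuous_reaction (hN : 3 ≤ N) (μ : ℝ) :
    Continuous fun p : X N × X N => reaction μ p.1 p.2 := by
  have h1 : Continuous fun p : X N × X N => ⟪p.1.grad, p.2.grad⟫_ℝ :=
    Continuous.inner (X.continuous_grad.comp continuous_fst) (X.continuous_grad.comp continuous_snd)
  have h := (h1.sub (continuous_form hN μ)).add (continuous_nonlin hN)
  have e : (fun p : X N × X N => reaction μ p.1 p.2) = fun p : X N × X N =>
      ⟪p.1.grad, p.2.grad⟫_ℝ - form hN μ p.1 p.2 + nonlin p.1 p.2 :=
    funext fun p => by rw [reaction_eq hN, form]; ring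
  rw [e]
  exact h

/-- One-sided Taylor estimate for the energy. -/
lemma energy_sub_le (hN : 3 ≤ N) (μ : ℝ) (a b : X N) :
    energy μ b - energy μ a ≤ denergy μ a (b - a) + 1 / 2 * form hN μ (b - a) (b - a) := by
  -- The quadratic part expands exactly and the power part is concave, so the only remainder is the
  -- quadratic form of the increment.
  have h := nonlin_sub_le hN a b
  rw [energy_eq hN, energy_eq hN, denergy_eq hN]
  simp only [form_sub_left, form_sub_right]
  rw [form_comm hN μ b a]
  linarith

/-- On compact subsets of `X` the critical potential `|a|^{2*-2}` is an infinitesimally form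
bounded perturbation. -/
lemma exists_compact_trilinear_le (hN : 3 ≤ N) {S : Set (X N)} (hS : IsCompact S) {ε : ℝ}
    (hε : 0 < ε) : ∃ M : ℝ, 0 ≤ M ∧ ∀ a ∈ S, ∀ u : X N,
      ∫ y, |a.fn y| ^ (critExp N - 2) * |u.fn y| * |u.fn y| ∂(measureK N)
        ≤ ε * ‖u.grad‖ ^ 2 + M * ‖u.fn‖ ^ 2 := by
  obtain ⟨C, hC0, hC⟩ := X.exists_trilinear hN
  have hr := critExp_sub_two_pos hN
  set r := critExp N - 2 with hrdef
  -- Two constants `M` combine into their maximum, so by compactness a neighbourhood of each point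
  -- suffices.
  refine hS.induction_on (p := fun S => ∃ M : ℝ, 0 ≤ M ∧ ∀ a ∈ S, ∀ u : X N,
      ∫ y, |a.fn y| ^ r * |u.fn y| * |u.fn y| ∂(measureK N)
        ≤ ε * ‖u.grad‖ ^ 2 + M * ‖u.fn‖ ^ 2) ?_ ?_ ?_ ?_
  · exact ⟨0, le_rfl, by simp⟩
  · rintro s t hst ⟨M, hM, h⟩
    exact ⟨M, hM, fun a ha => h a (hst ha)⟩
  · rintro s t ⟨M, hM, h⟩ ⟨M', hM', h'⟩
    refine ⟨max M M', le_max_of_le_left hM, fun a ha u => ?_⟩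
    rcases ha with ha | ha
    · refine (h a ha u).trans ?_
      gcongr; exact le_max_left _ _
    · refine (h' a ha u).trans ?_
      gcongr; exact le_max_right _ _
  · intro a₀ _
    have hlim : Tendsto (fun η : ℝ => 2 ^ r * (C * η ^ r)) (𝓝[>] 0) (𝓝 0) := by
      have h : ContinuousAt (fun η : ℝ => 2 ^ r * (C * η ^ r)) 0 :=
        continuousAt_const.mul (continuousAt_const.mul
          (Real.continuousAt_rpow_const _ _ (Or.inr hr.le)))
      have h' := h.tendsto
      simp only [Real.zero_rpow hr.ne', mul_zero] at h'
      exact h'.mono_left nhdsWithin_le_nhds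
    -- Near `a₀` each `a` is a fixed bounded test function plus a part of norm below `η`. The
    -- trilinear estimate makes the small part cost at most `ε`; the bounded part goes into `M`.
    obtain ⟨η, hη, hη0⟩ := ((hlim.eventually_lt_const hε).and self_mem_nhdsWithin).exists
    obtain ⟨u, φ, hu, hulim, -⟩ := a₀.exists_testFunction_seq
    have hn : Tendsto (fun n => ‖(a₀ - u n).grad‖) atTop (𝓝 0) := by
      have : Continuous fun z : X N => ‖(a₀ - z).grad‖ :=
        (X.continuous_grad.comp
          (continuous_const.sub continuous_id : Continuous fun z : X N => a₀ - z)).norm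
      have h := (this.tendsto a₀).comp hulim
      simpa [X.grad, Function.comp_def] using h
    obtain ⟨n, hn⟩ := (hn.eventually_lt_const (show 0 < η from hη0)).exists
    obtain ⟨B, hB⟩ := (hu n).hasCompactSupport.exists_bound_of_continuous (hu n).contDiff.continuous
    have hB0 : 0 ≤ B := (norm_nonneg _).trans (hB 0)
    have hopen : {a : X N | ‖(a - u n).grad‖ < η} ∈ 𝓝 a₀ :=
      IsOpen.mem_nhds (isOpen_lt (X.continuous_grad.comp
        (continuous_id.sub continuous_const : Continuous fun z : X N => z - u n)).norm
        continuous_const) hn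
    refine ⟨_, mem_nhdsWithin_of_mem_nhds hopen, 2 ^ r * B ^ r, by positivity, fun a ha w => ?_⟩
    have ha' : ‖(a - u n).grad‖ < η := ha
    have hwint : Integrable (fun y => ‖w.fn y‖ ^ 2) (measureK N) :=
      (memLp_two_iff_integrable_sq_norm w.aestronglyMeasurable_fn).1 (Lp.memLp _)
    calc ∫ y, |a.fn y| ^ r * |w.fn y| * |w.fn y| ∂(measureK N)
        ≤ ∫ y, (2 ^ r * (|(a - u n).fn y| ^ r * |w.fn y| * |w.fn y|)
          + 2 ^ r * B ^ r * ‖w.fn y‖ ^ 2) ∂(measureK N) := by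
          refine integral_mono_ae (hC a w w).1
            (((hC (a - u n) w w).1.const_mul _).add (hwint.const_mul _)) ?_
          filter_upwards [Lp.coeFn_sub a.fn (u n).fn, (hu n).fn_ae] with y h1 h2
          have h3 : |a.fn y| ^ r ≤ 2 ^ r * (|(a - u n).fn y| ^ r + B ^ r) := by
            have e : a.fn y = (a - u n).fn y + φ n y := by
              rw [X.fn_sub, h1, Pi.sub_apply, h2]; ring
            conv_lhs => rw [e]
            refine (abs_add_rpow_le hr.le _ _).trans ?_
            gcongr
            exact hB y
          have h4 := mul_le_mul_of_nonneg_right h3 (mul_self_nonneg |w.fn y|)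
          rw [Real.norm_eq_abs, sq]
          linarith
      _ = 2 ^ r * (∫ y, |(a - u n).fn y| ^ r * |w.fn y| * |w.fn y| ∂(measureK N))
          + 2 ^ r * B ^ r * ‖w.fn‖ ^ 2 := by
          rw [integral_add ((hC (a - u n) w w).1.const_mul _) (hwint.const_mul _),
            integral_const_mul, integral_const_mul, integral_norm_sq_eq]
      _ ≤ 2 ^ r * (C * (η ^ r * ‖w.grad‖ * ‖w.grad‖)) + 2 ^ r * B ^ r * ‖w.fn‖ ^ 2 := by
          have h := (hC (a - u n) w w).2
          have : ‖(a - u n).grad‖ ^ r ≤ η ^ r := Real.rpow_le_rpow (norm_nonneg _) ha'.le hr.le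
          gcongr
          refine h.trans ?_
          gcongr
      _ ≤ ε * ‖w.grad‖ ^ 2 + 2 ^ r * B ^ r * ‖w.fn‖ ^ 2 := by
          have := mul_le_mul_of_nonneg_right hη.le (sq_nonneg ‖w.grad‖)
          linarith

end Form

/-! ### Weak compactness in `X` and Rellich's theorem. -/

section WeakConvergence

variable {N : ℕ}

/-- `v ↦ ∇v` as an isometry. -/
def X.gradIsometry (hN : 3 ≤ N) : X N →ₗᵢ[ℝ] L2KVec N where
  toLinearMap := (X.gradL N).toLinearMap
  norm_map' v := (v.norm_eq hN).symm

/-- The Riesz representation theorem for the gradient inner product. -/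
lemma X.exists_riesz (hN : 3 ≤ N) (L : X N →L[ℝ] ℝ) :
    ∃ w : X N, ∀ v : X N, L v = ⟪w.grad, v.grad⟫_ℝ := by
  -- As a subspace of a product, `X` carries a maximum norm and no inner product. The representation
  -- theorem is therefore applied in its isometric image in `L²_K`, which inherits completeness.
  set e := (X.gradIsometry hN).equivRange with he
  have : CompleteSpace (LinearMap.range (X.gradIsometry hN).toLinearMap) :=
    (completeSpace_congr (e := e.toEquiv) e.isometry.isUniformEmbedding).1 inferInstance
  set ψ := (InnerProductSpace.toDual ℝ _).symm (L.comp
    (e.symm.toContinuousLinearEquiv :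
      LinearMap.range (X.gradIsometry hN).toLinearMap →L[ℝ] X N)) with hψ
  refine ⟨e.symm ψ, fun v => ?_⟩
  have h1 : ⟪ψ, e v⟫_ℝ = L v := by
    rw [hψ, InnerProductSpace.toDual_symm_apply]
    simp
  have h2 : ∀ v : X N, ((e v : LinearMap.range (X.gradIsometry hN).toLinearMap) : L2KVec N)
      = v.grad := fun v => rfl
  have h3 : ⟪ψ, e v⟫_ℝ = ⟪(ψ : L2KVec N), ((e v : _) : L2KVec N)⟫_ℝ := rfl
  rw [← h1, h3, h2, ← h2 (e.symm ψ), e.apply_symm_apply]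

/-- By Riesz representation, testing with gradients already captures every functional; integrals
over sets and the Hardy and mass terms are passed to the limit in this way. -/
lemma WeakTendsto.tendsto_clm (hN : 3 ≤ N) {u : ℕ → X N} {w : X N} (h : WeakTendsto u w)
    (L : X N →L[ℝ] ℝ) : Tendsto (fun n => L (u n)) atTop (𝓝 (L w)) := by
  obtain ⟨ψ, hψ⟩ := X.exists_riesz hN L
  simp_rw [hψ, real_inner_comm _ ψ.grad]
  exact h ψ

/-- Separability serves twice: for sequential weak-* compactness, and to find a null set of times
independent of the test function. -/
lemma X.separableSpace (N : ℕ) : TopologicalSpace.SeparableSpace (X N) := by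
  have : Fact ((2 : ENNReal) ≠ ⊤) := ⟨by simp⟩
  have : SecondCountableTopology (L2K N × L2KVec N) := inferInstance
  have : SecondCountableTopology (X N) := TopologicalSpace.Subtype.secondCountableTopology _
  infer_instance

/-- Bounded sequences in `X` have weakly convergent subsequences. -/
lemma X.exists_weakTendsto_subseq (hN : 3 ≤ N) {u : ℕ → X N} {M : ℝ}
    (hu : ∀ n, ‖(u n).grad‖ ≤ M) :
    ∃ (w : X N) (k : ℕ → ℕ), StrictMono k ∧ WeakTendsto (u ∘ k) w := by
  set ℓ : ℕ → StrongDual ℝ (X N) := fun n => (innerSL ℝ (u n).grad).comp (X.gradL N) with hℓ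
  have hbd : ∀ n, StrongDual.toWeakDual (ℓ n) ∈
      (WeakDual.toStrongDual ⁻¹' Metric.closedBall (0 : StrongDual ℝ (X N)) M) := fun n => by
    have hM : 0 ≤ M := (norm_nonneg _).trans (hu n)
    have hb : ‖ℓ n‖ ≤ M := by
      refine ContinuousLinearMap.opNorm_le_bound _ hM fun v => ?_
      rw [v.norm_eq hN]
      change ‖⟪(u n).grad, v.grad⟫_ℝ‖ ≤ _
      refine (norm_inner_le_norm _ _).trans ?_
      gcongr
      exact hu n
    exact (dist_zero_right (ℓ n)).trans_le hb
  have : TopologicalSpace.SeparableSpace (X N) := X.separableSpace N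
  obtain ⟨L, -, k, hk, hlim⟩ := WeakDual.isSeqCompact_closedBall ℝ (X N) 0 M hbd
  obtain ⟨w, hw⟩ := X.exists_riesz hN (WeakDual.toStrongDual L)
  refine ⟨w, k, hk, fun φ => ?_⟩
  rw [← hw]
  exact ((WeakDual.eval_continuous φ).tendsto L).comp hlim

lemma X.lintegral_enorm_lt_top (v : X N) : ∫⁻ x, ‖v.fn x‖ₑ < ⊤ := by
  obtain ⟨C, hC⟩ := exists_lintegral_enorm_le N
  refine (hC _ v.aestronglyMeasurable_fn).trans_lt ?_
  rw [← Lp.enorm_def]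
  exact ENNReal.mul_lt_top (by simp) (by simp)

lemma X.integrable_fn (v : X N) : Integrable v.fn (volume : Measure (Space N)) :=
  ⟨(Lp.stronglyMeasurable v.fn).aestronglyMeasurable, v.lintegral_enorm_lt_top⟩

/-- `v ↦ ∫_s v dy` as a functional on `X`. -/
lemma X.exists_setIntegral_clm (hN : 3 ≤ N) (s : Set (Space N)) :
    ∃ L : X N →L[ℝ] ℝ, ∀ v : X N, L v = ∫ y in s, v.fn y := by
  obtain ⟨C, hC⟩ := exists_lintegral_enorm_le N
  refine ⟨LinearMap.mkContinuous
    { toFun := fun v => ∫ y in s, v.fn y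
      map_add' := fun v w => by
        rw [← integral_add v.integrable_fn.integrableOn w.integrable_fn.integrableOn]
        refine integral_congr_ae (ae_restrict_of_ae ?_)
        filter_upwards [ae_measureK_iff.1 (Lp.coeFn_add v.fn w.fn)] with y hy
        rw [X.fn_add, hy, Pi.add_apply]
      map_smul' := fun c v => by
        rw [RingHom.id_apply, smul_eq_mul, ← integral_const_mul]
        refine integral_congr_ae (ae_restrict_of_ae ?_)
        filter_upwards [ae_measureK_iff.1 (Lp.coeFn_smul c v.fn)] with y hy
        rw [X.fn_smul, hy, Pi.smul_apply, smul_eq_mul] } C (fun v => ?_), fun v => rfl⟩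
  change ‖∫ y in s, v.fn y‖ ≤ C * ‖v‖
  have h1 : ‖∫ y in s, v.fn y‖ₑ ≤ C * ‖v.fn‖ₑ := by
    refine (enorm_integral_le_lintegral_enorm _).trans ?_
    refine (setLIntegral_le_lintegral _ _).trans ?_
    rw [Lp.enorm_def]
    exact hC _ v.aestronglyMeasurable_fn
  have h2 : ‖∫ y in s, v.fn y‖ ≤ C * ‖v.fn‖ := by
    have := ENNReal.toReal_mono (by finiteness) h1
    simpa using this
  refine h2.trans ?_
  gcongr
  rw [v.norm_eq hN]
  exact v.norm_fn_le hN

/-- Rellich's theorem: weak convergence in `X` implies local convergence in `L¹`. -/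
lemma WeakTendsto.tendsto_lintegral_ball (hN : 3 ≤ N) {u : ℕ → X N} {w : X N} {M : ℝ}
    (h : WeakTendsto u w) (hu : ∀ n, ‖(u n).grad‖ ≤ M) (R : ℝ) :
    Tendsto (fun n => ∫⁻ x in Metric.ball (0 : Space N) R, ‖(u n - w).fn x‖ₑ) atTop (𝓝 0) := by
  obtain ⟨C, hC⟩ := X.exists_lintegral_translate_sub_le N
  obtain ⟨D, hD⟩ := exists_lintegral_enorm_le N
  have hM : ∀ n, ‖(u n - w).grad‖ₑ ≤ ENNReal.ofReal (M + ‖w.grad‖) := fun n => by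
    rw [← ofReal_norm]
    refine ENNReal.ofReal_le_ofReal ?_
    rw [X.grad_sub]
    exact (norm_sub_le _ _).trans (by gcongr; exact hu n)
  set A := ENNReal.ofReal (M + ‖w.grad‖) with hA
  have hsm : ∀ n, StronglyMeasurable (u n - w).fn := fun n => Lp.stronglyMeasurable _
  -- The value at `x` is compared with its mean over the ball of radius `ρ` around `x`. The error is
  -- of order `ρ` uniformly in `n`, by the `L¹` modulus of continuity.
  have key : ∀ ρ : ℝ, 0 < ρ → ∀ n,
      ∫⁻ x in Metric.ball (0 : Space N) R, ‖(u n - w).fn x‖ₑ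
        ≤ ENNReal.ofReal ρ * (C * A) + (volume (Metric.ball (0 : Space N) ρ))⁻¹
          * ∫⁻ x in Metric.ball (0 : Space N) R,
            ‖∫ y in Metric.ball (0 : Space N) ρ, (u n - w).fn (x + y)‖ₑ := by
    intro ρ hρ n
    set f : Space N → ℝ := ⇑((u n - w).fn) with hf
    set V := volume (Metric.ball (0 : Space N) ρ) with hV
    have hV0 : V ≠ 0 := (Metric.measure_ball_pos volume _ hρ).ne'
    have hVt : V ≠ ⊤ := measure_ball_lt_top.ne
    have hfm : Measurable f := (hsm n).measurable
    have hjoint : Measurable fun p : Space N × Space N => ‖f (p.1 + p.2) - f p.1‖ₑ :=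
      ((hfm.comp (measurable_fst.add measurable_snd)).sub (hfm.comp measurable_fst)).enorm
    have hpt : ∀ x, V * ‖f x‖ₑ ≤ (∫⁻ y in Metric.ball (0 : Space N) ρ, ‖f (x + y) - f x‖ₑ)
        + ‖∫ y in Metric.ball (0 : Space N) ρ, f (x + y)‖ₑ := by
      intro x
      have hi : IntegrableOn (fun y => f (x + y)) (Metric.ball (0 : Space N) ρ) :=
        ((u n - w).integrable_fn.comp_add_left x).integrableOn
      have hc : IntegrableOn (fun _ => f x) (Metric.ball (0 : Space N) ρ) :=
        integrableOn_const hVt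
      have e : V * ‖f x‖ₑ = ‖∫ y in Metric.ball (0 : Space N) ρ, f x‖ₑ := by
        rw [setIntegral_const, smul_eq_mul, enorm_mul, Real.enorm_of_nonneg measureReal_nonneg,
          ofReal_measureReal hVt]
      have e2 : ∫ y in Metric.ball (0 : Space N) ρ, f x
          = (∫ y in Metric.ball (0 : Space N) ρ, f (x + y))
            - ∫ y in Metric.ball (0 : Space N) ρ, (f (x + y) - f x) := by
        rw [integral_sub hi hc]; ring
      rw [e, e2, add_comm]
      refine enorm_sub_le.trans ?_
      gcongr
      exact enorm_integral_le_lintegral_enorm _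
    have hswap : ∫⁻ x in Metric.ball (0 : Space N) R,
        ∫⁻ y in Metric.ball (0 : Space N) ρ, ‖f (x + y) - f x‖ₑ
        ≤ V * (ENNReal.ofReal ρ * (C * A)) := by
      calc _ ≤ ∫⁻ x, ∫⁻ y in Metric.ball (0 : Space N) ρ, ‖f (x + y) - f x‖ₑ :=
            setLIntegral_le_lintegral _ _
        _ = ∫⁻ y in Metric.ball (0 : Space N) ρ, ∫⁻ x, ‖f (x + y) - f x‖ₑ :=
            lintegral_lintegral_swap hjoint.aemeasurable
        _ ≤ ∫⁻ _ in Metric.ball (0 : Space N) ρ, ENNReal.ofReal ρ * (C * A) := by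
            refine setLIntegral_mono measurable_const fun y hy => ?_
            refine (hC (u n - w) y).trans ?_
            gcongr
            · rw [← ofReal_norm]
              exact ENNReal.ofReal_le_ofReal (mem_ball_zero_iff.1 hy).le
            · exact hM n
        _ = _ := by rw [setLIntegral_const, mul_comm]
    have hsum : V * ∫⁻ x in Metric.ball (0 : Space N) R, ‖f x‖ₑ
        ≤ V * (ENNReal.ofReal ρ * (C * A)) + ∫⁻ x in Metric.ball (0 : Space N) R,
            ‖∫ y in Metric.ball (0 : Space N) ρ, f (x + y)‖ₑ := by
      rw [← lintegral_const_mul _ hfm.enorm]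
      refine (lintegral_mono hpt).trans ?_
      rw [lintegral_add_left hjoint.lintegral_prod_right]
      gcongr
    calc ∫⁻ x in Metric.ball (0 : Space N) R, ‖f x‖ₑ
        = V⁻¹ * (V * ∫⁻ x in Metric.ball (0 : Space N) R, ‖f x‖ₑ) := by
          rw [← mul_assoc, ENNReal.inv_mul_cancel hV0 hVt, one_mul]
      _ ≤ V⁻¹ * (V * (ENNReal.ofReal ρ * (C * A)) + ∫⁻ x in Metric.ball (0 : Space N) R,
            ‖∫ y in Metric.ball (0 : Space N) ρ, f (x + y)‖ₑ) := by gcongr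
      _ = _ := by rw [mul_add, ← mul_assoc V⁻¹, ENNReal.inv_mul_cancel hV0 hVt, one_mul]
  -- For fixed `ρ` the integral over a translated ball is a continuous functional, so it tends to
  -- zero at each `x`; the uniform `L¹` bound is a dominating constant on the ball of radius `R`.
  have hlim : ∀ ρ : ℝ, Tendsto (fun n => ∫⁻ x in Metric.ball (0 : Space N) R,
      ‖∫ y in Metric.ball (0 : Space N) ρ, (u n - w).fn (x + y)‖ₑ) atTop (𝓝 0) := by
    intro ρ
    have h0 : ∫⁻ _ in Metric.ball (0 : Space N) R, (0 : ENNReal) = 0 := by simp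
    rw [← h0]
    refine tendsto_lintegral_of_dominated_convergence (fun _ => D * A) (fun n => ?_) (fun n => ?_)
      ?_ ?_
    · have hm : Measurable fun p : Space N × Space N => (u n - w).fn (p.1 + p.2) :=
        (hsm n).measurable.comp (measurable_fst.add measurable_snd)
      exact (hm.stronglyMeasurable.integral_prod_right (ν := volume.restrict _)).measurable.enorm
    · refine Eventually.of_forall fun x => ?_
      refine (enorm_integral_le_lintegral_enorm _).trans ?_
      refine (setLIntegral_le_lintegral _ _).trans ?_
      rw [lintegral_add_left_eq_self (fun y => ‖(u n - w).fn y‖ₑ) x]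
      refine (hD _ (u n - w).aestronglyMeasurable_fn).trans ?_
      rw [← Lp.enorm_def]
      refine mul_le_mul' le_rfl (le_trans ?_ (hM n))
      rw [← ofReal_norm, ← ofReal_norm]
      exact ENNReal.ofReal_le_ofReal ((u n - w).norm_fn_le hN)
    · rw [setLIntegral_const]
      exact ENNReal.mul_ne_top (by finiteness) measure_ball_lt_top.ne
    · refine Eventually.of_forall fun x => ?_
      obtain ⟨L, hL⟩ := X.exists_setIntegral_clm hN (Metric.ball x ρ)
      have e : ∀ v : X N, ∫ y in Metric.ball (0 : Space N) ρ, v.fn (x + y) = L v := fun v => by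
        rw [hL]
        have h := (measurePreserving_add_left volume x).setIntegral_preimage_emb
          (measurableEmbedding_addLeft x) v.fn (Metric.ball x ρ)
        rw [← h]
        congr 2
        ext y; simp
      simp_rw [e, map_sub]
      have := ((h.tendsto_clm hN L).sub_const (L w)).enorm
      simpa using this
  rw [ENNReal.tendsto_nhds_zero]
  intro ε hε
  have hCA : C * A ≠ ⊤ := by finiteness
  have hρlim : Tendsto (fun ρ : ℝ => ENNReal.ofReal ρ * (C * A)) (𝓝[>] 0) (𝓝 0) := by
    have h1 : Tendsto (fun ρ : ℝ => ENNReal.ofReal ρ) (𝓝[>] 0) (𝓝 0) := by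
      have := (ENNReal.continuous_ofReal.tendsto 0).mono_left
        (nhdsWithin_le_nhds : 𝓝[>] (0 : ℝ) ≤ 𝓝 0)
      simpa using this
    have := ENNReal.Tendsto.mul_const h1 (Or.inr hCA)
    simpa using this
  have hε2 : 0 < ε / 2 := ENNReal.half_pos hε.ne'
  obtain ⟨ρ, hρ1, hρ0⟩ := ((hρlim.eventually_lt_const hε2).and self_mem_nhdsWithin).exists
  have hV0 : volume (Metric.ball (0 : Space N) ρ) ≠ 0 :=
    (Metric.measure_ball_pos volume _ hρ0).ne'
  have h2 := ENNReal.Tendsto.const_mul (a := (volume (Metric.ball (0 : Space N) ρ))⁻¹) (hlim ρ)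
    (Or.inr (ENNReal.inv_ne_top.2 hV0))
  rw [mul_zero] at h2
  filter_upwards [h2.eventually_lt_const hε2] with n hn
  refine (key ρ hρ0 n).trans ?_
  rw [← ENNReal.add_halves ε]
  exact add_le_add hρ1.le hn.le

end WeakConvergence

/-! ### Weak continuity of the energy differential and stationary limits. -/

section PalaisSmale

variable {N : ℕ}

/-- Truncation at height `L`: below it the power is at most `L^r`, above it one factor `1/L` is
gained from the critical power. -/
lemma abs_rpow_mul_abs_sub_le {r L : ℝ} (hr : 0 ≤ r) (hL : 0 < L) (a b : ℝ) :
    |a| ^ r * |a - b| ≤ L ^ r * |a - b| + 2 / L * (|a| ^ (r + 2) + |b| ^ (r + 2)) := by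
  set s := max |a| |b| with hs
  have hs0 : 0 ≤ s := le_max_of_le_left (abs_nonneg _)
  have ha : |a| ≤ s := le_max_left _ _
  have hb : |b| ≤ s := le_max_right _ _
  have hd : |a - b| ≤ 2 * s := (abs_sub _ _).trans (by linarith)
  have h1 : |a| ^ r * |a - b| ≤ s ^ r * |a - b| := by gcongr
  have hA : 0 ≤ |a| ^ (r + 2) := by positivity
  have hB : 0 ≤ |b| ^ (r + 2) := by positivity
  rcases le_total s L with h | h
  · have h2 : s ^ r * |a - b| ≤ L ^ r * |a - b| := by gcongr
    have : 0 ≤ 2 / L * (|a| ^ (r + 2) + |b| ^ (r + 2)) := by positivity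
    linarith
  · have hs0' : 0 < s := hL.trans_le h
    have hsq : s ^ (r + 2) ≤ |a| ^ (r + 2) + |b| ^ (r + 2) := by
      rcases max_choice |a| |b| with h | h <;> rw [hs, h] <;> linarith
    have h3 : s ^ r * |a - b| ≤ 2 / L * s ^ (r + 2) := by
      rw [Real.rpow_add hs0', Real.rpow_two, div_mul_eq_mul_div, le_div_iff₀ hL]
      have h4 : |a - b| * L ≤ 2 * s * s := by gcongr
      have := mul_le_mul_of_nonneg_left h4 (Real.rpow_nonneg hs0 r)
      linarith
    have h5 : 2 / L * s ^ (r + 2) ≤ 2 / L * (|a| ^ (r + 2) + |b| ^ (r + 2)) := by gcongr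
    have h6 : 0 ≤ L ^ r * |a - b| := by positivity
    linarith

/-- The weight is absorbed into the bound on the test function, so that Rellich's theorem, stated
for Lebesgue measure, applies. -/
lemma IsTestFunction.integral_abs_mul_le {ψ : X N} {φ : Space N → ℝ} (hφ : IsTestFunction ψ φ)
    {B R : ℝ} (hB : ∀ y, |weight y * φ y| ≤ B) (hR : ∀ y, φ y ≠ 0 → y ∈ Metric.ball (0 : Space N) R)
    (d : X N) : ∫ y, |d.fn y| * |ψ.fn y| ∂(measureK N)
      ≤ B * (∫⁻ x in Metric.ball (0 : Space N) R, ‖d.fn x‖ₑ).toReal := by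
  have h1 : ∫ y, |d.fn y| * |ψ.fn y| ∂(measureK N)
      = ∫ y, |d.fn y| * |φ y| ∂(measureK N) := by
    refine integral_congr_ae ?_
    filter_upwards [hφ.fn_ae] with y hy
    rw [hy]
  have h2 : (∫⁻ x in Metric.ball (0 : Space N) R, ‖d.fn x‖ₑ).toReal
      = ∫ x in Metric.ball (0 : Space N) R, |d.fn x| := by
    rw [← integral_norm_eq_lintegral_enorm d.integrable_fn.aestronglyMeasurable.restrict]
    rfl
  rw [h1, h2, integral_measureK, ← integral_const_mul, ← integral_indicator measurableSet_ball]
  refine integral_mono_of_nonneg (Eventually.of_forall fun y => ?_)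
    (IntegrableOn.integrable_indicator (d.integrable_fn.abs.const_mul B).integrableOn
      measurableSet_ball) (Eventually.of_forall fun y => ?_)
  · have := weight_pos y
    positivity
  · by_cases hy : φ y = 0
    · simp only [hy, abs_zero, mul_zero]
      refine indicator_nonneg (fun y _ => ?_) _
      have : 0 ≤ B := (abs_nonneg _).trans (hB y)
      positivity
    · rw [indicator_of_mem (hR y hy)]
      have h := mul_le_mul_of_nonneg_right (hB y) (abs_nonneg (d.fn y))
      rw [abs_mul, abs_of_pos (weight_pos y)] at h
      linarith

/-- On bounded sets of `X` the last term is small for large `L`; with `L` then fixed, the local `L¹`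
term tends to zero by Rellich. This replaces compactness at the critical exponent. -/
lemma exists_abs_nonlin_sub_testFunction_le (hN : 3 ≤ N) {ψ : X N} {φ : Space N → ℝ}
    (hφ : IsTestFunction ψ φ) : ∃ B R : ℝ, 0 ≤ B ∧ ∀ (a b : X N) (L : ℝ), 0 < L →
      |nonlin a ψ - nonlin b ψ| ≤
        B * (L ^ (critExp N - 2) * (∫⁻ x in Metric.ball (0 : Space N) R, ‖(a - b).fn x‖ₑ).toReal
          + 2 / L * (nonlin a a + nonlin b b)) := by
  have hr := critExp_sub_two_pos hN
  obtain ⟨C, hC0, hC⟩ := X.exists_trilinear hN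
  have hwφ : Continuous fun y => weight y * φ y := continuous_weight.mul hφ.contDiff.continuous
  obtain ⟨B, hB⟩ := (HasCompactSupport.mul_left (f := weight)
    hφ.hasCompactSupport).exists_bound_of_continuous hwφ
  have hB0 : 0 ≤ B := (norm_nonneg _).trans (hB 0)
  obtain ⟨R, hR⟩ := hφ.hasCompactSupport.isCompact.isBounded.subset_ball (0 : Space N)
  refine ⟨(critExp N - 1) * (2 * B), R, mul_nonneg (by linarith) (by linarith), fun a b L hL => ?_⟩
  have hφB : ∀ᵐ y ∂(measureK N), |ψ.fn y| ≤ B := by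
    filter_upwards [hφ.fn_ae] with y hy
    rw [hy]
    refine le_trans ?_ (hB y)
    rw [Pi.mul_apply, norm_mul, Real.norm_eq_abs, Real.norm_eq_abs, abs_of_pos (weight_pos y)]
    exact le_mul_of_one_le_left (abs_nonneg _) (one_le_weight y)
  have hint : ∀ d : X N, Integrable (fun y => |d.fn y| * |ψ.fn y|) (measureK N) := fun d => by
    have h := (L2.integrable_inner (𝕜 := ℝ) d.fn ψ.fn).abs
    refine h.congr (Eventually.of_forall fun y => ?_)
    simp [abs_mul, mul_comm]
  have hP : Integrable (fun y => |a.fn y| ^ critExp N + |b.fn y| ^ critExp N) (measureK N) :=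
    (integrable_abs_rpow hN a).add (integrable_abs_rpow hN b)
  have key : ∀ c : X N, (∀ᵐ y ∂(measureK N), |c.fn y| ^ (critExp N - 2) * |(a - b).fn y|
      ≤ L ^ (critExp N - 2) * |(a - b).fn y|
        + 2 / L * (|a.fn y| ^ critExp N + |b.fn y| ^ critExp N)) →
      ∫ y, |c.fn y| ^ (critExp N - 2) * |(a - b).fn y| * |ψ.fn y| ∂(measureK N)
        ≤ B * (L ^ (critExp N - 2)
          * (∫⁻ x in Metric.ball (0 : Space N) R, ‖(a - b).fn x‖ₑ).toReal
          + 2 / L * (nonlin a a + nonlin b b)) := by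
    intro c hc
    calc _ ≤ ∫ y, (L ^ (critExp N - 2) * (|(a - b).fn y| * |ψ.fn y|)
          + B * (2 / L) * (|a.fn y| ^ critExp N + |b.fn y| ^ critExp N)) ∂(measureK N) := by
          refine integral_mono_ae (hC c (a - b) ψ).1
            (((hint _).const_mul _).add (hP.const_mul _)) ?_
          filter_upwards [hc, hφB] with y h1 h2
          have h3 := mul_le_mul_of_nonneg_right h1 (abs_nonneg (ψ.fn y))
          have h4 : 2 / L * (|a.fn y| ^ critExp N + |b.fn y| ^ critExp N) * |ψ.fn y|
              ≤ 2 / L * (|a.fn y| ^ critExp N + |b.fn y| ^ critExp N) * B := by gcongr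
          linarith
      _ = L ^ (critExp N - 2) * (∫ y, |(a - b).fn y| * |ψ.fn y| ∂(measureK N))
          + B * (2 / L) * (nonlin a a + nonlin b b) := by
          rw [integral_add ((hint _).const_mul _) (hP.const_mul _), integral_const_mul,
            integral_const_mul, integral_add (integrable_abs_rpow hN a) (integrable_abs_rpow hN b),
            integral_abs_rpow_eq_nonlin hN, integral_abs_rpow_eq_nonlin hN]
      _ ≤ L ^ (critExp N - 2)
          * (B * (∫⁻ x in Metric.ball (0 : Space N) R, ‖(a - b).fn x‖ₑ).toReal)
          + B * (2 / L) * (nonlin a a + nonlin b b) := by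
          gcongr
          exact hφ.integral_abs_mul_le hB (fun y hy => hR (subset_tsupport _ hy)) (a - b)
      _ = _ := by ring
  have e : critExp N - 2 + 2 = critExp N := by ring
  have ka := key a (by
    filter_upwards [Lp.coeFn_sub a.fn b.fn] with y hy
    rw [X.fn_sub, hy, Pi.sub_apply]
    have := abs_rpow_mul_abs_sub_le hr.le hL (a.fn y) (b.fn y)
    rwa [e] at this)
  have kb := key b (by
    filter_upwards [Lp.coeFn_sub a.fn b.fn] with y hy
    rw [X.fn_sub, hy, Pi.sub_apply]
    have := abs_rpow_mul_abs_sub_le hr.le hL (b.fn y) (a.fn y)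
    rwa [e, abs_sub_comm, add_comm (|b.fn y| ^ critExp N)] at this)
  refine (abs_nonlin_sub_le hN a b ψ).trans ?_
  rw [mul_assoc]
  refine mul_le_mul_of_nonneg_left ?_ (by linarith)
  linarith

/-- The critical nonlinearity is sequentially weakly continuous on `X`. -/
lemma WeakTendsto.tendsto_nonlin (hN : 3 ≤ N) {u : ℕ → X N} {w : X N} {M : ℝ}
    (h : WeakTendsto u w) (hu : ∀ n, ‖(u n).grad‖ ≤ M) (ψ : X N) :
    Tendsto (fun n => nonlin (u n) ψ) atTop (𝓝 (nonlin w ψ)) := by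
  have hr := critExp_sub_two_pos hN
  obtain ⟨D, hD0, hD⟩ := exists_abs_nonlin_le hN
  have hM0 : 0 ≤ M := (norm_nonneg _).trans (hu 0)
  set M' := max M ‖w.grad‖ with hM'
  have hM'0 : 0 ≤ M' := le_max_of_le_left hM0
  set Q := D * (M' ^ (critExp N - 2) * M') with hQ
  have hQ0 : 0 ≤ Q := by positivity
  have hDQ : ∀ v z : X N, ‖v.grad‖ ≤ M' → |nonlin v z| ≤ Q * ‖z.grad‖ := fun v z hv => by
    refine (hD v z).trans ?_
    rw [hQ, mul_assoc D]
    gcongr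
  have huM : ∀ n, ‖(u n).grad‖ ≤ M' := fun n => (hu n).trans (le_max_left _ _)
  have hwM : ‖w.grad‖ ≤ M' := le_max_right _ _
  have htest : ∀ (ψ : X N) (φ : Space N → ℝ), IsTestFunction ψ φ →
      Tendsto (fun n => nonlin (u n) ψ) atTop (𝓝 (nonlin w ψ)) := by
    intro ψ φ hφ
    obtain ⟨B, R, hB0, hB⟩ := exists_abs_nonlin_sub_testFunction_le hN hφ
    rw [Metric.tendsto_atTop']
    intro ε hε
    have hP : ∀ v : X N, ‖v.grad‖ ≤ M' → nonlin v v ≤ Q * M' := fun v hv =>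
      (le_abs_self _).trans ((hDQ v v hv).trans (by gcongr))
    obtain ⟨L, hL⟩ : ∃ L : ℝ, 0 < L ∧ B * (2 / L * (Q * M' + Q * M')) < ε / 2 := by
      have hl : Tendsto (fun L : ℝ => B * (2 / L * (Q * M' + Q * M'))) atTop (𝓝 0) := by
        have := ((tendsto_const_nhds (x := (2 : ℝ))).div_atTop tendsto_id).mul_const
          (Q * M' + Q * M') |>.const_mul B
        simpa using this
      exact ((eventually_gt_atTop 0).and (hl.eventually_lt_const (by positivity))).exists
    have hI := (ENNReal.tendsto_toReal (by simp)).comp (h.tendsto_lintegral_ball hN hu R)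
    have hI' := (hI.const_mul (L ^ (critExp N - 2))).const_mul B
    simp only [ENNReal.toReal_zero, mul_zero] at hI'
    obtain ⟨n₀, hn₀⟩ := eventually_atTop.1 (hI'.eventually_lt_const (half_pos hε))
    refine ⟨n₀, fun n hn => ?_⟩
    have h1 := hn₀ n hn.le
    simp only [Function.comp_apply] at h1
    rw [Real.dist_eq]
    refine (hB (u n) w L hL.1).trans_lt ?_
    have h2 : B * (2 / L * (nonlin (u n) (u n) + nonlin w w))
        ≤ B * (2 / L * (Q * M' + Q * M')) := by
      have := hL.1
      gcongr
      · exact hP _ (huM n)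
      · exact hP _ hwM
    rw [mul_add]
    linarith [hL.2]
  -- The functionals `nonlin (u n)` are bounded uniformly by `Q`, so convergence on the dense set of
  -- test functions extends to `ψ`.
  obtain ⟨z, φ, hz, hzlim, -⟩ := ψ.exists_testFunction_seq
  rw [Metric.tendsto_atTop']
  intro ε hε
  have hzn : Tendsto (fun k => Q * ‖(ψ - z k).grad‖) atTop (𝓝 0) := by
    have hc : Continuous fun z : X N => Q * ‖(ψ - z).grad‖ :=
      continuous_const.mul (X.continuous_grad.comp
        (continuous_const.sub continuous_id : Continuous fun z : X N => ψ - z)).norm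
    have h := (hc.tendsto ψ).comp hzlim
    simpa [X.grad, Function.comp_def] using h
  obtain ⟨k, hk⟩ := (hzn.eventually_lt_const (show 0 < ε / 3 by positivity)).exists
  obtain ⟨n₀, hn₀⟩ := (Metric.tendsto_atTop'.1 (htest (z k) (φ k) (hz k))) (ε / 3) (by positivity)
  refine ⟨n₀, fun n hn => ?_⟩
  have h1 := hn₀ n hn
  rw [Real.dist_eq] at h1 ⊢
  have h2 := (hDQ (u n) (ψ - z k) (huM n)).trans_lt hk
  have h3 := (hDQ w (ψ - z k) hwM).trans_lt hk
  rw [nonlin_sub_right hN] at h2 h3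
  rw [abs_lt] at *
  constructor <;> linarith

lemma WeakTendsto.tendsto_denergy (hN : 3 ≤ N) (μ : ℝ) {u : ℕ → X N} {w : X N} {M : ℝ}
    (h : WeakTendsto u w) (hu : ∀ n, ‖(u n).grad‖ ≤ M) (ψ : X N) :
    Tendsto (fun n => denergy μ (u n) ψ) atTop (𝓝 (denergy μ w ψ)) := by
  simp_rw [denergy_eq hN, form]
  have h1 := h.tendsto_clm hN ((innerSL ℝ (X.hardyL hN ψ)).comp (X.hardyL hN))
  have h2 := h.tendsto_clm hN ((innerSL ℝ ψ.fn).comp (X.fnL N))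
  simp only [ContinuousLinearMap.comp_apply, innerSL_apply_apply] at h1 h2
  simp_rw [real_inner_comm _ (X.hardyL hN ψ)] at h1
  simp_rw [real_inner_comm _ ψ.fn] at h2
  exact (((h ψ).sub (h1.const_mul _)).sub (h2.const_mul _)).sub (h.tendsto_nonlin hN hu ψ)

lemma exists_abs_energy_le (hN : 3 ≤ N) (μ M : ℝ) :
    ∃ D : ℝ, ∀ v : X N, ‖v.grad‖ ≤ M → |energy μ v| ≤ D := by
  obtain ⟨C, hC0, hC⟩ := exists_abs_nonlin_le hN
  have hr := critExp_sub_two_pos hN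
  refine ⟨1 / 2 * (M ^ 2 + |μ| * (4 / ((N : ℝ) - 2) ^ 2 * M ^ 2) + |beta N| * M ^ 2)
    + 1 / critExp N * (C * (M ^ (critExp N - 2) * M * M)), fun v hv => ?_⟩
  have hq : 0 < critExp N := by linarith
  have hM : 0 ≤ M := (norm_nonneg _).trans hv
  have h1 : ‖v.grad‖ ^ 2 ≤ M ^ 2 := by gcongr
  have h2 : ‖X.hardyL hN v‖ ^ 2 ≤ 4 / ((N : ℝ) - 2) ^ 2 * M ^ 2 :=
    (v.norm_hardyL_sq_le hN).trans (by gcongr)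
  have h3 : ‖v.fn‖ ^ 2 ≤ M ^ 2 := by
    have := v.norm_fn_le hN
    gcongr
    exact this.trans hv
  have h4 : |nonlin v v| ≤ C * (M ^ (critExp N - 2) * M * M) := (hC v v).trans (by gcongr)
  rw [energy_eq hN, form, real_inner_self_eq_norm_sq, real_inner_self_eq_norm_sq,
    real_inner_self_eq_norm_sq]
  refine (abs_sub _ _).trans (add_le_add ?_ ?_)
  · rw [abs_mul, abs_of_pos (by norm_num : (0 : ℝ) < 1 / 2)]
    gcongr
    refine (abs_sub _ _).trans (add_le_add ((abs_sub _ _).trans (add_le_add ?_ ?_)) ?_)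
    · rwa [abs_of_nonneg (by positivity)]
    · rw [abs_mul, abs_of_nonneg (sq_nonneg ‖X.hardyL hN v‖)]; gcongr
    · rw [abs_mul, abs_of_nonneg (sq_nonneg ‖v.fn‖)]; gcongr
  · rw [abs_mul, abs_of_pos (by positivity : (0 : ℝ) < 1 / critExp N)]
    gcongr

/-- A bounded sequence of times along which `v_s → 0` produces a stationary solution. -/
lemma exists_stationary_of_seq (hN : 3 ≤ N) (μ : ℝ) {v : ℝ → X N} {s : ℕ → ℝ} {g : ℕ → L2K N}
    {M : ℝ} (hs0 : ∀ n, 0 < s n) (hs : Tendsto s atTop atTop)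
    (hd : ∀ n, HasDerivAt (fun t => (v t).fn) (g n) (s n))
    (hg : Tendsto (fun n => ‖g n‖) atTop (𝓝 0)) (hM : ∀ n, ‖(v (s n)).grad‖ ≤ M)
    (heq : ∀ n, ∀ w : X N, ⟪g n, w.fn⟫_ℝ + ⟪(v (s n)).grad, w.grad⟫_ℝ = reaction μ (v (s n)) w) :
    ∃ w ∈ omegaLimitSet v, IsStationarySolution μ w ∧
      ∃ (s : ℕ → ℝ) (g : ℕ → L2K N), (∀ n, 0 < s n) ∧ Tendsto s atTop atTop ∧
        (∀ n, HasDerivAt (fun t => (v t).fn) (g n) (s n)) ∧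
        Tendsto (fun n => ‖g n‖) atTop (𝓝 0) ∧
        IsPalaisSmale μ (fun n => v (s n)) ∧
        WeakTendsto (fun n => v (s n)) w := by
  obtain ⟨w, k, hk, hw⟩ := X.exists_weakTendsto_subseq hN hM
  obtain ⟨D, hD⟩ := exists_abs_energy_le hN μ M
  obtain ⟨c, -, j, hj, hc⟩ := tendsto_subseq_of_bounded
    (s := Metric.closedBall (0 : ℝ) D) Metric.isBounded_closedBall
    (x := fun n => energy μ (v (s (k n)))) (fun n => by
      rw [mem_closedBall_zero_iff, Real.norm_eq_abs]
      exact hD _ (hM _))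
  have hkj : Tendsto (fun n => k (j n)) atTop atTop := hk.tendsto_atTop.comp hj.tendsto_atTop
  -- The differential at `v(s_n)` is minus the `L²_K` pairing with `g n`, and `‖φ‖ ≤ ‖∇φ‖` turns it
  -- into a bound in the dual of `X`.
  have hden : ∀ n, ∀ φ : X N, |denergy μ (v (s n)) φ| ≤ ‖g n‖ * ‖φ.grad‖ := fun n φ => by
    have e : denergy μ (v (s n)) φ = - ⟪g n, φ.fn⟫_ℝ := by
      rw [denergy, ← heq n φ]; ring
    rw [e, abs_neg]
    refine (abs_real_inner_le_norm _ _).trans ?_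
    gcongr
    exact φ.norm_fn_le hN
  have hw' : WeakTendsto (fun n => v (s (k (j n)))) w := fun φ => (hw φ).comp hj.tendsto_atTop
  have hg' : Tendsto (fun n => ‖g (k (j n))‖) atTop (𝓝 0) := hg.comp hkj
  refine ⟨w, ⟨_, hs.comp hkj, hw'⟩, fun φ => ?_, fun n => s (k (j n)), fun n => g (k (j n)),
    fun n => hs0 _, hs.comp hkj, fun n => hd _, hg', ⟨⟨c, hc⟩, _, hg', fun n φ => hden _ φ⟩, hw'⟩
  have h1 := hw'.tendsto_denergy hN μ (fun n => hM _) φ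
  have h2 : Tendsto (fun n => denergy μ (v (s (k (j n)))) φ) atTop (𝓝 0) := by
    refine squeeze_zero_norm (fun n => hden _ φ) ?_
    simpa using hg'.mul_const ‖φ.grad‖
  have := tendsto_nhds_unique h1 h2
  rw [denergy] at this
  linarith

end PalaisSmale

/-! ### Calculus for Hilbert-valued primitives. -/

section HilbertValued

variable {H : Type*} [NormedAddCommGroup H] [InnerProductSpace ℝ H]

/-- `u` is a primitive of the locally square integrable function `g`. -/
structure IsPrimitive (u g : ℝ → H) : Prop where
  memLp : ∀ a b, MemLp g 2 (volume.restrict (Ioc a b))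
  sub_eq : ∀ s t, u t - u s = ∫ τ in s..t, g τ

namespace IsPrimitive

variable {u g : ℝ → H}

lemma intervalIntegrable (h : IsPrimitive u g) (a b : ℝ) : IntervalIntegrable g volume a b :=
  ⟨(h.memLp a b).integrable (by norm_num), (h.memLp b a).integrable (by norm_num)⟩

lemma locallyIntegrable (h : IsPrimitive u g) : LocallyIntegrable g volume := by
  refine (locallyIntegrable_iff).2 fun k hk => ?_
  obtain ⟨r, hr⟩ := hk.isBounded.subset_closedBall 0
  refine IntegrableOn.mono_set ?_ (hr.trans ?_) (t := Icc (-r) r)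
  · rw [integrableOn_Icc_iff_integrableOn_Ioc]
    exact (h.memLp _ _).integrable (by norm_num)
  · rw [Real.closedBall_eq_Icc]; simp

lemma intervalIntegrable_norm_sq (h : IsPrimitive u g) (a b : ℝ) :
    IntervalIntegrable (fun τ => ‖g τ‖ ^ 2) volume a b :=
  ⟨(memLp_two_iff_integrable_sq_norm (h.memLp a b).1).1 (h.memLp a b),
    (memLp_two_iff_integrable_sq_norm (h.memLp b a).1).1 (h.memLp b a)⟩

lemma ae_hasDerivAt [CompleteSpace H] (h : IsPrimitive u g) : ∀ᵐ t, HasDerivAt u (g t) t := by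
  filter_upwards [LocallyIntegrable.ae_hasDerivAt_integral h.locallyIntegrable] with t ht
  have e : u = fun t => u 0 + ∫ τ in (0 : ℝ)..t, g τ := by
    funext t; rw [← h.sub_eq]; abel
  rw [e]
  exact (ht 0).const_add _

lemma continuous (h : IsPrimitive u g) : Continuous u := by
  have e : u = fun t => u 0 + ∫ τ in (0 : ℝ)..t, g τ := by
    funext t; rw [← h.sub_eq]; abel
  rw [e]
  exact continuous_const.add
    (intervalIntegral.continuous_primitive (fun a b => h.intervalIntegrable a b) 0)

lemma intervalIntegrable_inner (h : IsPrimitive u g) {w : ℝ → H} (hw : Continuous w) (a b : ℝ) :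
    IntervalIntegrable (fun τ => ⟪g τ, w τ⟫_ℝ) volume a b := by
  have hm : AEStronglyMeasurable g volume := h.locallyIntegrable.aestronglyMeasurable
  obtain ⟨C, hC⟩ := (isCompact_uIcc (a := a) (b := b)).exists_bound_of_continuousOn hw.continuousOn
  refine ((h.intervalIntegrable a b).norm.mul_const C).mono_fun
    (hm.inner hw.aestronglyMeasurable).restrict ?_
  refine (ae_restrict_iff' measurableSet_uIoc).2 (Eventually.of_forall fun τ hτ => ?_)
  refine (norm_inner_le_norm _ _).trans ?_
  change _ ≤ ‖‖g τ‖ * C‖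
  rw [norm_mul, norm_norm]
  gcongr
  exact (hC τ (uIoc_subset_uIcc hτ)).trans (le_abs_self C)

/-- The chain rule for `‖u‖²`. -/
lemma norm_sq_sub [CompleteSpace H] (h : IsPrimitive u g) (a b : ℝ) :
    ‖u b‖ ^ 2 - ‖u a‖ ^ 2 = ∫ τ in a..b, 2 * ⟪g τ, u τ⟫_ℝ := by
  obtain ⟨C, hC⟩ := (isCompact_uIcc (a := a) (b := b)).exists_bound_of_continuousOn
    h.continuous.continuousOn
  have hint : ∀ x y, IntervalIntegrable (fun τ => ‖g τ‖) volume x y := fun x y =>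
    (h.intervalIntegrable x y).norm
  have hΦ := ((hint a b).absolutelyContinuousOnInterval_intervalIntegral
    (c := a) left_mem_uIcc).const_mul (2 * C)
  -- Increments of `‖u‖²` are dominated by those of the primitive of `2C‖g‖`, where `C` bounds `u`;
  -- an absolutely continuous function is the integral of its almost everywhere derivative.
  have hac : AbsolutelyContinuousOnInterval (fun t => ‖u t‖ ^ 2) a b := by
    rw [absolutelyContinuousOnInterval_iff] at hΦ ⊢
    intro ε hε
    obtain ⟨δ, hδ, hE⟩ := hΦ ε hε
    refine ⟨δ, hδ, fun E hE1 hE2 => lt_of_le_of_lt (Finset.sum_le_sum fun i hi => ?_)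
      (hE E hE1 hE2)⟩
    obtain ⟨hx, hy⟩ := hE1.1 i hi
    set x := (E.2 i).1
    set y := (E.2 i).2
    rw [Real.dist_eq, Real.dist_eq, ← mul_sub, intervalIntegral.integral_interval_sub_left
      (hint _ _) (hint _ _)]
    have h1 : |‖u x‖ ^ 2 - ‖u y‖ ^ 2| = (‖u x‖ + ‖u y‖) * |‖u x‖ - ‖u y‖| := by
      rw [sq_sub_sq, abs_mul, abs_of_nonneg (by positivity : 0 ≤ ‖u x‖ + ‖u y‖)]
    have h2 : |‖u x‖ - ‖u y‖| ≤ |∫ τ in y..x, ‖g τ‖| := by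
      refine (abs_norm_sub_norm_le _ _).trans ?_
      rw [h.sub_eq]
      exact intervalIntegral.norm_integral_le_abs_integral_norm
    have hC0 : 0 ≤ C := (norm_nonneg _).trans (hC x hx)
    rw [h1, abs_mul, abs_of_nonneg (by positivity : 0 ≤ 2 * C)]
    refine mul_le_mul ?_ h2 (abs_nonneg _) (by positivity)
    linarith [hC x hx, hC y hy]
  rw [← hac.integral_deriv_eq_sub]
  refine intervalIntegral.integral_congr_ae ?_
  filter_upwards [h.ae_hasDerivAt] with t ht _
  rw [ht.norm_sq.deriv, real_inner_comm]

/-- The Cauchy–Schwarz bound for increments. -/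
lemma norm_sub_sq_le (h : IsPrimitive u g) {s t : ℝ} (hst : s ≤ t) :
    ‖u t - u s‖ ^ 2 ≤ (t - s) * ∫ τ in s..t, ‖g τ‖ ^ 2 := by
  rcases hst.eq_or_lt with rfl | hlt
  · simp
  have h1 : ‖u t - u s‖ ≤ ∫ τ in s..t, ‖g τ‖ := by
    rw [h.sub_eq]; exact intervalIntegral.norm_integral_le_integral_norm hst
  set A := ∫ τ in s..t, ‖g τ‖ with hA
  set m := A / (t - s) with hm
  have hp : 0 < t - s := sub_pos.2 hlt
  -- The variance of `‖g‖` about its mean `m` is nonnegative, which is the Cauchy–Schwarz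
  -- inequality.
  have h2 : 0 ≤ ∫ τ in s..t, (‖g τ‖ - m) ^ 2 :=
    intervalIntegral.integral_nonneg hst fun _ _ => sq_nonneg _
  have e : ∀ τ, (‖g τ‖ - m) ^ 2 = ‖g τ‖ ^ 2 - 2 * m * ‖g τ‖ + m ^ 2 := fun τ => by ring
  simp_rw [e] at h2
  rw [intervalIntegral.integral_add ((h.intervalIntegrable_norm_sq s t).sub
      ((h.intervalIntegrable s t).norm.const_mul _)) intervalIntegrable_const,
    intervalIntegral.integral_sub (h.intervalIntegrable_norm_sq s t)
      ((h.intervalIntegrable s t).norm.const_mul _),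
    intervalIntegral.integral_const_mul, intervalIntegral.integral_const, smul_eq_mul, ← hA] at h2
  have hmA : m * (t - s) = A := by rw [hm]; field_simp
  have h3 : A ^ 2 ≤ (t - s) * ∫ τ in s..t, ‖g τ‖ ^ 2 := by
    have h4 := mul_nonneg hp.le h2
    have e2 : (t - s) * ((∫ τ in s..t, ‖g τ‖ ^ 2) - 2 * m * A + (t - s) * m ^ 2)
        = (t - s) * (∫ τ in s..t, ‖g τ‖ ^ 2) - 2 * (m * (t - s)) * A + (m * (t - s)) ^ 2 := by ring
    rw [e2, hmA] at h4
    linarith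
  exact (pow_le_pow_left₀ (norm_nonneg _) h1 2).trans h3

/-- Increments over a fixed time step are again a primitive. -/
lemma increment (h : IsPrimitive u g) (δ : ℝ) :
    IsPrimitive (fun τ => u (τ + δ) - u τ) (fun τ => g (τ + δ) - g τ) where
  memLp a b := by
    refine MemLp.sub ?_ (h.memLp a b)
    have hmp : MeasurePreserving (fun τ => τ + δ) (volume.restrict (Ioc a b))
        (volume.restrict (Ioc (a + δ) (b + δ))) := by
      have := (measurePreserving_add_right volume δ).restrict_preimage
        (measurableSet_Ioc (a := a + δ) (b := b + δ))
      simpa using this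
    exact (h.memLp (a + δ) (b + δ)).comp_measurePreserving hmp
  sub_eq s t := by
    have hi : IntervalIntegrable (fun τ => g (τ + δ)) volume s t := by
      have := (h.intervalIntegrable (s + δ) (t + δ)).comp_add_right δ
      simpa using this
    rw [intervalIntegral.integral_sub hi (h.intervalIntegrable s t),
      intervalIntegral.integral_comp_add_right, ← h.sub_eq, ← h.sub_eq]
    abel

end IsPrimitive

end HilbertValued

/-! ### The energy inequality for strongly continuous flows. -/

section Dissipation

variable {N : ℕ}

/-- Strongly continuous flows satisfying the equation at almost every positive time. -/
structure IsFlow (μ : ℝ) (V : ℝ → X N) (g : ℝ → L2K N) : Prop where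
  continuous : Continuous V
  isPrimitive : IsPrimitive (fun t => (V t).fn) g
  eq : ∀ᵐ τ, 0 < τ → ∀ w : X N,
    ⟪g τ, w.fn⟫_ℝ + ⟪(V τ).grad, w.grad⟫_ℝ = reaction μ (V τ) w

/-- A change of variables turns the integral into difference quotients of the primitive of `f` at
the two endpoints, so no differentiability of `f` is needed. -/
lemma tendsto_integral_difference_quotient {f : ℝ → ℝ} (hf : Continuous f) (s t : ℝ) :
    Tendsto (fun h => h⁻¹ * ∫ τ in s..t, (f (τ + h) - f τ)) (𝓝[>] 0) (𝓝 (f t - f s)) := by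
  have hi : ∀ a b, IntervalIntegrable f volume a b := fun a b => hf.intervalIntegrable a b
  have hP : ∀ x, HasDerivAt (fun x => ∫ τ in (0 : ℝ)..x, f τ) (f x) x := fun x =>
    intervalIntegral.integral_hasDerivAt_right (hi _ _) (hf.stronglyMeasurableAtFilter _ _)
      hf.continuousAt
  have h1 := (hP t).tendsto_slope_zero_right.sub (hP s).tendsto_slope_zero_right
  refine h1.congr fun h => ?_
  have hi' : IntervalIntegrable (fun τ => f (τ + h)) volume s t :=
    (hf.comp (continuous_add_const h)).intervalIntegrable _ _
  rw [intervalIntegral.integral_sub hi' (hi _ _), intervalIntegral.integral_comp_add_right,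
    ← intervalIntegral.integral_interval_sub_left (hi 0 (t + h)) (hi 0 (s + h)),
    ← intervalIntegral.integral_interval_sub_left (hi 0 t) (hi 0 s)]
  simp only [smul_eq_mul]
  ring

/-- Monotonicity of the energy differential modulo lower order terms, on compact subsets. -/
lemma exists_form_sub_le (hN : 3 ≤ N) {μ : ℝ} (hμ₁ : μ ≤ ((N : ℝ) - 2) ^ 2 / 8) {S : Set (X N)}
    (hS : IsCompact S) : ∃ M : ℝ, 0 ≤ M ∧ ∀ a ∈ S, ∀ b ∈ S,
      form hN μ (b - a) (b - a)
        ≤ 2 * (denergy μ b (b - a) - denergy μ a (b - a)) + M * ‖(b - a).fn‖ ^ 2 := by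
  have hr := critExp_sub_two_pos hN
  have hq : 0 < critExp N - 1 := by linarith
  have hN0 : (0 : ℝ) < N := by positivity
  -- With this `ε` the critical terms cost `2(2* - 1)ε = 1/(2N)` of the squared gradient norm, half
  -- of what coercivity provides.
  obtain ⟨M, hM0, hM⟩ := exists_compact_trilinear_le hN hS
    (ε := 1 / (4 * N * (critExp N - 1))) (by positivity)
  refine ⟨4 * (critExp N - 1) * M, by positivity, fun a ha b hb => ?_⟩
  have hsub : nonlin b (b - a) - nonlin a (b - a) ≤ (critExp N - 1) *
      (2 * (1 / (4 * N * (critExp N - 1)) * ‖(b - a).grad‖ ^ 2 + M * ‖(b - a).fn‖ ^ 2)) := by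
    refine (le_abs_self _).trans ((abs_nonlin_sub_le hN _ _ _).trans ?_)
    refine mul_le_mul_of_nonneg_left ?_ hq.le
    have k1 := hM b hb (b - a)
    have k2 := hM a ha (b - a)
    linarith
  have hform := form_sub_left hN μ b a (b - a)
  have hco := form_coercive hN hμ₁ (b - a)
  have hfac : (critExp N - 1) * (2 * (1 / (4 * N * (critExp N - 1)) * ‖(b - a).grad‖ ^ 2
      + M * ‖(b - a).fn‖ ^ 2)) = 1 / 2 * (1 / N * ‖(b - a).grad‖ ^ 2)
      + 2 * (critExp N - 1) * M * ‖(b - a).fn‖ ^ 2 := by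
    field_simp
    ring
  rw [hfac] at hsub
  rw [denergy_eq hN, denergy_eq hN]
  linarith

namespace IsFlow

variable {μ : ℝ} {V : ℝ → X N} {g : ℝ → L2K N}

lemma ae_denergy (h : IsFlow μ V g) :
    ∀ᵐ τ, 0 < τ → ∀ w : X N, denergy μ (V τ) w = - ⟪g τ, w.fn⟫_ℝ := by
  filter_upwards [h.eq] with τ hτ h0 w
  rw [denergy, ← hτ h0 w]; ring

lemma continuous_increment (h : IsFlow μ V g) (δ : ℝ) : Continuous fun τ => V (τ + δ) - V τ :=
  (h.continuous.comp (continuous_add_const δ)).sub h.continuous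

lemma continuous_form_increment (hN : 3 ≤ N) (h : IsFlow μ V g) (δ : ℝ) :
    Continuous fun τ => form hN μ (V (τ + δ) - V τ) (V (τ + δ) - V τ) :=
  Continuous.comp (g := fun p : X N × X N => form hN μ p.1 p.2)
    (f := fun τ => (V (τ + δ) - V τ, V (τ + δ) - V τ)) (continuous_form hN μ)
    ((h.continuous_increment δ).prodMk (h.continuous_increment δ))

/-- Comparison of the equation at two times. -/
lemma exists_integral_form_increment_le (hN : 3 ≤ N) (hμ₁ : μ ≤ ((N : ℝ) - 2) ^ 2 / 8)
    (h : IsFlow μ V g) {s t : ℝ} (hs : 0 ≤ s) (hst : s ≤ t) : ∃ M : ℝ, 0 ≤ M ∧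
    ∀ δ ∈ Ioc (0 : ℝ) 1, ∫ τ in s..t, form hN μ (V (τ + δ) - V τ) (V (τ + δ) - V τ)
      ≤ ‖(V (s + δ) - V s).fn‖ ^ 2 + M * ∫ τ in s..t, ‖(V (τ + δ) - V τ).fn‖ ^ 2 := by
  -- The interval reaches `t + 1` so as to contain the shifted times `τ + δ` for `δ ≤ 1`.
  have hS : IsCompact (V '' Icc s (t + 1)) := isCompact_Icc.image h.continuous
  obtain ⟨M, hM0, hM⟩ := exists_form_sub_le hN hμ₁ hS
  refine ⟨M, hM0, fun δ hδ => ?_⟩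
  set D : ℝ → X N := fun τ => V (τ + δ) - V τ with hD
  have hDc : Continuous D := h.continuous_increment δ
  have hprim := h.isPrimitive.increment δ
  have hDfn : (fun τ => (V (τ + δ)).fn - (V τ).fn) = fun τ => (D τ).fn := rfl
  rw [hDfn] at hprim
  -- The equations at `τ + δ` and `τ` are subtracted and tested with the increment `D τ`. The
  -- pairing is half the derivative of `‖D‖²`, so integration leaves boundary terms, of which the
  -- one at `t` has the good sign.
  have hpt : ∀ᵐ τ, τ ∈ Ioc s t → form hN μ (D τ) (D τ)
      ≤ - (2 * ⟪g (τ + δ) - g τ, (D τ).fn⟫_ℝ) + M * ‖(D τ).fn‖ ^ 2 := by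
    have h2 : ∀ᵐ τ, 0 < τ + δ → ∀ w : X N, denergy μ (V (τ + δ)) w = - ⟪g (τ + δ), w.fn⟫_ℝ :=
      (measurePreserving_add_right volume δ).quasiMeasurePreserving.ae h.ae_denergy
    filter_upwards [h.ae_denergy, h2] with τ h1 h2 hτ
    have hτ0 : 0 < τ := hs.trans_lt hτ.1
    have e1 := h1 hτ0 (D τ)
    have e2 := h2 (by linarith [hδ.1]) (D τ)
    have k := hM (V τ) ⟨_, ⟨hτ.1.le, by linarith [hτ.2]⟩, rfl⟩ (V (τ + δ))
      ⟨_, ⟨by linarith [hτ.1, hδ.1], by linarith [hτ.2, hδ.2]⟩, rfl⟩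
    change form hN μ (D τ) (D τ) ≤ 2 * (denergy μ (V (τ + δ)) (D τ) - denergy μ (V τ) (D τ))
      + M * ‖(D τ).fn‖ ^ 2 at k
    rw [e1, e2] at k
    rw [inner_sub_left]
    linarith
  have hi1 : IntervalIntegrable (fun τ => 2 * ⟪g (τ + δ) - g τ, (D τ).fn⟫_ℝ) volume s t :=
    (hprim.intervalIntegrable_inner hprim.continuous s t).const_mul 2
  have hi2 : IntervalIntegrable (fun τ => M * ‖(D τ).fn‖ ^ 2) volume s t :=
    (continuous_const.mul (hprim.continuous.norm.pow 2)).intervalIntegrable s t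
  have hi3 : IntervalIntegrable (fun τ => form hN μ (D τ) (D τ)) volume s t :=
    (h.continuous_form_increment hN δ).intervalIntegrable s t
  have hi1' : IntervalIntegrable (fun τ => -(2 * ⟪g (τ + δ) - g τ, (D τ).fn⟫_ℝ)) volume s t :=
    hi1.neg
  have hmono := intervalIntegral.integral_mono_ae_restrict hst hi3 (hi1'.add hi2) (by
    rw [← restrict_Ioc_eq_restrict_Icc]
    exact (ae_restrict_iff' measurableSet_Ioc).2 hpt)
  rw [intervalIntegral.integral_add hi1' hi2, intervalIntegral.integral_neg,
    ← hprim.norm_sq_sub, intervalIntegral.integral_const_mul] at hmono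
  have := sq_nonneg ‖(D t).fn‖
  linarith

/-- The energy inequality. -/
theorem energy_add_integral_le (hN : 3 ≤ N) (hμ₁ : μ ≤ ((N : ℝ) - 2) ^ 2 / 8)
    (h : IsFlow μ V g) {s t : ℝ} (hs : 0 ≤ s) (hst : s ≤ t) :
    energy μ (V t) + ∫ τ in s..t, ‖g τ‖ ^ 2 ≤ energy μ (V s) := by
  obtain ⟨M, hM0, hM⟩ := h.exists_integral_form_increment_le hN hμ₁ hs hst
  set γ : ℝ → ℝ := fun τ => ‖g τ‖ ^ 2 with hγ
  have hγi : ∀ a b, IntervalIntegrable γ volume a b := h.isPrimitive.intervalIntegrable_norm_sq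
  set Γ : ℝ → ℝ := fun x => ∫ τ in (0 : ℝ)..x, γ τ with hΓ
  have hΓc : Continuous Γ := intervalIntegral.continuous_primitive hγi 0
  have hΓsub : ∀ a b, ∫ τ in a..b, γ τ = Γ b - Γ a := fun a b =>
    (intervalIntegral.integral_interval_sub_left (hγi 0 b) (hγi 0 a)).symm
  have hec : Continuous fun τ => energy μ (V τ) := (continuous_energy hN μ).comp h.continuous
  have hinc : ∀ τ : ℝ, ∀ δ : ℝ, 0 < δ → ‖(V (τ + δ) - V τ).fn‖ ^ 2 ≤ δ * (Γ (τ + δ) - Γ τ) := by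
    intro τ δ hδ
    have := h.isPrimitive.norm_sub_sq_le (s := τ) (t := τ + δ) (by linarith)
    rw [hΓsub, add_sub_cancel_left] at this
    exact this
  have hDc : ∀ δ : ℝ, Continuous fun τ => (V (τ + δ) - V τ).fn := fun δ =>
    X.continuous_fn.comp (h.continuous_increment δ)
  -- the integrated difference quotient of the energy
  set R : ℝ → ℝ := fun δ => (Γ (s + δ) - Γ s) + M * ∫ τ in s..t, (Γ (τ + δ) - Γ τ) with hR
  -- The Taylor estimate at `V τ` is integrated in `τ`. Its quadratic remainder is at most `δ R(δ) /
  -- 2` with `R(δ) → 0`, hence vanishes after division by `δ`.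
  have hstep : ∀ δ ∈ Ioc (0 : ℝ) 1, δ⁻¹ * ∫ τ in s..t, ⟪g τ, (V (τ + δ) - V τ).fn⟫_ℝ
      ≤ - (δ⁻¹ * ∫ τ in s..t, (energy μ (V (τ + δ)) - energy μ (V τ))) + 1 / 2 * R δ := by
    intro δ hδ
    have hi1 : IntervalIntegrable (fun τ => ⟪g τ, (V (τ + δ) - V τ).fn⟫_ℝ) volume s t :=
      h.isPrimitive.intervalIntegrable_inner (hDc δ) s t
    have hi2 : IntervalIntegrable (fun τ => 1 / 2 * form hN μ (V (τ + δ) - V τ) (V (τ + δ) - V τ))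
        volume s t :=
      (continuous_const.mul (h.continuous_form_increment hN δ)).intervalIntegrable s t
    have hi3 : IntervalIntegrable (fun τ => energy μ (V (τ + δ)) - energy μ (V τ)) volume s t :=
      ((hec.comp (continuous_add_const δ)).sub hec).intervalIntegrable s t
    have hi1' : IntervalIntegrable (fun τ => -⟪g τ, (V (τ + δ) - V τ).fn⟫_ℝ) volume s t :=
      hi1.neg
    have hmono := intervalIntegral.integral_mono_ae_restrict hst hi3 (hi1'.add hi2) (by
      rw [← restrict_Ioc_eq_restrict_Icc]
      refine (ae_restrict_iff' measurableSet_Ioc).2 ?_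
      filter_upwards [h.ae_denergy] with τ hτ hτs
      have := energy_sub_le hN μ (V τ) (V (τ + δ))
      rw [hτ (hs.trans_lt hτs.1)] at this
      exact this)
    rw [intervalIntegral.integral_add hi1' hi2, intervalIntegral.integral_neg,
      intervalIntegral.integral_const_mul] at hmono
    have h1 := hM δ hδ
    have h2 : ∫ τ in s..t, ‖(V (τ + δ) - V τ).fn‖ ^ 2 ≤ δ * ∫ τ in s..t, (Γ (τ + δ) - Γ τ) := by
      rw [← intervalIntegral.integral_const_mul]
      exact intervalIntegral.integral_mono_on hst
        (((hDc δ).norm.pow 2).intervalIntegrable s t)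
        ((continuous_const.mul ((hΓc.comp (continuous_add_const δ)).sub hΓc)).intervalIntegrable
          s t) fun τ _ => hinc τ δ hδ.1
    have h3 := hinc s δ hδ.1
    have h4 := mul_le_mul_of_nonneg_left h2 hM0
    have h5 : ∫ τ in s..t, form hN μ (V (τ + δ) - V τ) (V (τ + δ) - V τ) ≤ δ * R δ := by
      rw [hR]; linarith
    have h6 : ∫ τ in s..t, ⟪g τ, (V (τ + δ) - V τ).fn⟫_ℝ
        ≤ - (∫ τ in s..t, (energy μ (V (τ + δ)) - energy μ (V τ))) + δ * (1 / 2 * R δ) := by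
      linarith
    have h7 := mul_le_mul_of_nonneg_left h6 (inv_nonneg.2 hδ.1.le)
    refine h7.trans (le_of_eq ?_)
    have := hδ.1.ne'
    field_simp
  have hRlim : Tendsto R (𝓝[>] 0) (𝓝 0) := by
    have h1 : Tendsto (fun δ => Γ (s + δ) - Γ s) (𝓝[>] 0) (𝓝 0) := by
      have hc : Continuous fun δ => Γ (s + δ) - Γ s := by fun_prop
      have := (hc.tendsto 0).mono_left (nhdsWithin_le_nhds (s := Ioi 0))
      simpa using this
    have h2 : Tendsto (fun δ => ∫ τ in s..t, (Γ (τ + δ) - Γ τ)) (𝓝[>] 0) (𝓝 0) := by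
      have hid : Tendsto (fun δ : ℝ => δ) (𝓝[>] 0) (𝓝 0) := tendsto_id.mono_left nhdsWithin_le_nhds
      have := hid.mul (tendsto_integral_difference_quotient hΓc s t)
      rw [zero_mul] at this
      refine this.congr' ?_
      filter_upwards [self_mem_nhdsWithin] with δ hδ
      rw [← mul_assoc, mul_inv_cancel₀ (ne_of_gt hδ), one_mul]
    have := h1.add (h2.const_mul M)
    simpa using this
  -- Fatou along `δ = 1 / (n + 1)`
  set d : ℕ → ℝ := fun n => 1 / ((n : ℝ) + 1) with hd
  have hd0 : ∀ n, 0 < d n := fun n => by simp only [hd]; positivity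
  have hd1 : ∀ n, d n ∈ Ioc (0 : ℝ) 1 := fun n => ⟨hd0 n, by
    simp only [hd]; rw [div_le_one (by positivity)]; linarith [(Nat.cast_nonneg n : (0 : ℝ) ≤ n)]⟩
  have hdlim : Tendsto d atTop (𝓝[>] 0) :=
    tendsto_nhdsWithin_iff.2 ⟨tendsto_one_div_add_atTop_nhds_zero_nat, Eventually.of_forall hd0⟩
  -- The two halves make the integrand nonnegative, as Fatou requires: the quotient of `Γ` dominates
  -- the squared norm of the difference quotient of `V`, so `F n` is at least half of a squared
  -- norm.
  set F : ℕ → ℝ → ℝ := fun n τ => 1 / 2 * γ τ + 1 / 2 * ((d n)⁻¹ * (Γ (τ + d n) - Γ τ))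
    + (d n)⁻¹ * ⟪g τ, (V (τ + d n) - V τ).fn⟫_ℝ with hF
  have hF0 : ∀ n τ, 0 ≤ F n τ := by
    intro n τ
    have h1 := hinc τ (d n) (hd0 n)
    have hdn := hd0 n
    set x := g τ
    set y := (V (τ + d n) - V τ).fn
    have h2 : 0 ≤ ‖x + (d n)⁻¹ • y‖ ^ 2 := sq_nonneg _
    rw [norm_add_sq_real, inner_smul_right, norm_smul, mul_pow, Real.norm_eq_abs, sq_abs] at h2
    have h3 : (d n)⁻¹ ^ 2 * ‖y‖ ^ 2 ≤ (d n)⁻¹ * (Γ (τ + d n) - Γ τ) := by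
      have := mul_le_mul_of_nonneg_left h1 (sq_nonneg (d n)⁻¹)
      refine this.trans (le_of_eq ?_)
      field_simp
    simp only [hF, hγ]
    linarith
  have hiF1 : ∀ n, IntervalIntegrable (fun τ => (d n)⁻¹ * (Γ (τ + d n) - Γ τ)) volume s t :=
    fun n => (continuous_const.mul ((hΓc.comp (continuous_add_const _)).sub hΓc)).intervalIntegrable
      s t
  have hiF2 : ∀ n, IntervalIntegrable (fun τ => (d n)⁻¹ * ⟪g τ, (V (τ + d n) - V τ).fn⟫_ℝ)
      volume s t := fun n => (h.isPrimitive.intervalIntegrable_inner (hDc _) s t).const_mul _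
  have hiF12 : ∀ n, IntervalIntegrable (fun τ => 1 / 2 * γ τ
      + 1 / 2 * ((d n)⁻¹ * (Γ (τ + d n) - Γ τ))) volume s t := fun n =>
    ((hγi s t).const_mul _).add ((hiF1 n).const_mul _)
  have hiF : ∀ n, IntervalIntegrable (F n) volume s t := fun n => (hiF12 n).add (hiF2 n)
  set G := ∫ τ in s..t, γ τ with hG
  set U : ℕ → ℝ := fun n => 1 / 2 * G
    + 1 / 2 * ((d n)⁻¹ * ∫ τ in s..t, (Γ (τ + d n) - Γ τ))
    + (- ((d n)⁻¹ * ∫ τ in s..t, (energy μ (V (τ + d n)) - energy μ (V τ))) + 1 / 2 * R (d n))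
    with hU
  have hFU : ∀ n, ∫ τ in s..t, F n τ ≤ U n := by
    intro n
    have e : ∫ τ in s..t, F n τ = 1 / 2 * G
        + 1 / 2 * ((d n)⁻¹ * ∫ τ in s..t, (Γ (τ + d n) - Γ τ))
        + (d n)⁻¹ * ∫ τ in s..t, ⟪g τ, (V (τ + d n) - V τ).fn⟫_ℝ := by
      rw [hF, intervalIntegral.integral_add (hiF12 n) (hiF2 n),
        intervalIntegral.integral_add ((hγi s t).const_mul _) ((hiF1 n).const_mul _)]
      simp only [intervalIntegral.integral_const_mul]
      rw [hG]
    rw [e, hU]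
    exact add_le_add le_rfl (hstep _ (hd1 n))
  have hUlim : Tendsto U atTop (𝓝 (G - (energy μ (V t) - energy μ (V s)))) := by
    have h1 := (tendsto_integral_difference_quotient hΓc s t).comp hdlim
    have h2 := (tendsto_integral_difference_quotient hec s t).comp hdlim
    have h3 := hRlim.comp hdlim
    have h4 := ((h1.const_mul (1 / 2)).const_add (1 / 2 * G)).add (h2.neg.add (h3.const_mul (1 / 2)))
    have e : 1 / 2 * G + 1 / 2 * (Γ t - Γ s)
        + (-(energy μ (V t) - energy μ (V s)) + 1 / 2 * 0)
        = G - (energy μ (V t) - energy μ (V s)) := by rw [← hΓsub]; ring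
    rw [e] at h4
    exact h4
  have hU0 : ∀ n, 0 ≤ U n := fun n =>
    (intervalIntegral.integral_nonneg hst fun τ _ => hF0 n τ).trans (hFU n)
  have hlim0 : 0 ≤ G - (energy μ (V t) - energy μ (V s)) := ge_of_tendsto' hUlim hU0
  have hae : ∀ᵐ τ ∂(volume.restrict (Ioc s t)),
      Tendsto (fun n => ENNReal.ofReal (F n τ)) atTop (𝓝 (ENNReal.ofReal (2 * γ τ))) := by
    refine ae_restrict_of_ae ?_
    have hΓd : ∀ᵐ τ, HasDerivAt Γ (γ τ) τ := by
      have hloc : LocallyIntegrable γ volume := by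
        have := h.isPrimitive.locallyIntegrable
        refine locallyIntegrable_iff.2 fun k hk => ?_
        obtain ⟨r, hr⟩ := hk.isBounded.subset_closedBall 0
        refine IntegrableOn.mono_set ?_ (hr.trans (by rw [Real.closedBall_eq_Icc]; simp))
          (t := Icc (-r) r)
        rw [integrableOn_Icc_iff_integrableOn_Ioc]
        exact (hγi (-r) r).1
      filter_upwards [LocallyIntegrable.ae_hasDerivAt_integral hloc] with τ hτ using hτ 0
    filter_upwards [hΓd, h.isPrimitive.ae_hasDerivAt] with τ h1 h2
    refine ENNReal.tendsto_ofReal ?_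
    have k1 := h1.tendsto_slope_zero_right.comp hdlim
    have k2 := h2.tendsto_slope_zero_right.comp hdlim
    have k3 := (tendsto_const_nhds (x := g τ)).inner k2 (𝕜 := ℝ)
    have k4 := ((k1.const_mul (1 / 2)).const_add (1 / 2 * γ τ)).add k3
    rw [real_inner_self_eq_norm_sq] at k4
    have e : 1 / 2 * γ τ + 1 / 2 * γ τ + ‖g τ‖ ^ 2 = 2 * γ τ := by simp only [hγ]; ring
    rw [e] at k4
    refine k4.congr fun n => ?_
    simp only [hF, Function.comp_apply, smul_eq_mul, inner_smul_right, X.fn_sub]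
  -- The integrands tend to `2γ` almost everywhere while their integrals are bounded by `U n`, whose
  -- limit contains only one `G`; the excess `G` is the dissipation.
  have hfatou : ENNReal.ofReal (2 * G)
      ≤ ENNReal.ofReal (G - (energy μ (V t) - energy μ (V s))) := by
    calc ENNReal.ofReal (2 * G) = ∫⁻ τ in Ioc s t, ENNReal.ofReal (2 * γ τ) := by
          rw [hG, ← intervalIntegral.integral_const_mul, intervalIntegral.integral_of_le hst]
          exact ofReal_integral_eq_lintegral_ofReal ((hγi s t).const_mul 2).1
            (Eventually.of_forall fun τ => by simp only [hγ]; positivity)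
      _ = ∫⁻ τ in Ioc s t, liminf (fun n => ENNReal.ofReal (F n τ)) atTop :=
          lintegral_congr_ae (hae.mono fun τ hτ => hτ.liminf_eq.symm)
      _ ≤ liminf (fun n => ∫⁻ τ in Ioc s t, ENNReal.ofReal (F n τ)) atTop :=
          lintegral_liminf_le' fun n => (hiF n).1.aestronglyMeasurable.aemeasurable.ennreal_ofReal
      _ ≤ liminf (fun n => ENNReal.ofReal (U n)) atTop := by
          refine liminf_le_liminf (Eventually.of_forall fun n => ?_)
          rw [← ofReal_integral_eq_lintegral_ofReal (hiF n).1 (Eventually.of_forall (hF0 n)),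
            ← intervalIntegral.integral_of_le hst]
          exact ENNReal.ofReal_le_ofReal (hFU n)
      _ = _ := (ENNReal.tendsto_ofReal hUlim).liminf_eq
  have := (ENNReal.ofReal_le_ofReal_iff hlim0).1 hfatou
  linarith

end IsFlow

end Dissipation

/-! ### Nonnegative energy and bounds for global flows. -/

section GlobalBounds

/-- The concavity argument: `I^{-α}` would be positive, with derivative bounded away from zero. -/
lemma false_of_concavity {I F k : ℝ → ℝ} {t₁ α : ℝ} (hα : 0 < α)
    (hI : ∀ t, HasDerivAt I (F t) t) (hF : ∀ t, HasDerivAt F (k t) t)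
    (hIpos : ∀ t, t₁ ≤ t → 0 < I t) (hF1 : 0 < F t₁)
    (h : ∀ t, t₁ ≤ t → (1 + α) * F t ^ 2 ≤ k t * I t) : False := by
  -- The derivative equals `(k I - (1+α) F²) I^{-(2+α)}`, which is nonnegative by hypothesis; up to
  -- the factor `-α` the function is the derivative of `I^{-α}`.
  have hχ : ∀ t, t₁ ≤ t → HasDerivAt (fun t => F t * I t ^ (-(1 + α)))
      (k t * I t ^ (-(1 + α)) + F t * (F t * -(1 + α) * I t ^ (-(1 + α) - 1))) t := fun t ht =>
    (hF t).mul ((hI t).rpow_const (Or.inl (hIpos t ht).ne'))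
  have hχmono : MonotoneOn (fun t => F t * I t ^ (-(1 + α))) (Ici t₁) := by
    refine monotoneOn_of_deriv_nonneg (convex_Ici _)
      (fun t ht => (hχ t ht).continuousAt.continuousWithinAt)
      (fun t ht => (hχ t (interior_subset ht)).differentiableAt.differentiableWithinAt)
      fun t ht => ?_
    have ht' : t₁ ≤ t := interior_subset ht
    rw [(hχ t ht').deriv]
    have hp := hIpos t ht'
    have e : I t ^ (-(1 + α)) = I t * I t ^ (-(1 + α) - 1) := by
      rw [Real.rpow_sub_one hp.ne']; field_simp
    rw [e]
    have := mul_nonneg (sub_nonneg.2 (h t ht')) (Real.rpow_nonneg hp.le (-(1 + α) - 1))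
    linarith
  set c := F t₁ * I t₁ ^ (-(1 + α)) with hc
  have hc0 : 0 < c := mul_pos hF1 (Real.rpow_pos_of_pos (hIpos t₁ le_rfl) _)
  have hψ : ∀ t, t₁ ≤ t → HasDerivAt (fun t => -(I t ^ (-α)) - α * c * t)
      (-(F t * -α * I t ^ (-α - 1)) - α * c * 1) t := fun t ht =>
    ((hI t).rpow_const (Or.inl (hIpos t ht).ne')).neg.sub ((hasDerivAt_id t).const_mul _)
  have hψmono : MonotoneOn (fun t => -(I t ^ (-α)) - α * c * t) (Ici t₁) := by
    refine monotoneOn_of_deriv_nonneg (convex_Ici _)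
      (fun t ht => (hψ t ht).continuousAt.continuousWithinAt)
      (fun t ht => (hψ t (interior_subset ht)).differentiableAt.differentiableWithinAt)
      fun t ht => ?_
    have ht' : t₁ ≤ t := interior_subset ht
    rw [(hψ t ht').deriv]
    have hle : c ≤ F t * I t ^ (-(1 + α)) := hχmono (mem_Ici.2 le_rfl) ht' ht'
    have e : -α - 1 = -(1 + α) := by ring
    rw [e]
    have := mul_le_mul_of_nonneg_left hle hα.le
    linarith
  -- By this time the linear decay would force `I^{-α} ≤ -1`.
  set T := t₁ + (I t₁ ^ (-α) + 1) / (α * c) with hT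
  have hI1 : 0 < I t₁ ^ (-α) := Real.rpow_pos_of_pos (hIpos t₁ le_rfl) _
  have hαc : 0 < α * c := by positivity
  have hT1 : t₁ ≤ T := by
    rw [hT]; have : 0 ≤ (I t₁ ^ (-α) + 1) / (α * c) := by positivity
    linarith
  have hmono : -(I t₁ ^ (-α)) - α * c * t₁ ≤ -(I T ^ (-α)) - α * c * T :=
    hψmono (mem_Ici.2 le_rfl) (mem_Ici.2 hT1) hT1
  have hIT : 0 < I T ^ (-α) := Real.rpow_pos_of_pos (hIpos T hT1) _
  have e : α * c * T = α * c * t₁ + (I t₁ ^ (-α) + 1) := by rw [hT]; field_simp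
  linarith

namespace IsPrimitive

variable {H : Type*} [NormedAddCommGroup H] [InnerProductSpace ℝ H] {u g : ℝ → H}

/-- The Cauchy–Schwarz inequality in time. -/
lemma sq_integral_inner_le (h : IsPrimitive u g) {s t : ℝ} (hst : s ≤ t) :
    (∫ τ in s..t, ⟪g τ, u τ⟫_ℝ) ^ 2
      ≤ (∫ τ in s..t, ‖g τ‖ ^ 2) * ∫ τ in s..t, ‖u τ‖ ^ 2 := by
  have hg := h.intervalIntegrable_norm_sq s t
  have hu : IntervalIntegrable (fun τ => ‖u τ‖ ^ 2) volume s t :=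
    (h.continuous.norm.pow 2).intervalIntegrable s t
  have hgu := h.intervalIntegrable_inner h.continuous s t
  -- The quadratic polynomial is the integral of `‖g + x u‖²`; its discriminant is therefore
  -- nonpositive.
  have hq : ∀ x : ℝ, 0 ≤ (∫ τ in s..t, ‖u τ‖ ^ 2) * (x * x)
      + (2 * ∫ τ in s..t, ⟪g τ, u τ⟫_ℝ) * x + ∫ τ in s..t, ‖g τ‖ ^ 2 := by
    intro x
    have h0 : 0 ≤ ∫ τ in s..t, (‖u τ‖ ^ 2 * (x * x) + ⟪g τ, u τ⟫_ℝ * (2 * x) + ‖g τ‖ ^ 2) := by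
      refine intervalIntegral.integral_nonneg hst fun τ _ => ?_
      have h1 : 0 ≤ ‖g τ + x • u τ‖ ^ 2 := sq_nonneg _
      rw [norm_add_sq_real, inner_smul_right, norm_smul, mul_pow, Real.norm_eq_abs, sq_abs] at h1
      linarith
    rw [intervalIntegral.integral_add ((hu.mul_const _).add (hgu.mul_const _)) hg,
      intervalIntegral.integral_add (hu.mul_const _) (hgu.mul_const _),
      intervalIntegral.integral_mul_const, intervalIntegral.integral_mul_const] at h0
    linarith
  have := discrim_le_zero hq
  rw [discrim] at this
  linarith

end IsPrimitive

variable {N : ℕ}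

namespace IsFlow

variable {μ : ℝ} {V : ℝ → X N} {g : ℝ → L2K N}

lemma continuous_denergy_self (hN : 3 ≤ N) (h : IsFlow μ V g) :
    Continuous fun τ => denergy μ (V τ) (V τ) := by
  simp_rw [denergy_eq hN]
  have hd : Continuous fun τ => (V τ, V τ) := h.continuous.prodMk h.continuous
  exact (Continuous.comp (g := fun p : X N × X N => form hN μ p.1 p.2) (continuous_form hN μ) hd).sub
    (Continuous.comp (g := fun p : X N × X N => nonlin p.1 p.2) (continuous_nonlin hN) hd)

lemma norm_sq_sub_eq (h : IsFlow μ V g) {s t : ℝ} (hs : 0 ≤ s) (hst : s ≤ t) :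
    ‖(V t).fn‖ ^ 2 - ‖(V s).fn‖ ^ 2 = ∫ τ in s..t, -(2 * denergy μ (V τ) (V τ)) := by
  rw [h.isPrimitive.norm_sq_sub]
  refine intervalIntegral.integral_congr_ae ?_
  filter_upwards [h.ae_denergy] with τ hτ hτs
  rw [uIoc_of_le hst] at hτs
  rw [hτ (hs.trans_lt hτs.1)]
  ring

/-- The energy of a global flow is nonnegative. -/
theorem energy_nonneg (hN : 3 ≤ N) (hμ₁ : μ ≤ ((N : ℝ) - 2) ^ 2 / 8)
    (h : IsFlow μ V g) {s₀ : ℝ} (hs₀ : 0 ≤ s₀) : 0 ≤ energy μ (V s₀) := by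
  by_contra hneg
  push Not at hneg
  set q := critExp N with hqdef
  have hr : 0 < q - 2 := critExp_sub_two_pos hN
  have hq : 0 < q := by linarith
  set k : ℝ → ℝ := fun τ => -(2 * denergy μ (V τ) (V τ)) with hk
  have hkc : Continuous k := ((h.continuous_denergy_self hN).const_mul 2).neg
  -- Testing the equation with `V` shows that this is `‖V‖²` after `s₀`. Written as an integral, it
  -- is differentiable at every real time.
  set F : ℝ → ℝ := fun t => ‖(V s₀).fn‖ ^ 2 + ∫ τ in s₀..t, k τ with hF
  have hFd : ∀ t, HasDerivAt F (k t) t := fun t =>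
    (intervalIntegral.integral_hasDerivAt_right (hkc.intervalIntegrable _ _)
      (hkc.stronglyMeasurableAtFilter _ _) hkc.continuousAt).const_add _
  have hFc : Continuous F := continuous_iff_continuousAt.2 fun t => (hFd t).continuousAt
  have hFeq : ∀ t, s₀ ≤ t → F t = ‖(V t).fn‖ ^ 2 := fun t ht => by
    simp only [hF, hk]; rw [← h.norm_sq_sub_eq hs₀ ht]; ring
  set I : ℝ → ℝ := fun t => ∫ τ in s₀..t, F τ with hI
  have hId : ∀ t, HasDerivAt I (F t) t := fun t =>
    intervalIntegral.integral_hasDerivAt_right (hFc.intervalIntegrable _ _)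
      (hFc.stronglyMeasurableAtFilter _ _) hFc.continuousAt
  have hIeq : ∀ t, s₀ ≤ t → I t = ∫ τ in s₀..t, ‖(V τ).fn‖ ^ 2 := fun t ht =>
    intervalIntegral.integral_congr fun τ hτ => by
      rw [uIcc_of_le ht] at hτ; exact hFeq τ hτ.1
  set A : ℝ → ℝ := fun t => ∫ τ in s₀..t, ‖g τ‖ ^ 2 with hA
  have hA0 : ∀ t, s₀ ≤ t → 0 ≤ A t := fun t ht =>
    intervalIntegral.integral_nonneg ht fun τ _ => sq_nonneg _
  have hI0 : ∀ t, s₀ ≤ t → 0 ≤ I t := fun t ht => by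
    rw [hIeq t ht]; exact intervalIntegral.integral_nonneg ht fun τ _ => sq_nonneg _
  -- Eliminating the power term gives `k = (q-2) form - 2q E`; the form is nonnegative and `-E` is
  -- bounded below by the dissipation inequality.
  have hkA : ∀ t, s₀ ≤ t → 2 * q * (A t - energy μ (V s₀)) ≤ k t := fun t ht => by
    have h1 := h.energy_add_integral_le hN hμ₁ hs₀ ht
    have h2 := form_self_nonneg hN hμ₁ (V t)
    have h3 : k t = (q - 2) * form hN μ (V t) (V t) - 2 * q * energy μ (V t) := by
      simp only [hk]
      rw [denergy_eq hN, energy_eq hN, ← hqdef]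
      field_simp
      ring
    rw [h3]
    have h4 := mul_nonneg hr.le h2
    have h5 : 2 * q * (A t - energy μ (V s₀)) ≤ 2 * q * (- energy μ (V t)) := by
      refine mul_le_mul_of_nonneg_left ?_ (by linarith)
      simp only [hA]; linarith
    linarith
  set c := 2 * q * (-energy μ (V s₀)) with hc
  have hc0 : 0 < c := by
    have : 0 < -energy μ (V s₀) := by linarith
    positivity
  have hkc0 : ∀ t, s₀ ≤ t → c ≤ k t := fun t ht => by
    refine le_trans ?_ (hkA t ht)
    have := mul_nonneg (by linarith : 0 ≤ 2 * q) (hA0 t ht)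
    rw [hc]; linarith
  have hFlow : ∀ t, s₀ ≤ t → F s₀ + c * (t - s₀) ≤ F t := fun t ht => by
    have h1 : ∫ _ in s₀..t, c ≤ ∫ τ in s₀..t, k τ :=
      intervalIntegral.integral_mono_on ht intervalIntegrable_const (hkc.intervalIntegrable _ _)
        fun τ hτ => hkc0 τ hτ.1
    rw [intervalIntegral.integral_const, smul_eq_mul] at h1
    simp only [hF, intervalIntegral.integral_same]
    linarith
  have hF00 : 0 ≤ F s₀ := by rw [hFeq s₀ le_rfl]; positivity
  have hCS : ∀ t, s₀ ≤ t → (F t - F s₀) ^ 2 ≤ 4 * (A t * I t) := fun t ht => by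
    have h1 := h.isPrimitive.sq_integral_inner_le ht
    have h2 := h.isPrimitive.norm_sq_sub s₀ t
    rw [intervalIntegral.integral_const_mul] at h2
    rw [hFeq t ht, hFeq s₀ le_rfl, h2, hIeq t ht, mul_pow]
    simp only [hA]
    linarith
  have hkI : ∀ t, s₀ ≤ t → q / 2 * (F t - F s₀) ^ 2 ≤ k t * I t := fun t ht => by
    have h1 := mul_le_mul_of_nonneg_right (hkA t ht) (hI0 t ht)
    have h2 := mul_le_mul_of_nonneg_left (hCS t ht) (by linarith : 0 ≤ q / 2)
    have h3 := mul_nonneg hc0.le (hI0 t ht)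
    rw [hc] at h3
    linarith
  -- Cauchy–Schwarz yields the factor `q/2 = 1 + 2α` for `(F - F s₀)²`. Once `F s₀ ≤ θ F`, replacing
  -- this square by `F²` costs the factor `1 - 2θ`, chosen to leave exactly `1 + α`.
  set α := (q - 2) / 4 with hα
  have hα0 : 0 < α := by positivity
  have hqα : q / 2 = 1 + 2 * α := by rw [hα]; ring
  set θ := α / (2 * (1 + 2 * α)) with hθ
  have hθ0 : 0 < θ := by positivity
  -- Linear growth of `F` makes `F s₀ ≤ θ F` from this time on; the summand `1` keeps `t₁ > s₀` when
  -- `F s₀ = 0`.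
  set t₁ := s₀ + 1 + F s₀ / (θ * c) with ht₁
  have hdiv : 0 ≤ F s₀ / (θ * c) := by positivity
  have hFθ : ∀ t, t₁ ≤ t → F s₀ ≤ θ * F t := fun t ht => by
    have h1 := hFlow t (by linarith)
    have h2 : F s₀ ≤ θ * (c * (t - s₀)) := by
      have : F s₀ / (θ * c) ≤ t - s₀ := by linarith
      rw [div_le_iff₀ (by positivity)] at this
      linarith
    refine h2.trans (mul_le_mul_of_nonneg_left ?_ hθ0.le)
    linarith
  have hFpos : ∀ t, s₀ < t → 0 < F t := fun t ht => by
    have h1 := hFlow t ht.le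
    have := mul_pos hc0 (sub_pos.2 ht)
    linarith
  refine false_of_concavity (t₁ := t₁) hα0 hId hFd (fun t ht => ?_) (hFpos _ (by linarith))
    fun t ht => ?_
  · exact intervalIntegral.intervalIntegral_pos_of_pos_on (hFc.intervalIntegrable _ _)
      (fun τ hτ => hFpos τ hτ.1) (by linarith)
  · refine le_trans ?_ (hkI t (by linarith))
    have h1 := hFθ t ht
    have hFt := hFpos t (by linarith)
    rw [hqα]
    have h2 : (1 - 2 * θ) * F t ^ 2 ≤ (F t - F s₀) ^ 2 := by nlinarith
    have h3 : (1 + 2 * α) * (1 - 2 * θ) = 1 + α := by rw [hθ]; field_simp; ring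
    calc (1 + α) * F t ^ 2 = (1 + 2 * α) * ((1 - 2 * θ) * F t ^ 2) := by rw [← h3]; ring
      _ ≤ _ := mul_le_mul_of_nonneg_left h2 (by positivity)

/-- The time derivative of a global flow is square integrable. -/
theorem memLp_Ioi (hN : 3 ≤ N) (hμ₁ : μ ≤ ((N : ℝ) - 2) ^ 2 / 8) (h : IsFlow μ V g) :
    MemLp g 2 (volume.restrict (Ioi 0)) := by
  rw [memLp_two_iff_integrable_sq_norm h.isPrimitive.locallyIntegrable.aestronglyMeasurable.restrict]
  refine integrableOn_Ioi_of_intervalIntegral_norm_bounded (energy μ (V 0)) 0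
    (fun n : ℕ => (h.isPrimitive.intervalIntegrable_norm_sq 0 n).1) tendsto_natCast_atTop_atTop
    (Eventually.of_forall fun n => ?_)
  have h1 := h.energy_add_integral_le hN hμ₁ le_rfl (Nat.cast_nonneg n)
  have h2 := h.energy_nonneg hN hμ₁ (Nat.cast_nonneg n)
  simp only [norm_pow, norm_norm]
  linarith

/-- Bounds in `X` at the times where the time derivative is small. -/
theorem exists_norm_grad_le (hN : 3 ≤ N) (hμ₁ : μ ≤ ((N : ℝ) - 2) ^ 2 / 8) (h : IsFlow μ V g) :
    ∃ M : ℝ, ∀ᵐ τ, 0 < τ → ‖g τ‖ ≤ 1 → ‖(V τ).grad‖ ≤ M := by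
  set E₀ := energy μ (V 0) with hE₀
  have hE0 : 0 ≤ E₀ := h.energy_nonneg hN hμ₁ le_rfl
  have hN0 : (3 : ℝ) ≤ N := by exact_mod_cast hN
  -- Any larger `x` violates the inequality `x² ≤ N²(E₀ + x)` established below.
  refine ⟨(N : ℝ) ^ 2 + (N : ℝ) ^ 2 * E₀ + 1, ?_⟩
  filter_upwards [h.ae_denergy] with τ hτ hτ0 hg
  set x := ‖(V τ).grad‖ with hx
  have hx0 : 0 ≤ x := norm_nonneg _
  have h1 : energy μ (V τ) ≤ E₀ := by
    have h1 := h.energy_add_integral_le hN hμ₁ le_rfl hτ0.le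
    have h2 : 0 ≤ ∫ σ in (0 : ℝ)..τ, ‖g σ‖ ^ 2 :=
      intervalIntegral.integral_nonneg hτ0.le fun _ _ => sq_nonneg _
    linarith
  have h2 := form_coercive hN hμ₁ (V τ)
  have h3 : -denergy μ (V τ) (V τ) ≤ x := by
    rw [hτ hτ0, neg_neg]
    calc ⟪g τ, (V τ).fn⟫_ℝ ≤ ‖g τ‖ * ‖(V τ).fn‖ := real_inner_le_norm _ _
      _ ≤ 1 * x := mul_le_mul hg ((V τ).norm_fn_le hN) (norm_nonneg _) zero_le_one
      _ = x := one_mul x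
  have hq : critExp N = 2 * N / ((N : ℝ) - 2) := rfl
  have hN2 : 0 < (N : ℝ) - 2 := by linarith
  -- The power term cancels between the energy and its differential, and `1/2 - 1/2* = 1/N`.
  have h4 : 1 / (N : ℝ) * form hN μ (V τ) (V τ)
      = energy μ (V τ) + 1 / critExp N * -denergy μ (V τ) (V τ) := by
    rw [denergy_eq hN, energy_eq hN, hq]
    field_simp
    ring
  have h5 : 1 / critExp N * -denergy μ (V τ) (V τ) ≤ x := by
    have hq2 := two_lt_critExp hN
    have h6 : 0 ≤ 1 / critExp N := by positivity
    have h7 : 1 / critExp N ≤ 1 := by rw [div_le_one (by linarith)]; linarith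
    calc _ ≤ 1 / critExp N * x := mul_le_mul_of_nonneg_left h3 h6
      _ ≤ 1 * x := mul_le_mul_of_nonneg_right h7 hx0
      _ = x := one_mul x
  have h6 : x ^ 2 ≤ (N : ℝ) ^ 2 * (E₀ + x) := by
    have h7 : 1 / (N : ℝ) * (1 / (N : ℝ) * x ^ 2) ≤ E₀ + x := by
      have := mul_le_mul_of_nonneg_left h2 (by positivity : 0 ≤ 1 / (N : ℝ))
      linarith
    have h8 := mul_le_mul_of_nonneg_left h7 (sq_nonneg (N : ℝ))
    have e : (N : ℝ) ^ 2 * (1 / (N : ℝ) * (1 / (N : ℝ) * x ^ 2)) = x ^ 2 := by field_simp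
    rwa [e] at h8
  by_contra hlt
  push Not at hlt
  have hNE : 0 ≤ (N : ℝ) ^ 2 * E₀ := by positivity
  have hx1 : 1 ≤ x := by nlinarith [sq_nonneg (N : ℝ)]
  have h9 : (N : ℝ) ^ 2 * E₀ * 1 ≤ (N : ℝ) ^ 2 * E₀ * x := mul_le_mul_of_nonneg_left hx1 hNE
  have h10 : ((N : ℝ) ^ 2 + (N : ℝ) ^ 2 * E₀ + 1) * x < x * x :=
    mul_lt_mul_of_pos_right hlt (by linarith)
  linarith

end IsFlow

end GlobalBounds

/-! ### From weak solutions to pointwise equations and good times. -/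

section GlobalSolutions

variable {N : ℕ} {H : Type*} [NormedAddCommGroup H]

/-- Square integrable functions on a half-line are small along a sequence of times tending to
infinity, which can be chosen in a prescribed set of full measure. -/
lemma exists_seq_norm_lt_of_memLp_Ioi {f : ℝ → H} (hf : MemLp f 2 (volume.restrict (Ioi 0)))
    {p : ℝ → Prop} (hp : ∀ᵐ s, 0 < s → p s) :
    ∃ s : ℕ → ℝ, ∀ n : ℕ, (n : ℝ) < s n ∧ p (s n) ∧ ‖f (s n)‖ < 1 / ((n : ℝ) + 1) := by
  refine Classical.axiom_of_choice (r := fun (n : ℕ) (x : ℝ) => (n : ℝ) < x ∧ p x ∧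
    ‖f x‖ < 1 / ((n : ℝ) + 1)) fun n => ?_
  -- Otherwise `‖f‖²` would exceed a positive constant almost everywhere on a half-line of infinite
  -- measure.
  by_contra! hcon
  have hn : (0 : ℝ) ≤ n := n.cast_nonneg
  have hi : Integrable (fun x => ‖f x‖ ^ 2) (volume.restrict (Ioi (n : ℝ))) :=
    ((memLp_two_iff_integrable_sq_norm hf.1).1 hf).mono_measure
      (Measure.restrict_mono (Ioi_subset_Ioi hn) le_rfl)
  have hc : Integrable (fun _ : ℝ => (1 / ((n : ℝ) + 1)) ^ 2)
      (volume.restrict (Ioi (n : ℝ))) := by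
    refine hi.mono' aestronglyMeasurable_const ?_
    refine (ae_restrict_iff' measurableSet_Ioi).2 ?_
    filter_upwards [hp] with x hx hxn
    rw [Real.norm_of_nonneg (by positivity)]
    gcongr
    exact hcon x hxn (hx (hn.trans_lt hxn))
  rw [integrable_const_iff_isFiniteMeasure (by positivity)] at hc
  have := measure_lt_top (volume.restrict (Ioi (n : ℝ))) univ
  simp at this

lemma ae_hasDerivAt_of_eq_integral [NormedSpace ℝ H] [CompleteSpace H] {u g : ℝ → H} {u₀ : H}
    {T : ℝ} (hg : IntervalIntegrable g volume 0 T)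
    (hu : ∀ s ∈ Ioo 0 T, u s = u₀ + ∫ τ in (0 : ℝ)..s, g τ) :
    ∀ᵐ s, s ∈ Ioo 0 T → HasDerivAt u (g s) s := by
  filter_upwards [hg.ae_hasDerivAt_integral] with s hs hsT
  have hT : 0 ≤ T := (hsT.1.trans hsT.2).le
  rw [uIcc_of_le hT] at hs
  refine ((hs (Ioo_subset_Icc_self hsT) 0 (left_mem_Icc.2 hT)).const_add u₀).congr_of_eventuallyEq ?_
  filter_upwards [Ioo_mem_nhds hsT.1 hsT.2] with t ht using hu t ht

lemma exists_abs_reaction_le (hN : 3 ≤ N) (μ M : ℝ) (w : X N) :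
    ∃ D : ℝ, ∀ v : X N, ‖v.grad‖ ≤ M → |reaction μ v w| ≤ D := by
  obtain ⟨C, hC0, hC⟩ := exists_abs_nonlin_le hN
  have hr := critExp_sub_two_pos hN
  refine ⟨C * (M ^ (critExp N - 2) * M * ‖w.grad‖)
    + |μ| * (‖X.hardyL hN‖ * M * ‖X.hardyL hN w‖) + |beta N| * (M * ‖w.fn‖), fun v hv => ?_⟩
  have hM : 0 ≤ M := (norm_nonneg _).trans hv
  rw [reaction_eq hN]
  refine (abs_add_le _ _).trans (add_le_add ((abs_add_le _ _).trans (add_le_add ?_ ?_)) ?_)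
  · refine (hC v w).trans ?_
    gcongr
  · rw [abs_mul]
    gcongr
    refine (abs_real_inner_le_norm _ _).trans ?_
    gcongr
    refine ((X.hardyL hN).le_opNorm v).trans ?_
    rw [v.norm_eq hN]
    gcongr
  · rw [abs_mul]
    gcongr
    refine (abs_real_inner_le_norm _ _).trans ?_
    gcongr
    exact (v.norm_fn_le hN).trans hv

lemma continuous_reaction_left (hN : 3 ≤ N) (μ : ℝ) (w : X N) :
    Continuous fun v : X N => reaction μ v w :=
  Continuous.comp (g := fun p : X N × X N => reaction μ p.1 p.2) (f := fun v => (v, w))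
    (continuous_reaction hN μ) (Continuous.prodMk_left w)

lemma continuous_reaction_right (hN : 3 ≤ N) (μ : ℝ) (v : X N) :
    Continuous fun w : X N => reaction μ v w :=
  Continuous.comp (g := fun p : X N × X N => reaction μ p.1 p.2) (f := fun w => (v, w))
    (continuous_reaction hN μ) (Continuous.prodMk_right v)

lemma continuous_inner_fn_add_inner_grad (g : L2K N) (v : X N) :
    Continuous fun w : X N => ⟪g, w.fn⟫_ℝ + ⟪v.grad, w.grad⟫_ℝ :=
  (Continuous.inner continuous_const X.continuous_fn).add
    (Continuous.inner continuous_const X.continuous_grad)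

lemma aestronglyMeasurable_of_grad (hN : 3 ≤ N) {v : ℝ → X N} {ν : Measure ℝ}
    (hm : AEStronglyMeasurable (fun s => (v s).grad) ν) : AEStronglyMeasurable v ν :=
  ((X.gradIsometry hN).isometry.isEmbedding.aestronglyMeasurable_comp_iff).1 hm

/-- The integrated weak equation holds pointwise at almost every time, simultaneously for all test
functions. -/
lemma ae_weak_equation (hN : 3 ≤ N) {μ T M : ℝ} {v : ℝ → X N} {g : ℝ → L2K N}
    (hg : IntervalIntegrable g volume 0 T)
    (hm : AEStronglyMeasurable (fun s => (v s).grad) (volume.restrict (Ioc 0 T)))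
    (hM : ∀ᵐ s ∂volume.restrict (Ioc 0 T), ‖(v s).grad‖ ≤ M)
    (heq : ∀ w : X N, ∀ s ∈ Ioo 0 T,
      ∫ τ in (0 : ℝ)..s, (⟪g τ, w.fn⟫_ℝ + ⟪(v τ).grad, w.grad⟫_ℝ)
        = ∫ τ in (0 : ℝ)..s, reaction μ (v τ) w) :
    ∀ᵐ s, s ∈ Ioo 0 T → ∀ w : X N,
      ⟪g s, w.fn⟫_ℝ + ⟪(v s).grad, w.grad⟫_ℝ = reaction μ (v s) w := by
  rcases le_or_gt T 0 with hT | hT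
  · exact Eventually.of_forall fun s hs => absurd (hs.1.trans hs.2) hT.not_gt
  have hv := aestronglyMeasurable_of_grad hN hm
  have key : ∀ w : X N, ∀ᵐ s, s ∈ Ioo 0 T →
      ⟪g s, w.fn⟫_ℝ + ⟪(v s).grad, w.grad⟫_ℝ = reaction μ (v s) w := fun w => by
    obtain ⟨D, hD⟩ := exists_abs_reaction_le hN μ M w
    have i1 : IntervalIntegrable (fun τ => ⟪g τ, w.fn⟫_ℝ) volume 0 T := by
      rw [intervalIntegrable_iff_integrableOn_Ioc_of_le hT.le] at hg ⊢
      exact hg.inner_const _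
    have i2 : IntervalIntegrable (fun τ => ⟪(v τ).grad, w.grad⟫_ℝ) volume 0 T := by
      rw [intervalIntegrable_iff_integrableOn_Ioc_of_le hT.le]
      exact (Integrable.of_bound hm M hM).inner_const _
    have i3 : IntervalIntegrable (fun τ => reaction μ (v τ) w) volume 0 T := by
      rw [intervalIntegrable_iff_integrableOn_Ioc_of_le hT.le]
      refine Integrable.of_bound ?_ D (hM.mono fun s hs => hD _ hs)
      exact (continuous_reaction_left hN μ w).comp_aestronglyMeasurable hv
    have hsub : ∀ s ∈ Ioo 0 T, IntervalIntegrable (fun τ => ⟪g τ, w.fn⟫_ℝ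
        + ⟪(v τ).grad, w.grad⟫_ℝ) volume 0 s ∧
        IntervalIntegrable (fun τ => reaction μ (v τ) w) volume 0 s := fun s hs => by
      have hss : uIcc 0 s ⊆ uIcc 0 T := by
        rw [uIcc_of_le hs.1.le, uIcc_of_le hT.le]
        exact Icc_subset_Icc_right hs.2.le
      exact ⟨(i1.add i2).mono_set hss, i3.mono_set hss⟩
    -- The zero function is a primitive of the difference of the two sides, so that difference
    -- vanishes almost everywhere.
    have h0 := ae_hasDerivAt_of_eq_integral (u := fun _ => (0 : ℝ)) (u₀ := 0)
      ((i1.add i2).sub i3) fun s hs => by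
        rw [zero_add]
        refine Eq.symm ((intervalIntegral.integral_sub (hsub s hs).1 (hsub s hs).2).trans ?_)
        exact sub_eq_zero.2 (heq w s hs)
    filter_upwards [h0] with s hs hsT
    exact sub_eq_zero.1 ((hs hsT).unique (hasDerivAt_const s (0 : ℝ)))
  have : TopologicalSpace.SeparableSpace (X N) := X.separableSpace N
  -- A countable dense family gives one null set of times; continuity in `w` then covers all test
  -- functions.
  have hall := ae_all_iff.2 fun n => key (TopologicalSpace.denseSeq (X N) n)
  filter_upwards [hall] with s hs hsT w
  refine congrFun (Continuous.ext_on (TopologicalSpace.denseRange_denseSeq (X N))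
    (continuous_inner_fn_add_inner_grad (g s) (v s)) (continuous_reaction_right hN μ (v s)) ?_) w
  rintro _ ⟨n, rfl⟩
  exact hs n hsT

lemma measurableSet_timeInterval (S : EReal) : MeasurableSet (timeInterval S) :=
  measurableSet_Ioi.inter (measurable_coe_real_ereal measurableSet_Iio)

/-- The time derivative of a weak solution, and the equation it satisfies at almost every time. -/
lemma IsWeakSolution.exists_hasDerivAt (hN : 3 ≤ N) {μ : ℝ} {S : EReal} {v₀ : X N} {v : ℝ → X N}
    (h : IsWeakSolution μ S v₀ v) : ∃ (g : ℝ → L2K N) (M : ℝ),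
      MemLp g 2 (volume.restrict (timeInterval S)) ∧
      (∀ s ∈ timeInterval S, (v s).fn = v₀.fn + ∫ τ in (0 : ℝ)..s, g τ) ∧
      ∀ T ∈ timeInterval S, ∀ᵐ s, s ∈ Ioo 0 T → ‖(v s).grad‖ ≤ M ∧
        HasDerivAt (fun t => (v t).fn) (g s) s ∧
        ∀ w : X N, ⟪g s, w.fn⟫_ℝ + ⟪(v s).grad, w.grad⟫_ℝ = reaction μ (v s) w := by
  obtain ⟨-, hvm, g, hg, hu, heq⟩ := h
  have hM : ∀ᵐ s ∂volume.restrict (timeInterval S),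
      ‖(v s).grad‖ ≤ (eLpNormEssSup (fun s => (v s).grad) (volume.restrict (timeInterval S))).toReal := by
    filter_upwards [ae_le_eLpNormEssSup (f := fun s => (v s).grad)
      (μ := volume.restrict (timeInterval S))] with s hs
    have hlt := hvm.2
    rw [eLpNorm_exponent_top] at hlt
    rw [← toReal_enorm]
    exact ENNReal.toReal_mono hlt.ne hs
  refine ⟨g, (eLpNormEssSup (fun s => (v s).grad) (volume.restrict (timeInterval S))).toReal,
    hg, hu, fun T hT => ?_⟩
  have hsub : Ioc 0 T ⊆ timeInterval S := fun s hs =>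
    ⟨hs.1, (EReal.coe_le_coe_iff.2 hs.2).trans_lt hT.2⟩
  have hle : volume.restrict (Ioc 0 T) ≤ volume.restrict (timeInterval S) :=
    Measure.restrict_mono hsub le_rfl
  have hgi : IntervalIntegrable g volume 0 T := by
    rw [intervalIntegrable_iff_integrableOn_Ioc_of_le hT.1.le]
    exact (hg.mono_measure hle).integrable (by norm_num)
  have hIoo : ∀ s ∈ Ioo 0 T, s ∈ timeInterval S := fun s hs => hsub (Ioo_subset_Ioc_self hs)
  filter_upwards [(ae_restrict_iff' (measurableSet_timeInterval S)).1 hM,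
    ae_hasDerivAt_of_eq_integral hgi fun s hs => hu s (hIoo s hs),
    ae_weak_equation hN hgi (hvm.1.mono_measure hle) (ae_mono hle hM)
      fun w s hs => heq w s (hIoo s hs)] with s h1 h2 h3 hs
  exact ⟨h1 (hIoo s hs), h2 hs, h3 hs⟩

/-- Weak solutions on all finite intervals which are continuous with values in `X` are flows. -/
lemma isFlow_of_isWeakSolution (hN : 3 ≤ N) {μ : ℝ} {v₀ : X N} {v : ℝ → X N}
    (hc : ContinuousOn (fun s => (v s).grad) (Ici 0))
    (h : ∀ S : ℝ, 0 < S → IsWeakSolution μ (S : EReal) v₀ v) :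
    IsFlow μ (fun s => v (max 0 s)) ((Ioi 0).indicator (deriv fun t => (v t).fn)) ∧
      ∀ᵐ s, 0 < s → HasDerivAt (fun t => (v t).fn) (deriv (fun t => (v t).fn) s) s := by
  -- Each finite horizon supplies its own time derivative. The pointwise derivative is a common
  -- representative; it is zero at negative times, matching the constant extension of `v`.
  set G : ℝ → L2K N := (Ioi 0).indicator (deriv fun t => (v t).fn) with hG
  have hv0 : v 0 = v₀ := (h 1 one_pos).1
  have hmem : ∀ T : ℝ, 0 < T → T ∈ timeInterval ((T + 1 : ℝ) : EReal) := fun T hT =>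
    ⟨hT, EReal.coe_lt_coe_iff.2 (lt_add_one T)⟩
  have hloc : ∀ T : ℝ, 0 < T → ∃ g : ℝ → L2K N, MemLp g 2 (volume.restrict (Ioc 0 T)) ∧
      (v T).fn = v₀.fn + (∫ τ in (0 : ℝ)..T, g τ) ∧
      ∀ᵐ s, s ∈ Ioc 0 T → G s = g s ∧ HasDerivAt (fun t => (v t).fn) (G s) s ∧
        ∀ w : X N, ⟪G s, w.fn⟫_ℝ + ⟪(v s).grad, w.grad⟫_ℝ = reaction μ (v s) w := fun T hT => by
    obtain ⟨g, M, hg, hu, hae⟩ := (h (T + 1) (by linarith)).exists_hasDerivAt hN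
    refine ⟨g, hg.mono_measure (Measure.restrict_mono (fun s hs => ?_) le_rfl),
      hu T (hmem T hT), ?_⟩
    · exact ⟨hs.1, EReal.coe_lt_coe_iff.2 (hs.2.trans_lt (lt_add_one T))⟩
    · have hne : ∀ᵐ s : ℝ, s ≠ T := by simp [ae_iff, measure_singleton]
      filter_upwards [hae T (hmem T hT), hne] with s hs hsT hsI
      obtain ⟨-, hd, he⟩ := hs ⟨hsI.1, lt_of_le_of_ne hsI.2 hsT⟩
      have e : G s = g s := by rw [hG, indicator_of_mem (mem_Ioi.2 hsI.1), hd.deriv]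
      rw [e]
      exact ⟨rfl, hd, he⟩
  have hae : ∀ᵐ s, 0 < s → HasDerivAt (fun t => (v t).fn) (G s) s ∧
        ∀ w : X N, ⟪G s, w.fn⟫_ℝ + ⟪(v s).grad, w.grad⟫_ℝ = reaction μ (v s) w := by
    choose! g hg1 hg2 hg3 using hloc
    filter_upwards [ae_all_iff.2 fun n : ℕ => hg3 (n + 1 : ℝ) (by positivity)] with s hs hs0
    obtain ⟨n, hn⟩ := exists_nat_ge s
    exact (hs n ⟨hs0, by linarith⟩).2
  have hLp : ∀ a b, MemLp G 2 (volume.restrict (Ioc a b)) := fun a b => by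
    -- The maximum ensures a positive horizon whatever the sign of `b`.
    obtain ⟨g, hg, -, hgG⟩ := hloc (max b 1) (by positivity)
    have k := (memLp_indicator_iff_restrict measurableSet_Ioc).2 hg
    refine (k.restrict (Ioc a b)).ae_eq ((ae_restrict_iff' measurableSet_Ioc).2 ?_)
    filter_upwards [hgG] with s hs hsI
    rcases le_or_gt s 0 with h0 | h0
    · rw [indicator_of_notMem (fun hh => h0.not_gt hh.1), hG,
        indicator_of_notMem (notMem_Ioi.2 h0)]
    · have hsm : s ∈ Ioc 0 (max b 1) := ⟨h0, hsI.2.trans (le_max_left _ _)⟩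
      rw [indicator_of_mem hsm, (hs hsm).1]
  have hii : ∀ a b, IntervalIntegrable G volume a b := fun a b =>
    ⟨(hLp a b).integrable (by norm_num), (hLp b a).integrable (by norm_num)⟩
  have hint : ∀ t, (v (max 0 t)).fn = v₀.fn + ∫ τ in (0 : ℝ)..t, G τ := fun t => by
    rcases le_or_gt t 0 with h0 | h0
    · have e : ∫ τ in (0 : ℝ)..t, G τ = ∫ τ in (0 : ℝ)..t, (0 : L2K N) := by
        refine intervalIntegral.integral_congr_ae (Eventually.of_forall fun s hs => ?_)
        rw [uIoc_of_ge h0] at hs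
        exact indicator_of_notMem hs.2.not_gt _
      rw [max_eq_left h0, hv0, e, intervalIntegral.integral_zero, add_zero]
    · obtain ⟨g, -, hu, hgG⟩ := hloc t h0
      rw [max_eq_right h0.le, hu]
      congr 1
      refine intervalIntegral.integral_congr_ae ?_
      filter_upwards [hgG] with s hs hsI
      rw [uIoc_of_le h0.le] at hsI
      exact (hs hsI).1.symm
  refine ⟨⟨?_, ⟨hLp, fun s t => ?_⟩, ?_⟩, ?_⟩
  · refine (X.gradIsometry hN).isometry.isEmbedding.continuous_iff.2 ?_
    exact hc.comp_continuous (continuous_const.max continuous_id) fun s => le_max_left 0 s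
  · rw [hint, hint, add_sub_add_left_eq_sub, intervalIntegral.integral_interval_sub_left
      (hii _ _) (hii _ _)]
  · filter_upwards [hae] with s hs hs0
    rw [max_eq_right hs0.le]
    exact (hs hs0).2
  · filter_upwards [hae] with s hs hs0
    exact (hs hs0).1.differentiableAt.hasDerivAt

/-- Along global solutions the time derivative is square integrable, the equation holds at almost
every time, and the solution is bounded at the times at which its derivative is small. -/
lemma IsGlobalSolution.exists_memLp_hasDerivAt (hN : 3 ≤ N) {μ : ℝ}
    (hμ₁ : μ ≤ ((N : ℝ) - 2) ^ 2 / 8) {v₀ : X N} {v : ℝ → X N} (hv : IsGlobalSolution μ v₀ v) :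
    ∃ (g : ℝ → L2K N) (M : ℝ), MemLp g 2 (volume.restrict (Ioi 0)) ∧
      ∀ᵐ s, 0 < s → (‖g s‖ ≤ 1 → ‖(v s).grad‖ ≤ M) ∧
        HasDerivAt (fun t => (v t).fn) (g s) s ∧
        ∀ w : X N, ⟪g s, w.fn⟫_ℝ + ⟪(v s).grad, w.grad⟫_ℝ = reaction μ (v s) w := by
  -- In the first class both bounds are part of the definition; in the second they come from
  -- dissipation and nonnegative energy.
  rcases hv with hv | ⟨hc, hv⟩
  · obtain ⟨g, M, hg, -, hae⟩ := hv.exists_hasDerivAt hN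
    have hI : timeInterval ⊤ = Ioi 0 := by
      ext s; simp [timeInterval, EReal.coe_lt_top]
    rw [hI] at hg hae
    refine ⟨g, M, hg, ?_⟩
    filter_upwards [ae_all_iff.2 fun n : ℕ => hae (n + 1 : ℝ) (mem_Ioi.2 (by positivity))]
      with s hs hs0
    obtain ⟨n, hn⟩ := exists_nat_ge s
    obtain ⟨h1, h2⟩ := hs n ⟨hs0, by linarith⟩
    exact ⟨fun _ => h1, h2⟩
  · obtain ⟨hF, hd⟩ := isFlow_of_isWeakSolution hN hc hv
    obtain ⟨M, hM⟩ := hF.exists_norm_grad_le hN hμ₁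
    refine ⟨_, M, hF.memLp_Ioi hN hμ₁, ?_⟩
    filter_upwards [hM, hd, hF.eq] with s h1 h2 h3 hs0
    have h1' := h1 hs0
    have h3' := h3 hs0
    rw [max_eq_right hs0.le] at h1' h3'
    refine ⟨h1', ?_, h3'⟩
    rw [indicator_of_mem (mem_Ioi.2 hs0)]
    exact h2 hs0

end GlobalSolutions

end HardySobolev

end

theorem theorem6p2 (N : ℕ) (hN : 3 ≤ N) (μ : ℝ) (hμ₀ : 0 ≤ μ) (hμ₁ : μ ≤ ((N : ℝ) - 2) ^ 2 / 8)
    (v₀ : X N) (v : ℝ → X N) (hv : IsGlobalSolution μ v₀ v) :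
    ∃ w ∈ omegaLimitSet v, IsStationarySolution μ w ∧
      ∃ (s : ℕ → ℝ) (g : ℕ → L2K N), (∀ n, 0 < s n) ∧ Tendsto s atTop atTop ∧
        (∀ n, HasDerivAt (fun t => (v t).fn) (g n) (s n)) ∧
        Tendsto (fun n => ‖g n‖) atTop (𝓝 0) ∧
        IsPalaisSmale μ (fun n => v (s n)) ∧
        WeakTendsto (fun n => v (s n)) w := by
  obtain ⟨g, M, hg, hae⟩ := hv.exists_memLp_hasDerivAt hN hμ₁
  -- These times satisfy `s n > n` and `‖g (s n)‖ < 1/(n+1) ≤ 1`, so the bound `M` holds at every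
  -- one of them.
  obtain ⟨s, hs⟩ := exists_seq_norm_lt_of_memLp_Ioi hg hae
  have hpos : ∀ n, 0 < s n := fun n => n.cast_nonneg.trans_lt (hs n).1
  refine exists_stationary_of_seq hN μ hpos
    (tendsto_atTop_mono (fun n => (hs n).1.le) tendsto_natCast_atTop_atTop)
    (fun n => (hs n).2.1.2.1) ?_ (fun n => (hs n).2.1.1 ?_) fun n => (hs n).2.1.2.2
  · exact squeeze_zero (fun n => norm_nonneg _) (fun n => (hs n).2.2.le)
      tendsto_one_div_add_atTop_nhds_zero_nat
  · refine (hs n).2.2.le.trans ?_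
    rw [div_le_one (by positivity)]
    linarith [(n.cast_nonneg : (0 : ℝ) ≤ n)]
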